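/- **Proposition (Asymptotic approach rates).** Let $k_0,k_1,k_2\ge 0$ and $\alpha,\beta,\Gamma,\omega,\theta>0$, and put $$f(u,v,P)=\frac{(1+P)^{k_1}\,\Gamma u(1-u)}{1+e^{-\beta(v-\alpha)}}-\omega u,\qquad g(u,v,P)=1-(1+P)^{-k_2}\theta(1+u)^{-k_0}v,\qquad s(u,v,P)=u(1-P),$$ $F=(f,g,s)$. Let $0\le P_+<1$, let $\hat{\mathbf u}_+=\bigl(0,(1+P_+)^{k_2}/\theta,P_+\bigr)$ be a trivial steady state and let $\hat{\mathbf u}_-=(u^*,v^*,1)$ be a steady state, $F(\hat{\mathbf u}_-)=0$, with $f_vg_u-f_ug_v<0$ at $\hat{\mathbf u}_-$. Let $c\in\mathbb R$ and let $\hat{\mathbf u}=(\hat u,\hat v,\hat P)$, with $\hat u,\hat v\in C^2(\mathbb R)$, $\hat P\in C^1(\mathbb R)$, be a monotone traveling wave of speed $c$ from $\hat{\mathbf u}_-$ to $\hat{\mathbf u}_+$, that is, $$\hat u''+c\hat u'+f(\hat{\mathbf u})=0,\quad \hat v''+c\hat v'+g(\hat{\mathbf u})=0,\quad c\hat P'+s(\hat{\mathbf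 u})=0,\qquad \lim_{z\to\pm\infty}\hat{\mathbf u}(z)=\hat{\mathbf u}_\pm,$$ with $\hat u,\hat v\ge0$, $0\le\hat P\le1$ and $\hat u',\hat v'<0$. Write $f_u^{+},g_v^{+}$ for $f_u(\hat{\mathbf u}_+),g_v(\hat{\mathbf u}_+)$, and $$\lambda_{2,3}=\frac{-c\pm\sqrt{c^2-4f_u^{+}}}{2},\qquad \lambda_{5}=\frac{-c-\sqrt{c^2-4g_v^{+}}}{2},$$ with the plus sign for $\lambda_2$ and the minus sign for $\lambda_3$; with all derivatives taken at $\hat{\mathbf u}_-$, $$\mu_{1,2}=-(f_u+g_v)\pm\sqrt{(f_u+g_v)^2+4f_vg_u-4f_ug_v},\qquad \tilde\lambda_1=\frac{u^*}{c},\qquad \tilde\lambda_2=\frac{-c+\sqrt{c^2+2\mu_2}}{2}.$$ Let $A_\pm$ be the $5\times5$ matrix of the linearization at $(\hat{\mathbf u}_\pm,0,0)$ of the system $u'=w$, $v'=y$, $P'=-\frac1c s$, $w'=-cw-f$, $y'=-cy-g$. The *principal eigenvalue* of $A_+$ is its negative eigenvalue of smallest magnitude, that of $A_-$ is its positive eigenvalue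 of smallest magnitude. Inequalities between vectors are entrywise. Let $I=[0,\infty)$ in cases 1–5 and $I=(-\infty,0]$ in cases 6–9. For a rate $\lambda$ and $S\subseteq\{u,v,P\}$, we say that $D:\mathbb R\to\mathbb R^3$ satisfies * $B(\lambda,S)$ if there are nonnegative vectors $\mathbf k,\mathbf K$, where the entries of $\mathbf k$ in $S$ are positive, with $\mathbf k e^{\lambda z}\le D(z)\le\mathbf Ke^{\lambda z}$ for $z\in I$; * $B_\epsilon(\lambda,S)$ if for every $\epsilon>0$ there are nonnegative vectors $\mathbf k_\epsilon,\mathbf K_\epsilon$, where the entries of $\mathbf k_\epsilon$ in $S$ are positive, with $\mathbf k_\epsilon e^{\lambda z-\epsilon|z|}\le D(z)\le\mathbf K_\epsilon e^{\lambda z+\epsilon|z|}$ for $z\in I$, and they can be chosen so that every entry of $\mathbf K_\epsilon$ tends to $\infty$ as $\epsilon\to0^+$. As $z\to+\infty$: **both** $D=\hat{\mathbf u}-\hat{\mathbf u}_+$ **and** $D=-\hat{\mathbf u}'$ satisfy 1. $B(\lambda_5,\{v\})$ if $f_u^+<g_v^+$; 2. $B_\epsilon(\lambda_5,\{u,v,P\})$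 if $f_u^+=g_v^+$; 3. $B(\lambda_3,\{u,v,P\})$ if $g_v^+<f_u^+<0$; 4. if $f_u^+>0$ and $c>2\sqrt{f_u^+}$: $B(\lambda_2,\{u,v,P\})$ whenever $c$ exceeds the minimal wave speed (i.e. there is also a monotone traveling wave from $\hat{\mathbf u}_-$ to $\hat{\mathbf u}_+$, in the above sense, of some speed $c'<c$); and, whether or not $c$ is the minimal speed, $B(\lambda,\{u,v,P\})$ for a $\lambda\in\{\lambda_2,\lambda_3\}$, the same for both $D$; 5. $B_\epsilon(\lambda_2,\{u,v,P\})$ if $f_u^+>0$ and $c=2\sqrt{f_u^+}$. As $z\to-\infty$: **both** $D=\hat{\mathbf u}_--\hat{\mathbf u}$ **and** $D=-\hat{\mathbf u}'$ satisfy 6. $B(\tilde\lambda_1,S)$ if $\tilde\lambda_1<\tilde\lambda_2$, where $S=\{u,v,P\}$ if $k_1>0$ or $k_2>0$, and $S=\{P\}$ otherwise; 7. $B_\epsilon(\tilde\lambda_1,\{u,v,P\})$ if $\tilde\lambda_1=\tilde\lambda_2$; 8. $B_\epsilon(\tilde\lambda_2,\{u,v\})$ if $\tilde\lambda_2<\tilde\lambda_1$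 and $\mu_1=\mu_2$; 9. $B(\tilde\lambda_2,S)$ if $\tilde\lambda_2<\tilde\lambda_1$ and $\mu_1\ne\mu_2$, where $S=\{u,v\}$ if $k_0>0$ or $f_u(\hat{\mathbf u}_-)<g_v(\hat{\mathbf u}_-)$, and $S=\{u\}$ otherwise. Moreover, the principal eigenvalue of $A_+$ is $\lambda_5,\lambda_5,\lambda_3,\lambda_2,\lambda_2$ in cases 1–5, respectively, and that of $A_-$ is $\tilde\lambda_1,\tilde\lambda_1,\tilde\lambda_2,\tilde\lambda_2$ in cases 6–9. -/

import Mathlib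

open Filter Topology

noncomputable section

namespace Protest

/-- Parameters of the activity / tension / police system. -/
structure Params where
  k0 : ℝ
  k1 : ℝ
  k2 : ℝ
  alpha : ℝ
  beta : ℝ
  Gam : ℝ
  omega : ℝ
  theta : ℝ

/-- The parameter range of the monotone (tension-enhancing) regime. -/
structure Params.Admissible (p : Params) : Prop where
  k0_nonneg : 0 ≤ p.k0
  k1_nonneg : 0 ≤ p.k1
  k2_nonneg : 0 ≤ p.k2
  alpha_pos : 0 < p.alpha
  beta_pos : 0 < p.beta
  Gam_pos : 0 < p.Gam
  omega_pos : 0 < p.omega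
  theta_pos : 0 < p.theta

/-- Source term of the protest activity `u`. -/
def Params.f (p : Params) (u v P : ℝ) : ℝ :=
  (1 + P) ^ p.k1 * (1 / (1 + Real.exp (-p.beta * (v - p.alpha)))) * p.Gam * u * (1 - u)
    - p.omega * u

/-- Source term of the social tension `v`. -/
def Params.g (p : Params) (u v P : ℝ) : ℝ :=
  1 - (1 + P) ^ (-p.k2) * p.theta * (1 + u) ^ (-p.k0) * v

/-- Source term of the police density `P`. -/
def Params.s (_p : Params) (u _v P : ℝ) : ℝ := u * (1 - P)

/-- The source `F = (f, g, s)`; the coordinates `0, 1, 2` are `u, v, P`. -/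
def Params.F (p : Params) (x : Fin 3 → ℝ) : Fin 3 → ℝ :=
  ![p.f (x 0) (x 1) (x 2), p.g (x 0) (x 1) (x 2), p.s (x 0) (x 1) (x 2)]

/-- Jacobian matrix of a vector field: entry `(i, j)` is `∂ Fᵢ / ∂ xⱼ`. -/
def jacobian {n : ℕ} (F : (Fin n → ℝ) → (Fin n → ℝ)) (x : Fin n → ℝ) :
    Matrix (Fin n) (Fin n) ℝ :=
  fun i j => fderiv ℝ F x (Pi.single j 1) i

def Params.fu (p : Params) (x : Fin 3 → ℝ) : ℝ := jacobian p.F x 0 0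
def Params.fv (p : Params) (x : Fin 3 → ℝ) : ℝ := jacobian p.F x 0 1
def Params.gu (p : Params) (x : Fin 3 → ℝ) : ℝ := jacobian p.F x 1 0
def Params.gv (p : Params) (x : Fin 3 → ℝ) : ℝ := jacobian p.F x 1 1

/-- The trivial steady state with police density `P`. -/
def Params.trivialState (p : Params) (P : ℝ) : Fin 3 → ℝ :=
  ![0, (1 + P) ^ p.k2 / p.theta, P]

/-- The diagonal of the diffusion matrix `diag(1, 1, 0)`. -/
def diffusion : Fin 3 → ℝ := ![1, 1, 0]

/-- `U` is a traveling wave profile, in `z = x - c t`, of the system, running from `Um` at `-∞` to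
`Up` at `+∞`, with `u, v ≥ 0`, `0 ≤ P ≤ 1` and `u', v' < 0`. -/
structure IsMonotoneWave (p : Params) (c : ℝ) (Up Um : Fin 3 → ℝ) (U : ℝ → Fin 3 → ℝ) :
    Prop where
  smooth_u : ContDiff ℝ 2 (fun z => U z 0)
  smooth_v : ContDiff ℝ 2 (fun z => U z 1)
  smooth_P : ContDiff ℝ 1 (fun z => U z 2)
  ode : ∀ z i, diffusion i * deriv (deriv (fun t => U t i)) z
    + c * deriv (fun t => U t i) z + p.F (U z) i = 0
  lim_top : Tendsto U atTop (𝓝 Up)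
  lim_bot : Tendsto U atBot (𝓝 Um)
  u_nonneg : ∀ z, 0 ≤ U z 0
  v_nonneg : ∀ z, 0 ≤ U z 1
  P_nonneg : ∀ z, 0 ≤ U z 2
  P_le_one : ∀ z, U z 2 ≤ 1
  u_decreasing : ∀ z, deriv (fun t => U t 0) z < 0
  v_decreasing : ∀ z, deriv (fun t => U t 1) z < 0

/-- Monotone waves between the same two states exist for some smaller speed, that is, `c` exceeds
the minimal wave speed. -/
def ExceedsMinimalSpeed (p : Params) (c : ℝ) (Up Um : Fin 3 → ℝ) : Prop :=
  ∃ c' < c, ∃ W : ℝ → Fin 3 → ℝ, IsMonotoneWave p c' Up Um W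

/-- The traveling wave equations as a first-order system for `(u, v, P, w, y)`,
`w = u'`, `y = v'`. -/
def Params.waveField (p : Params) (c : ℝ) (Y : Fin 5 → ℝ) : Fin 5 → ℝ :=
  ![Y 3,
    Y 4,
    -(1 / c) * p.s (Y 0) (Y 1) (Y 2),
    -c * Y 3 - p.f (Y 0) (Y 1) (Y 2),
    -c * Y 4 - p.g (Y 0) (Y 1) (Y 2)]

/-- Linearization of the first-order system at the rest point `(x, 0, 0)`. -/
def Params.waveMatrix (p : Params) (c : ℝ) (x : Fin 3 → ℝ) : Matrix (Fin 5) (Fin 5) ℝ :=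
  jacobian (p.waveField c) ![x 0, x 1, x 2, 0, 0]

/-- The negative eigenvalue of smallest magnitude (governing `z → +∞`). -/
def IsPrincipalAtTop (A : Matrix (Fin 5) (Fin 5) ℝ) (lam : ℝ) : Prop :=
  IsGreatest {r : ℝ | r < 0 ∧ Module.End.HasEigenvalue (Matrix.toLin' A) r} lam

/-- The positive eigenvalue of smallest magnitude (governing `z → -∞`). -/
def IsPrincipalAtBot (A : Matrix (Fin 5) (Fin 5) ℝ) (lam : ℝ) : Prop :=
  IsLeast {r : ℝ | 0 < r ∧ Module.End.HasEigenvalue (Matrix.toLin' A) r} lam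

def rootPlus (c q : ℝ) : ℝ := (-c + √(c ^ 2 - 4 * q)) / 2
def rootMinus (c q : ℝ) : ℝ := (-c - √(c ^ 2 - 4 * q)) / 2

def Params.mu1 (p : Params) (x : Fin 3 → ℝ) : ℝ :=
  -(p.fu x + p.gv x)
    + √((p.fu x + p.gv x) ^ 2 + 4 * p.fv x * p.gu x - 4 * p.fu x * p.gv x)

def Params.mu2 (p : Params) (x : Fin 3 → ℝ) : ℝ :=
  -(p.fu x + p.gv x)
    - √((p.fu x + p.gv x) ^ 2 + 4 * p.fv x * p.gu x - 4 * p.fu x * p.gv x)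

/-- `k e^{λ z} ≤ D(z) ≤ K e^{λ z}` entrywise on `I`, with nonnegative vectors `k`, `K` and
`k` positive in the entries from `S`. -/
def ExpBounds (I : Set ℝ) (lam : ℝ) (S : Set (Fin 3)) (D : ℝ → Fin 3 → ℝ) : Prop :=
  ∃ k K : Fin 3 → ℝ, (∀ i, 0 ≤ k i) ∧ (∀ i ∈ S, 0 < k i) ∧ (∀ i, 0 ≤ K i) ∧
    ∀ z ∈ I, ∀ i, k i * Real.exp (lam * z) ≤ D z i ∧ D z i ≤ K i * Real.exp (lam * z)

/-- The version with an arbitrarily small loss `ε` in the rate, whose upper constants blow up as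
`ε → 0`. For `z ≥ 0` the two exponents are `(λ - ε) z` and `(λ + ε) z`; for `z ≤ 0` they are
`(λ + ε) z` and `(λ - ε) z`. -/
def ExpBoundsLoss (I : Set ℝ) (lam : ℝ) (S : Set (Fin 3)) (D : ℝ → Fin 3 → ℝ) : Prop :=
  ∃ k K : ℝ → Fin 3 → ℝ,
    (∀ i, Tendsto (fun ε => K ε i) (𝓝[>] 0) atTop) ∧
    ∀ ε > 0, (∀ i, 0 ≤ k ε i) ∧ (∀ i ∈ S, 0 < k ε i) ∧ (∀ i, 0 ≤ K ε i) ∧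
      ∀ z ∈ I, ∀ i, k ε i * Real.exp (lam * z - ε * |z|) ≤ D z i ∧
        D z i ≤ K ε i * Real.exp (lam * z + ε * |z|)

/-- `z ↦ -U'(z)`. -/
def negDeriv (U : ℝ → Fin 3 → ℝ) : ℝ → Fin 3 → ℝ := fun z i => -deriv (fun t => U t i) z

/-- Bounds, for `z ≥ 0`, on `U - Up` and on `-U'`. -/
def RateAtTop (Up : Fin 3 → ℝ) (U : ℝ → Fin 3 → ℝ) (lam : ℝ) (S : Set (Fin 3)) : Prop :=
  ExpBounds (Set.Ici 0) lam S (fun z => U z - Up) ∧ ExpBounds (Set.Ici 0) lam S (negDeriv U)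

def RateAtTopLoss (Up : Fin 3 → ℝ) (U : ℝ → Fin 3 → ℝ) (lam : ℝ) (S : Set (Fin 3)) : Prop :=
  ExpBoundsLoss (Set.Ici 0) lam S (fun z => U z - Up) ∧
    ExpBoundsLoss (Set.Ici 0) lam S (negDeriv U)

/-- Bounds, for `z ≤ 0`, on `Um - U` and on `-U'`. -/
def RateAtBot (Um : Fin 3 → ℝ) (U : ℝ → Fin 3 → ℝ) (lam : ℝ) (S : Set (Fin 3)) : Prop :=
  ExpBounds (Set.Iic 0) lam S (fun z => Um - U z) ∧ ExpBounds (Set.Iic 0) lam S (negDeriv U)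

def RateAtBotLoss (Um : Fin 3 → ℝ) (U : ℝ → Fin 3 → ℝ) (lam : ℝ) (S : Set (Fin 3)) : Prop :=
  ExpBoundsLoss (Set.Iic 0) lam S (fun z => Um - U z) ∧
    ExpBoundsLoss (Set.Iic 0) lam S (negDeriv U)

end Protest

end

/-!
# Asymptotic rates of monotone waves

Let `d = -U' > 0`. Its `u`- and `v`-components solve the linearized equations
`dᵢ'' + c dᵢ' + ∑ⱼ Jᵢⱼ(U) dⱼ = 0`, whose coupling is nonnegative (the system is cooperative), and
`-P' = u (1 - P) / c`. All rates are proved for `d`; those for the distance to the limit follow by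
integration. The behaviour at `-∞` is that of the reflected wave at `+∞`, with `-c` in place of `c`.

*Comparison.* Near a state where the coupled part of the linearization is stable, a maximum
principle (`nonneg_of_localMin`, `IsStableCoop.comparison`) compares `d` with explicit exponentials.
A strict supersolution `φ e^{lz}` gives an upper bound at rate `l`, a strict subsolution or a forcing
of that rate a lower one. At a simple root `l`, with exponentially small errors in the coefficients,
`φ (e^{lz} ∓ e^{(l - δ)z})` gives sharp bounds (`IsStableCoop.isBigO_exp_sharp`,
`IsStableCoop.exp_isBigO_sharp`), where `φ` is a Perron vector.

*At `+∞`*, `u'' + c u' + h u = 0` with `h → f_u`, which may be positive, so that comparison is not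
available for `u`. Instead `r = -u'/u` solves `r' = r² - c r + h`; it can cross each level other than
a root of `r² - c r + f_u` in one direction only, hence converges to a root (`riccati_tendsto`), and
at a simple root the convergence is exponential (`isBigO_exp_of_linear`). This fixes the rate of `u`
up to an arbitrarily small loss, respectively sharply. The rates of `P` and `v` follow by
integration and by comparison in the equation of `v`; the forcing of `v` does not vanish, because
for `k₀ = k₂ = 0` both steady states would have the same `v` (`IsFront.k0_pos_or_k2_pos`).

*At `-∞`*, `1 - P` has the logarithmic derivative `u / c → u* / c`, and the pair `(-u', -v')` is
compared with the Perron mode of its `2 × 2` block. Whichever rate is smaller dominates. If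
`k₀ = 0` the block is triangular and the Perron vector may degenerate; then the two equations are
treated one after the other.

*Above the minimal speed* the steep rate is excluded by sliding: a wave `W` of smaller speed is a
strict supersolution and decays more slowly than a steep wave `U`. Hence some shift of `W` lies above
`U`, and the smallest such shift would have to touch `U`, which the maximum principle forbids
(`IsFront.false_of_faster_decay`).

The eigenvalues of the first-order system solve a quadratic eigenvalue problem that is block
triangular at both steady states.
-/

namespace Protest

/-! ### A maximum principle for cooperative systems on a half-line -/

/-- Maximum principle on `[Z, ∞)` for finitely many functions, coupled by matrices `A z` with
nonnegative off-diagonal entries that map a fixed positive vector `φ` to a negative one. The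
differential inequality enters only through its consequence at interior local minima, so that
equations of first and of second order are covered alike. -/
theorem nonneg_of_localMin {ι : Type*} [Fintype ι] {w : ι → ℝ → ℝ} {A : ℝ → ι → ι → ℝ}
    {φ : ι → ℝ} {Z : ℝ} (hφ : ∀ i, 0 < φ i) (hcont : ∀ i, ContinuousOn (w i) (Set.Ici Z))
    (hZ : ∀ i, 0 ≤ w i Z) (hlim : ∀ i, ∀ ε > 0, ∀ᶠ z in atTop, -ε < w i z)
    (hoff : ∀ z > Z, ∀ i j, i ≠ j → 0 ≤ A z i j)
    (hneg : ∀ z > Z, ∀ i, ∑ j, A z i j * φ j < 0)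
    (hmin : ∀ z > Z, ∀ i, IsLocalMin (w i) z → w i z < 0 → ∑ j, A z i j * w j z ≤ 0) :
    ∀ z ≥ Z, ∀ i, 0 ≤ w i z := by
  classical
  by_contra! hcon
  obtain ⟨z₁, hz₁, i₁, hi₁⟩ := hcon
  have hne : (Finset.univ : Finset ι).Nonempty := ⟨i₁, Finset.mem_univ _⟩
  set G : ℝ → ℝ := fun z => Finset.univ.inf' hne (fun i => w i z / φ i) with hG
  have hGle : ∀ z i, G z ≤ w i z / φ i := fun z i =>
    Finset.inf'_le (fun i => w i z / φ i) (Finset.mem_univ i)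
  have hGc : ContinuousOn G (Set.Ici Z) := by
    apply ContinuousOn.finset_inf'_apply
    intro i _
    exact (hcont i).div_const _
  have hG₁ : G z₁ < 0 := (hGle z₁ i₁).trans_lt (div_neg_of_neg_of_pos hi₁ (hφ i₁))
  have hfar : ∀ᶠ z in atTop, G z₁ < G z := by
    have : ∀ᶠ z in atTop, ∀ i, -(-G z₁ * φ i) < w i z :=
      eventually_all.2 fun i => hlim i _ (mul_pos (neg_pos.2 hG₁) (hφ i))
    filter_upwards [this] with z hz
    rw [hG, Finset.lt_inf'_iff]
    intro i _
    rw [lt_div_iff₀ (hφ i)]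
    simpa using hz i
  obtain ⟨B, hB⟩ := eventually_atTop.1 hfar
  have hzB : z₁ ∈ Set.Icc Z (max B z₁) := ⟨hz₁, le_max_right _ _⟩
  obtain ⟨z₀, hz₀, hmin₀⟩ := (isCompact_Icc (a := Z) (b := max B z₁)).exists_isMinOn ⟨z₁, hzB⟩
    (hGc.mono Set.Icc_subset_Ici_self)
  have hG₀ : G z₀ ≤ G z₁ := hmin₀ hzB
  have hglob : ∀ z ≥ Z, G z₀ ≤ G z := by
    intro z hz
    by_cases h : z ≤ max B z₁
    · exact hmin₀ ⟨hz, h⟩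
    · exact hG₀.trans (hB z ((le_max_left _ _).trans (not_le.1 h).le)).le
  have hzZ : Z < z₀ := by
    refine lt_of_le_of_ne hz₀.1 ?_
    rintro rfl
    have : 0 ≤ G Z := by
      rw [hG, Finset.le_inf'_iff]
      exact fun i _ => div_nonneg (hZ i) (hφ i).le
    linarith
  obtain ⟨i, -, hi⟩ := Finset.exists_mem_eq_inf' hne (fun i => w i z₀ / φ i)
  change G z₀ = w i z₀ / φ i at hi
  have hwi : w i z₀ = G z₀ * φ i := by rw [hi, div_mul_cancel₀ _ (hφ i).ne']
  have hge : ∀ z ≥ Z, ∀ j, G z₀ * φ j ≤ w j z := fun z hz j =>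
    (le_div_iff₀ (hφ j)).1 ((hglob z hz).trans (hGle z j))
  have hloc : IsLocalMin (w i) z₀ := by
    filter_upwards [lt_mem_nhds hzZ] with z hz
    rw [hwi]
    exact hge z hz.le i
  have h1 := hmin z₀ hzZ i hloc (by rw [hwi]; exact mul_neg_of_neg_of_pos (by linarith) (hφ i))
  have h2 : G z₀ * ∑ j, A z₀ i j * φ j ≤ ∑ j, A z₀ i j * w j z₀ := by
    rw [Finset.mul_sum]
    refine Finset.sum_le_sum fun j _ => ?_
    by_cases hij : i = j
    · subst hij; rw [hwi]; linarith
    · have := mul_le_mul_of_nonneg_left (hge z₀ hzZ.le j) (hoff z₀ hzZ i j hij)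
      linarith
  have h3 := mul_pos_of_neg_of_neg (hG₀.trans_lt hG₁) (hneg z₀ hzZ i)
  linarith

/-- `w₁` and `w₂` are the first and the second derivative of `w`. -/
def HasDerivs (w w₁ w₂ : ℝ → ℝ) : Prop :=
  (∀ z, HasDerivAt w (w₁ z) z) ∧ ∀ z, HasDerivAt w₁ (w₂ z) z

theorem HasDerivs.continuous {w w₁ w₂ : ℝ → ℝ} (h : HasDerivs w w₁ w₂) : Continuous w :=
  continuous_iff_continuousAt.2 fun z => (h.1 z).continuousAt

theorem HasDerivs.sub {w w₁ w₂ s s₁ s₂ : ℝ → ℝ} (h : HasDerivs w w₁ w₂)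
    (h' : HasDerivs s s₁ s₂) :
    HasDerivs (fun z => w z - s z) (fun z => w₁ z - s₁ z) (fun z => w₂ z - s₂ z) :=
  ⟨fun z => (h.1 z).sub (h'.1 z), fun z => (h.2 z).sub (h'.2 z)⟩

theorem HasDerivs.add {w w₁ w₂ s s₁ s₂ : ℝ → ℝ} (h : HasDerivs w w₁ w₂)
    (h' : HasDerivs s s₁ s₂) :
    HasDerivs (fun z => w z + s z) (fun z => w₁ z + s₁ z) (fun z => w₂ z + s₂ z) :=
  ⟨fun z => (h.1 z).add (h'.1 z), fun z => (h.2 z).add (h'.2 z)⟩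

theorem HasDerivs.const_mul {w w₁ w₂ : ℝ → ℝ} (k : ℝ) (h : HasDerivs w w₁ w₂) :
    HasDerivs (fun z => k * w z) (fun z => k * w₁ z) (fun z => k * w₂ z) :=
  ⟨fun z => (h.1 z).const_mul k, fun z => (h.2 z).const_mul k⟩

theorem hasDerivAt_exp_mul (l z : ℝ) :
    HasDerivAt (fun z => Real.exp (l * z)) (l * Real.exp (l * z)) z := by
  have := ((hasDerivAt_id z).const_mul l).exp
  simpa [mul_comm] using this

theorem hasDerivs_exp (l : ℝ) :
    HasDerivs (fun z => Real.exp (l * z)) (fun z => l * Real.exp (l * z))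
      (fun z => l ^ 2 * Real.exp (l * z)) := by
  refine ⟨hasDerivAt_exp_mul l, fun z => ?_⟩
  exact ((hasDerivAt_exp_mul l z).const_mul l).congr_deriv (by ring)

/-- Necessary conditions of first and second order at a local minimum. -/
theorem HasDerivs.of_isLocalMin {w w₁ w₂ : ℝ → ℝ} (h : HasDerivs w w₁ w₂) {z : ℝ}
    (hz : IsLocalMin w z) : w₁ z = 0 ∧ 0 ≤ w₂ z := by
  have h0 : w₁ z = 0 := hz.hasDerivAt_eq_zero (h.1 z)
  refine ⟨h0, ?_⟩
  by_contra! hlt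
  have hd : deriv w = w₁ := funext fun t => (h.1 t).deriv
  have hmax : IsLocalMax w z := by
    refine isLocalMax_of_deriv_deriv_neg ?_ ?_ (h.1 z).continuousAt
    · rw [hd, (h.2 z).deriv]; exact hlt
    · rw [hd, h0]
  have hconst : w =ᶠ[𝓝 z] fun _ => w z := by
    filter_upwards [hz, hmax] with t h1 h2 using le_antisymm h2 h1
  have hd1 : w₁ =ᶠ[𝓝 z] fun _ => 0 := by
    have := hconst.deriv
    rw [hd] at this
    simpa using this
  have := hd1.deriv_eq
  rw [(h.2 z).deriv] at this
  simp at this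
  linarith

/-- The operator `w ↦ w'' + c w' + A w`, component `i`, at `z`. -/
def sysOp {ι : Type*} [Fintype ι] (c : ℝ) (A : ℝ → ι → ι → ℝ) (w w₁ w₂ : ι → ℝ → ℝ) (i : ι)
    (z : ℝ) : ℝ :=
  w₂ i z + c * w₁ i z + ∑ j, A z i j * w j z

/-- Matrix functions which eventually have nonnegative off-diagonal entries, and whose limit maps
some positive vector to a negative one: the zeroth-order terms for which the maximum principle
holds near `+∞`. -/
structure IsStableCoop {ι : Type*} [Fintype ι] (A : ℝ → ι → ι → ℝ) (A₀ : ι → ι → ℝ) : Prop where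
  tendsto : ∀ i j, Tendsto (fun z => A z i j) atTop (𝓝 (A₀ i j))
  offDiag : ∀ᶠ z in atTop, ∀ i j, i ≠ j → 0 ≤ A z i j
  exists_pos : ∃ φ : ι → ℝ, (∀ i, 0 < φ i) ∧ ∀ i, ∑ j, A₀ i j * φ j < 0

theorem IsStableCoop.eventually_sum_lt {ι : Type*} [Fintype ι] {A : ℝ → ι → ι → ℝ}
    {A₀ : ι → ι → ℝ} (h : IsStableCoop A A₀) (φ : ι → ℝ) {r : ι → ℝ}
    (hr : ∀ i, ∑ j, A₀ i j * φ j < r i) :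
    ∀ᶠ z in atTop, ∀ i, ∑ j, A z i j * φ j < r i :=
  eventually_all.2 fun i =>
    (tendsto_finsetSum _ fun j _ => (h.tendsto i j).mul_const (φ j)).eventually_lt_const (hr i)

theorem IsStableCoop.eventually_lt_sum {ι : Type*} [Fintype ι] {A : ℝ → ι → ι → ℝ}
    {A₀ : ι → ι → ℝ} (h : IsStableCoop A A₀) (φ : ι → ℝ) {r : ι → ℝ}
    (hr : ∀ i, r i < ∑ j, A₀ i j * φ j) :
    ∀ᶠ z in atTop, ∀ i, r i < ∑ j, A z i j * φ j :=
  eventually_all.2 fun i =>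
    (tendsto_finsetSum _ fun j _ => (h.tendsto i j).mul_const (φ j)).eventually_const_lt (hr i)

/-- Comparison near `+∞`: if `L s ≤ -b ≤ 0`, `L a ≥ -C b`, `s > 0` and `a → 0`, then a multiple of
`s` dominates `a`. Upper bounds for a solution take it as `a`, lower bounds take it as `s`. -/
theorem IsStableCoop.comparison {ι : Type*} [Fintype ι] {A : ℝ → ι → ι → ℝ}
    {A₀ : ι → ι → ℝ} (hA : IsStableCoop A A₀) {c C : ℝ} {a a₁ a₂ s s₁ s₂ : ι → ℝ → ℝ}
    {b : ι → ℝ → ℝ}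
    (ha : ∀ i, HasDerivs (a i) (a₁ i) (a₂ i)) (hs : ∀ i, HasDerivs (s i) (s₁ i) (s₂ i))
    (hs0 : ∀ᶠ z in atTop, ∀ i, 0 < s i z) (ha0 : ∀ i, Tendsto (a i) atTop (𝓝 0))
    (hb : ∀ᶠ z in atTop, ∀ i, 0 ≤ b i z)
    (hLs : ∀ᶠ z in atTop, ∀ i, sysOp c A s s₁ s₂ i z ≤ -b i z)
    (hLa : ∀ᶠ z in atTop, ∀ i, -(C * b i z) ≤ sysOp c A a a₁ a₂ i z) :
    ∃ K > 0, ∀ᶠ z in atTop, ∀ i, a i z ≤ K * s i z := by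
  obtain ⟨φ, hφ, hneg⟩ := hA.exists_pos
  have hneg' := hA.eventually_sum_lt φ hneg
  obtain ⟨Z, hZ⟩ := eventually_atTop.1
    (hs0.and (hb.and (hLs.and (hLa.and (hneg'.and hA.offDiag)))))
  set K : ℝ := 1 + |C| + ∑ i, |a i Z| / s i Z with hK
  have hterm : ∀ i, 0 ≤ |a i Z| / s i Z := fun i =>
    div_nonneg (abs_nonneg _) ((hZ Z le_rfl).1 i).le
  have hK1 : 0 < K := by
    have := Finset.sum_nonneg (s := Finset.univ) fun i _ => hterm i
    have := abs_nonneg C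
    linarith
  have hKC : C ≤ K := by
    have := Finset.sum_nonneg (s := Finset.univ) fun i _ => hterm i
    have := le_abs_self C
    linarith
  have hKs : ∀ i, a i Z ≤ K * s i Z := by
    intro i
    have h1 : |a i Z| / s i Z ≤ K := by
      have := Finset.single_le_sum (fun i _ => hterm i) (Finset.mem_univ i)
      have := abs_nonneg C
      linarith
    rw [div_le_iff₀ ((hZ Z le_rfl).1 i)] at h1
    exact (le_abs_self _).trans h1
  refine ⟨K, hK1, ?_⟩
  have hD : ∀ i, HasDerivs (fun z => K * s i z - a i z) (fun z => K * s₁ i z - a₁ i z)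
      (fun z => K * s₂ i z - a₂ i z) := fun i => ((hs i).const_mul K).sub (ha i)
  have key := nonneg_of_localMin (w := fun i z => K * s i z - a i z) (A := A) (φ := φ) (Z := Z) hφ
    (fun i => (hD i).continuous.continuousOn) (fun i => sub_nonneg.2 (hKs i))
    (by
      intro i ε hε
      filter_upwards [(ha0 i).eventually_lt_const hε, hs0] with z h1 h2
      have := mul_pos hK1 (h2 i)
      linarith)
    (fun z hz => (hZ z hz.le).2.2.2.2.2)
    (fun z hz => (hZ z hz.le).2.2.2.2.1)
    (by
      intro z hz i hloc _
      obtain ⟨h1, h2⟩ := (hD i).of_isLocalMin hloc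
      have h3 := (hZ z hz.le).2.2.1 i
      have h4 := (hZ z hz.le).2.2.2.1 i
      have h5 := (hZ z hz.le).2.1 i
      have h6 : ∑ j, A z i j * (K * s j z - a j z)
          = K * (∑ j, A z i j * s j z) - ∑ j, A z i j * a j z := by
        rw [Finset.mul_sum, ← Finset.sum_sub_distrib]
        exact Finset.sum_congr rfl fun j _ => by ring
      rw [h6]
      unfold sysOp at h3 h4
      have h7 := mul_le_mul_of_nonneg_left h3 hK1.le
      have h8 := mul_le_mul_of_nonneg_right hKC h5
      have h9 : c * (K * s₁ i z - a₁ i z) = 0 := by rw [h1, mul_zero]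
      nlinarith)
  filter_upwards [eventually_ge_atTop Z] with z hz i
  linarith [key z hz i]

/-! ### Exponential rates from sub- and supersolutions -/

theorem tendsto_exp_mul_atTop_zero {l : ℝ} (hl : l < 0) :
    Tendsto (fun z => Real.exp (l * z)) atTop (𝓝 0) :=
  Real.tendsto_exp_atBot.comp ((tendsto_const_mul_atBot_of_neg hl).2 tendsto_id)

theorem isBigO_exp_exp {l m : ℝ} (h : l ≤ m) :
    (fun z => Real.exp (l * z)) =O[atTop] fun z => Real.exp (m * z) := by
  refine Asymptotics.IsBigO.of_bound 1 ?_
  filter_upwards [eventually_ge_atTop 0] with z hz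
  rw [Real.norm_eq_abs, Real.norm_eq_abs, Real.abs_exp, Real.abs_exp, one_mul]
  exact Real.exp_le_exp.2 (mul_le_mul_of_nonneg_right h hz)

theorem isBigO_of_eventually_le {f g : ℝ → ℝ} {K : ℝ} (hf : ∀ᶠ z in atTop, 0 ≤ f z)
    (h : ∀ᶠ z in atTop, f z ≤ K * g z) (hg : ∀ᶠ z in atTop, 0 ≤ g z) : f =O[atTop] g := by
  refine Asymptotics.IsBigO.of_bound K ?_
  filter_upwards [hf, h, hg] with z h1 h2 h3
  rwa [Real.norm_of_nonneg h1, Real.norm_of_nonneg h3]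

theorem exists_bound_of_isBigO_exp {f : ℝ → ℝ} {l : ℝ}
    (h : f =O[atTop] fun z => Real.exp (l * z)) :
    ∃ C > 0, ∀ᶠ z in atTop, |f z| ≤ C * Real.exp (l * z) := by
  obtain ⟨C, hC, h⟩ := h.exists_pos
  refine ⟨C, hC, ?_⟩
  filter_upwards [h.bound] with z hz
  simpa [Real.abs_exp] using hz

theorem sysOp_exp {ι : Type*} [Fintype ι] (c l : ℝ) (A : ℝ → ι → ι → ℝ) (φ : ι → ℝ) (i : ι)
    (z : ℝ) :
    sysOp c A (fun i z => φ i * Real.exp (l * z)) (fun i z => φ i * (l * Real.exp (l * z)))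
      (fun i z => φ i * (l ^ 2 * Real.exp (l * z))) i z
      = ((l ^ 2 + c * l) * φ i + ∑ j, A z i j * φ j) * Real.exp (l * z) := by
  have : ∑ j, A z i j * (φ j * Real.exp (l * z)) = (∑ j, A z i j * φ j) * Real.exp (l * z) := by
    rw [Finset.sum_mul]
    exact Finset.sum_congr rfl fun j _ => by ring
  rw [sysOp, this]
  ring

theorem sysOp_add {ι : Type*} [Fintype ι] (c : ℝ) (A : ℝ → ι → ι → ℝ)
    (w w₁ w₂ s s₁ s₂ : ι → ℝ → ℝ) (k : ℝ) (i : ι) (z : ℝ) :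
    sysOp c A (fun i z => w i z + k * s i z) (fun i z => w₁ i z + k * s₁ i z)
      (fun i z => w₂ i z + k * s₂ i z) i z
      = sysOp c A w w₁ w₂ i z + k * sysOp c A s s₁ s₂ i z := by
  have : ∑ j, A z i j * (w j z + k * s j z)
      = ∑ j, A z i j * w j z + k * ∑ j, A z i j * s j z := by
    rw [Finset.mul_sum, ← Finset.sum_add_distrib]
    exact Finset.sum_congr rfl fun j _ => by ring
  rw [sysOp, sysOp, sysOp, this]
  ring

section System

variable {ι : Type*} [Fintype ι] {A : ℝ → ι → ι → ℝ} {A₀ : ι → ι → ℝ} {c l η : ℝ}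
  {w w₁ w₂ : ι → ℝ → ℝ} {φ : ι → ℝ}

/-- Upper bound by a strict supersolution `φ e^{l z}`. -/
theorem IsStableCoop.isBigO_exp (hA : IsStableCoop A A₀)
    (hw : ∀ i, HasDerivs (w i) (w₁ i) (w₂ i)) (hpos : ∀ i z, 0 < w i z)
    (hw0 : ∀ i, Tendsto (w i) atTop (𝓝 0)) (hφ : ∀ i, 0 < φ i)
    (hl : ∀ i, (l ^ 2 + c * l) * φ i + ∑ j, A₀ i j * φ j < 0)
    (hL : ∀ i, (fun z => sysOp c A w w₁ w₂ i z) =O[atTop] fun z => Real.exp (l * z)) (i : ι) :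
    w i =O[atTop] fun z => Real.exp (l * z) := by
  choose C hC hCL using fun i => exists_bound_of_isBigO_exp (hL i)
  set N : ι → ℝ := fun i => (l ^ 2 + c * l) * φ i + ∑ j, A₀ i j * φ j with hN
  have hev := hA.eventually_sum_lt φ (r := fun i => N i / 2 - (l ^ 2 + c * l) * φ i) (by
    intro i
    have := hl i
    simp only [hN]
    linarith)
  have hterm : ∀ i, 0 ≤ C i / (-N i / 2) := fun i => by
    have := hl i
    have h2 : 0 < -N i / 2 := by simp only [hN]; linarith
    exact div_nonneg (hC i).le h2.le
  obtain ⟨K, hK, hle⟩ := hA.comparison (c := c) (C := ∑ i, C i / (-N i / 2)) (a := w)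
    (b := fun i z => (-N i / 2) * Real.exp (l * z)) hw
    (fun i => (hasDerivs_exp l).const_mul (φ i))
    (Eventually.of_forall fun z i => mul_pos (hφ i) (Real.exp_pos _)) hw0
    (Eventually.of_forall fun z i => mul_nonneg (by have := hl i; simp only [hN]; linarith)
      (Real.exp_pos _).le)
    (by
      filter_upwards [hev] with z hz i
      rw [sysOp_exp]
      have := mul_le_mul_of_nonneg_right (hz i).le (Real.exp_pos (l * z)).le
      linarith)
    (by
      filter_upwards [eventually_all.2 hCL] with z hz i
      have h1 := (abs_le.1 (hz i)).1
      have h2 : 0 < -N i / 2 := by have := hl i; simp only [hN]; linarith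
      have h3 : C i ≤ (∑ i, C i / (-N i / 2)) * (-N i / 2) := by
        rw [← div_le_iff₀ h2]
        exact Finset.single_le_sum (f := fun i => C i / (-N i / 2)) (fun i _ => hterm i)
          (Finset.mem_univ i)
      have h4 := mul_le_mul_of_nonneg_right h3 (Real.exp_pos (l * z)).le
      linarith)
  refine isBigO_of_eventually_le (K := K * φ i) (Eventually.of_forall fun z => (hpos i z).le) ?_
    (Eventually.of_forall fun z => (Real.exp_pos _).le)
  filter_upwards [hle] with z hz
  rw [mul_assoc]
  exact hz i

/-- Lower bound by a strict subsolution `φ e^{l z}`. -/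
theorem IsStableCoop.exp_isBigO (hA : IsStableCoop A A₀)
    (hw : ∀ i, HasDerivs (w i) (w₁ i) (w₂ i)) (hpos : ∀ i z, 0 < w i z)
    (hl0 : l < 0) (hφ : ∀ i, 0 < φ i)
    (hl : ∀ i, 0 < (l ^ 2 + c * l) * φ i + ∑ j, A₀ i j * φ j)
    (hL : ∀ᶠ z in atTop, ∀ i, sysOp c A w w₁ w₂ i z ≤ 0) (i : ι) :
    (fun z => Real.exp (l * z)) =O[atTop] w i := by
  have hev := hA.eventually_lt_sum φ (r := fun i => - (l ^ 2 + c * l) * φ i) (by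
    intro i
    have := hl i
    linarith)
  obtain ⟨K, hK, hle⟩ := hA.comparison (c := c) (C := 0) (s := w) (b := fun _ _ => 0)
    (fun i => (hasDerivs_exp l).const_mul (φ i)) hw
    (Eventually.of_forall fun z i => hpos i z)
    (fun i => by simpa using (tendsto_exp_mul_atTop_zero hl0).const_mul (φ i))
    (Eventually.of_forall fun z i => le_rfl)
    (by simpa using hL)
    (by
      filter_upwards [hev] with z hz i
      rw [sysOp_exp, zero_mul, neg_zero]
      exact mul_nonneg (by linarith [hz i]) (Real.exp_pos _).le)
  refine isBigO_of_eventually_le (K := K / φ i)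
    (Eventually.of_forall fun z => (Real.exp_pos _).le) ?_
    (Eventually.of_forall fun z => (hpos i z).le)
  filter_upwards [hle] with z hz
  rw [div_mul_eq_mul_div, le_div_iff₀ (hφ i), mul_comm]
  exact hz i

/-- With exponentially small `A - A₀`, the error that `φ e^{l z}` leaves in the equation is dominated
by the gain of the correction `φ e^{(l - δ) z}`, for `0 < δ < η`. -/
theorem eventually_error_le (hη : 0 < η)
    (hAη : ∀ i j, (fun z => A z i j - A₀ i j) =O[atTop] fun z => Real.exp (-η * z))
    {κ : ι → ℝ} (hκ : ∀ i, 0 < κ i) (φ : ι → ℝ) :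
    ∀ᶠ z in atTop, ∀ i, |∑ j, (A z i j - A₀ i j) * φ j| * (Real.exp (η / 2 * z) + 1) ≤ κ i := by
  refine eventually_all.2 fun i => ?_
  have hE : (fun z => ∑ j, (A z i j - A₀ i j) * φ j) =O[atTop] fun z => Real.exp (-η * z) :=
    Asymptotics.IsBigO.fun_sum fun j _ => by
      simp_rw [mul_comm _ (φ j)]
      exact (hAη i j).const_mul_left (φ j)
  have h2 : (fun z => Real.exp (η / 2 * z) + 1) =O[atTop] fun z => Real.exp (η / 2 * z) := by
    refine (Asymptotics.isBigO_refl _ _).add ?_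
    simpa using isBigO_exp_exp (l := 0) (m := η / 2) (by linarith)
  have h3 := hE.norm_left.mul h2
  have h4 : (fun z => Real.exp (-η * z) * Real.exp (η / 2 * z))
      = fun z => Real.exp (-(η / 2) * z) := by
    funext z
    rw [← Real.exp_add]
    ring_nf
  rw [h4] at h3
  have h5 := h3.trans_tendsto (tendsto_exp_mul_atTop_zero (by linarith))
  filter_upwards [h5.eventually_le_const (hκ i)] with z hz using hz

/-- Sharp upper bound at a simple root: `φ (e^{l z} - e^{(l - δ) z})` is a supersolution when `φ` is
in the kernel of `l² + c l + A₀`. -/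
theorem IsStableCoop.isBigO_exp_sharp (hA : IsStableCoop A A₀)
    (hw : ∀ i, HasDerivs (w i) (w₁ i) (w₂ i)) (hpos : ∀ i z, 0 < w i z)
    (hw0 : ∀ i, Tendsto (w i) atTop (𝓝 0)) (hφ : ∀ i, 0 < φ i) (hη : 0 < η)
    (hAη : ∀ i j, (fun z => A z i j - A₀ i j) =O[atTop] fun z => Real.exp (-η * z))
    (hl : ∀ i, (l ^ 2 + c * l) * φ i + ∑ j, A₀ i j * φ j = 0) (hsimple : 2 * l + c < 0)
    (hL : ∀ i, (fun z => sysOp c A w w₁ w₂ i z) =O[atTop] fun z => Real.exp ((l - η) * z))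
    (i : ι) : w i =O[atTop] fun z => Real.exp (l * z) := by
  set δ := η / 2 with hδ
  set κ := δ ^ 2 - δ * (2 * l + c) with hκ
  have hκ0 : 0 < κ := by
    have : 0 < δ := by linarith
    have := mul_pos_of_neg_of_neg hsimple (neg_neg_of_pos this)
    nlinarith [sq_nonneg δ]
  have herr := eventually_error_le hη hAη (κ := fun i => κ / 2 * φ i)
    (fun i => by have := hφ i; positivity) φ
  have hL' : ∀ i, (fun z => sysOp c A w w₁ w₂ i z) =O[atTop] fun z => Real.exp ((l - δ) * z) :=
    fun i => (hL i).trans (isBigO_exp_exp (by linarith))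
  choose C hC hCL using fun i => exists_bound_of_isBigO_exp (hL' i)
  have hterm : ∀ i, 0 ≤ C i / (κ / 2 * φ i) := fun i =>
    div_nonneg (hC i).le (by have := hφ i; positivity)
  obtain ⟨K, hK, hle⟩ := hA.comparison (c := c) (C := ∑ i, C i / (κ / 2 * φ i)) (a := w)
    (s := fun i z => φ i * Real.exp (l * z) + (-1) * (φ i * Real.exp ((l - δ) * z)))
    (b := fun i z => κ / 2 * φ i * Real.exp ((l - δ) * z)) hw
    (fun i => ((hasDerivs_exp l).const_mul (φ i)).add
      (((hasDerivs_exp (l - δ)).const_mul (φ i)).const_mul (-1)))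
    (by
      filter_upwards [eventually_gt_atTop 0] with z hz i
      have h1 : Real.exp ((l - δ) * z) < Real.exp (l * z) := by
        apply Real.exp_lt_exp.2
        apply mul_lt_mul_of_pos_right _ hz
        linarith
      have := mul_lt_mul_of_pos_left h1 (hφ i)
      linarith)
    hw0
    (Eventually.of_forall fun z i => by have := hφ i; positivity)
    (by
      filter_upwards [herr] with z hz i
      rw [sysOp_add, sysOp_exp, sysOp_exp]
      set e := ∑ j, (A z i j - A₀ i j) * φ j with he
      have h1 : ∑ j, A z i j * φ j = e + ∑ j, A₀ i j * φ j := by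
        rw [he, ← Finset.sum_add_distrib]
        exact Finset.sum_congr rfl fun j _ => by ring
      have h2 : ∑ j, A z i j * φ j = e - (l ^ 2 + c * l) * φ i := by
        rw [h1]; linarith [hl i]
      have h3 : Real.exp (l * z) = Real.exp (δ * z) * Real.exp ((l - δ) * z) := by
        rw [← Real.exp_add]; ring_nf
      have hX := Real.exp_pos ((l - δ) * z)
      have h4 := mul_le_mul_of_nonneg_right (hz i) hX.le
      have h5 : e * (Real.exp (δ * z) - 1) ≤ |e| * (Real.exp (δ * z) + 1) := by
        have h6 := Real.exp_pos (δ * z)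
        have h7 := mul_le_mul_of_nonneg_right (le_abs_self e) h6.le
        have h8 := neg_abs_le e
        nlinarith
      have h9 := mul_le_mul_of_nonneg_right h5 hX.le
      rw [h2, h3]
      simp only [hκ] at h4 ⊢
      linarith)
    (by
      filter_upwards [eventually_all.2 hCL] with z hz i
      have h1 := (abs_le.1 (hz i)).1
      have h2 : 0 < κ / 2 * φ i := by have := hφ i; positivity
      have h3 : C i ≤ (∑ i, C i / (κ / 2 * φ i)) * (κ / 2 * φ i) := by
        rw [← div_le_iff₀ h2]
        exact Finset.single_le_sum (f := fun i => C i / (κ / 2 * φ i)) (fun i _ => hterm i)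
          (Finset.mem_univ i)
      have h4 := mul_le_mul_of_nonneg_right h3 (Real.exp_pos ((l - δ) * z)).le
      linarith)
  refine isBigO_of_eventually_le (K := K * φ i) (Eventually.of_forall fun z => (hpos i z).le) ?_
    (Eventually.of_forall fun z => (Real.exp_pos _).le)
  filter_upwards [hle] with z hz
  have h1 := hz i
  have h2 := mul_pos hK (mul_pos (hφ i) (Real.exp_pos ((l - δ) * z)))
  linarith

/-- Sharp lower bound at a simple root, by the subsolution `φ (e^{l z} + e^{(l - δ) z})`. -/
theorem IsStableCoop.exp_isBigO_sharp (hA : IsStableCoop A A₀)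
    (hw : ∀ i, HasDerivs (w i) (w₁ i) (w₂ i)) (hpos : ∀ i z, 0 < w i z)
    (hl0 : l < 0) (hφ : ∀ i, 0 < φ i) (hη : 0 < η)
    (hAη : ∀ i j, (fun z => A z i j - A₀ i j) =O[atTop] fun z => Real.exp (-η * z))
    (hl : ∀ i, (l ^ 2 + c * l) * φ i + ∑ j, A₀ i j * φ j = 0) (hsimple : 2 * l + c < 0)
    (hL : ∀ᶠ z in atTop, ∀ i, sysOp c A w w₁ w₂ i z ≤ 0) (i : ι) :
    (fun z => Real.exp (l * z)) =O[atTop] w i := by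
  set δ := η / 2 with hδ
  set κ := δ ^ 2 - δ * (2 * l + c) with hκ
  have hδ0 : 0 < δ := by linarith
  have hκ0 : 0 < κ := by
    have := mul_pos_of_neg_of_neg hsimple (neg_neg_of_pos hδ0)
    nlinarith [sq_nonneg δ]
  have herr := eventually_error_le hη hAη (κ := fun i => κ / 2 * φ i)
    (fun i => by have := hφ i; positivity) φ
  obtain ⟨K, hK, hle⟩ := hA.comparison (c := c) (C := 0) (s := w)
    (a := fun i z => φ i * Real.exp (l * z) + 1 * (φ i * Real.exp ((l - δ) * z)))
    (b := fun _ _ => 0)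
    (fun i => ((hasDerivs_exp l).const_mul (φ i)).add
      (((hasDerivs_exp (l - δ)).const_mul (φ i)).const_mul 1)) hw
    (Eventually.of_forall fun z i => hpos i z)
    (fun i => by
      simpa using ((tendsto_exp_mul_atTop_zero hl0).const_mul (φ i)).add
        (((tendsto_exp_mul_atTop_zero (l := l - δ) (by linarith)).const_mul (φ i)).const_mul 1))
    (Eventually.of_forall fun z i => le_rfl)
    (by simpa using hL)
    (by
      filter_upwards [herr] with z hz i
      rw [sysOp_add, sysOp_exp, sysOp_exp, zero_mul, neg_zero]
      set e := ∑ j, (A z i j - A₀ i j) * φ j with he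
      have h1 : ∑ j, A z i j * φ j = e + ∑ j, A₀ i j * φ j := by
        rw [he, ← Finset.sum_add_distrib]
        exact Finset.sum_congr rfl fun j _ => by ring
      have h2 : ∑ j, A z i j * φ j = e - (l ^ 2 + c * l) * φ i := by
        rw [h1]; linarith [hl i]
      have h3 : Real.exp (l * z) = Real.exp (δ * z) * Real.exp ((l - δ) * z) := by
        rw [← Real.exp_add]; ring_nf
      have hX := Real.exp_pos ((l - δ) * z)
      have h4 := mul_le_mul_of_nonneg_right (hz i) hX.le
      have h5 : -(|e| * (Real.exp (δ * z) + 1)) ≤ e * (Real.exp (δ * z) + 1) := by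
        have h6 := Real.exp_pos (δ * z)
        have h8 := neg_abs_le e
        nlinarith
      have h9 := mul_le_mul_of_nonneg_right h5 hX.le
      have h10 : 0 ≤ κ / 2 * φ i * Real.exp ((l - δ) * z) := by have := hφ i; positivity
      rw [h2, h3]
      simp only [hκ] at h4 h10 ⊢
      linarith)
  refine isBigO_of_eventually_le (K := K / φ i)
    (Eventually.of_forall fun z => (Real.exp_pos _).le) ?_
    (Eventually.of_forall fun z => (hpos i z).le)
  filter_upwards [hle] with z hz
  rw [div_mul_eq_mul_div, le_div_iff₀ (hφ i)]
  have h1 := hz i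
  have h2 := mul_pos (hφ i) (Real.exp_pos ((l - δ) * z))
  linarith

end System

section Scalar

variable {a : ℝ → ℝ} {a₀ c l η : ℝ} {w w₁ w₂ : ℝ → ℝ}

theorem isStableCoop_scalar (ha : Tendsto a atTop (𝓝 a₀)) (ha₀ : a₀ < 0) :
    IsStableCoop (ι := Unit) (fun z _ _ => a z) (fun _ _ => a₀) where
  tendsto _ _ := ha
  offDiag := Eventually.of_forall fun _ i j h => absurd (Subsingleton.elim i j) h
  exists_pos := ⟨fun _ => 1, fun _ => one_pos, fun _ => by simpa using ha₀⟩

theorem isBigO_exp_scalar (ha : Tendsto a atTop (𝓝 a₀)) (ha₀ : a₀ < 0)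
    (hw : HasDerivs w w₁ w₂) (hpos : ∀ z, 0 < w z) (hw0 : Tendsto w atTop (𝓝 0))
    (hl : l ^ 2 + c * l + a₀ < 0)
    (hL : (fun z => w₂ z + c * w₁ z + a z * w z) =O[atTop] fun z => Real.exp (l * z)) :
    w =O[atTop] fun z => Real.exp (l * z) :=
  (isStableCoop_scalar ha ha₀).isBigO_exp (c := c) (w := fun _ => w) (φ := fun _ => 1)
    (fun _ => hw) (fun _ => hpos) (fun _ => hw0) (fun _ => one_pos) (fun _ => by simpa using hl)
    (fun _ => by simpa [sysOp] using hL) ()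

theorem exp_isBigO_scalar (ha : Tendsto a atTop (𝓝 a₀)) (ha₀ : a₀ < 0)
    (hw : HasDerivs w w₁ w₂) (hpos : ∀ z, 0 < w z) (hl0 : l < 0)
    (hl : 0 < l ^ 2 + c * l + a₀)
    (hL : ∀ᶠ z in atTop, w₂ z + c * w₁ z + a z * w z ≤ 0) :
    (fun z => Real.exp (l * z)) =O[atTop] w :=
  (isStableCoop_scalar ha ha₀).exp_isBigO (c := c) (w := fun _ => w) (φ := fun _ => 1)
    (fun _ => hw) (fun _ => hpos) hl0 (fun _ => one_pos) (fun _ => by simpa using hl)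
    (by simpa [sysOp] using hL) ()

theorem isBigO_exp_sharp_scalar (ha : Tendsto a atTop (𝓝 a₀)) (ha₀ : a₀ < 0)
    (hw : HasDerivs w w₁ w₂) (hpos : ∀ z, 0 < w z) (hw0 : Tendsto w atTop (𝓝 0))
    (hη : 0 < η) (haη : (fun z => a z - a₀) =O[atTop] fun z => Real.exp (-η * z))
    (hl : l ^ 2 + c * l + a₀ = 0) (hsimple : 2 * l + c < 0)
    (hL : (fun z => w₂ z + c * w₁ z + a z * w z) =O[atTop] fun z => Real.exp ((l - η) * z)) :
    w =O[atTop] fun z => Real.exp (l * z) :=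
  (isStableCoop_scalar ha ha₀).isBigO_exp_sharp (c := c) (w := fun _ => w) (φ := fun _ => 1)
    (fun _ => hw) (fun _ => hpos) (fun _ => hw0) (fun _ => one_pos) hη (fun _ _ => haη)
    (fun _ => by simpa using hl) hsimple (fun _ => by simpa [sysOp] using hL) ()

theorem exp_isBigO_sharp_scalar (ha : Tendsto a atTop (𝓝 a₀)) (ha₀ : a₀ < 0)
    (hw : HasDerivs w w₁ w₂) (hpos : ∀ z, 0 < w z) (hl0 : l < 0)
    (hη : 0 < η) (haη : (fun z => a z - a₀) =O[atTop] fun z => Real.exp (-η * z))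
    (hl : l ^ 2 + c * l + a₀ = 0) (hsimple : 2 * l + c < 0)
    (hL : ∀ᶠ z in atTop, w₂ z + c * w₁ z + a z * w z ≤ 0) :
    (fun z => Real.exp (l * z)) =O[atTop] w :=
  (isStableCoop_scalar ha ha₀).exp_isBigO_sharp (c := c) (w := fun _ => w) (φ := fun _ => 1)
    (fun _ => hw) (fun _ => hpos) hl0 (fun _ => one_pos) hη (fun _ _ => haη)
    (fun _ => by simpa using hl) hsimple (by simpa [sysOp] using hL) ()

/-- A positive solution driven by a positive forcing `h` decays no faster than `h`. -/
theorem exp_isBigO_of_forcing (ha : Tendsto a atTop (𝓝 a₀)) (ha₀ : a₀ < 0)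
    (hw : HasDerivs w w₁ w₂) (hpos : ∀ z, 0 < w z) (hl0 : l < 0) {h : ℝ → ℝ}
    (hh : (fun z => Real.exp (l * z)) =O[atTop] h) (hh0 : ∀ᶠ z in atTop, 0 ≤ h z)
    (hL : ∀ᶠ z in atTop, w₂ z + c * w₁ z + a z * w z ≤ -h z) :
    (fun z => Real.exp (l * z)) =O[atTop] w := by
  obtain ⟨C, hC, hCh⟩ := hh.exists_pos
  obtain ⟨K, hK, hle⟩ := (isStableCoop_scalar ha ha₀).comparison (c := c)
    (C := C * |l ^ 2 + c * l + a₀ - 1|) (s := fun _ => w) (b := fun _ => h)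
    (a := fun _ z => Real.exp (l * z))
    (fun _ => hasDerivs_exp l) (fun _ => hw)
    (Eventually.of_forall fun z _ => hpos z)
    (fun _ => tendsto_exp_mul_atTop_zero hl0)
    (by filter_upwards [hh0] with z hz _ using hz)
    (by filter_upwards [hL] with z hz _; simpa [sysOp] using hz)
    (by
      filter_upwards [hCh.bound, hh0, ha.eventually_const_lt (u := a₀ - 1) (by linarith)]
        with z h1 h2 h3 _
      rw [Real.norm_of_nonneg (Real.exp_pos _).le, Real.norm_of_nonneg h2] at h1
      simp only [sysOp, Finset.univ_unique, Finset.sum_const, Finset.card_singleton, one_smul]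
      have hX := Real.exp_pos (l * z)
      have h4 := mul_le_mul_of_nonneg_left h1 (abs_nonneg (l ^ 2 + c * l + a₀ - 1))
      have h5 := mul_le_mul_of_nonneg_right (neg_abs_le (l ^ 2 + c * l + a₀ - 1)) hX.le
      have h6 := mul_lt_mul_of_pos_right h3 hX
      linarith)
  exact isBigO_of_eventually_le (K := K) (Eventually.of_forall fun z => (Real.exp_pos _).le)
    (by filter_upwards [hle] with z hz using hz ()) (Eventually.of_forall fun z => (hpos z).le)

end Scalar

/-! ### Logarithmic derivatives and integration of rates -/

theorem antitoneOn_Ici_of_hasDerivAt {F F' : ℝ → ℝ} {Z : ℝ} (h : ∀ z, HasDerivAt F (F' z) z)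
    (h' : ∀ z ≥ Z, F' z ≤ 0) : AntitoneOn F (Set.Ici Z) := by
  refine antitoneOn_of_deriv_nonpos (convex_Ici Z)
    (fun z _ => (h z).continuousAt.continuousWithinAt)
    (fun z _ => (h z).differentiableAt.differentiableWithinAt) fun z hz => ?_
  rw [interior_Ici] at hz
  rw [(h z).deriv]
  exact h' z (le_of_lt hz)

theorem monotoneOn_Ici_of_hasDerivAt {F F' : ℝ → ℝ} {Z : ℝ} (h : ∀ z, HasDerivAt F (F' z) z)
    (h' : ∀ z ≥ Z, 0 ≤ F' z) : MonotoneOn F (Set.Ici Z) := by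
  have := antitoneOn_Ici_of_hasDerivAt (F := fun z => -F z) (fun z => (h z).neg)
    (fun z hz => neg_nonpos.2 (h' z hz))
  intro x hx y hy hxy
  exact neg_le_neg_iff.1 (this hx hy hxy)

/-- If `(log f)' ≤ N'` near `+∞`, then `f = O(e^N)`. -/
theorem isBigO_exp_of_logDeriv_le {f m N M : ℝ → ℝ} (hf : ∀ z, HasDerivAt f (f z * m z) z)
    (hpos : ∀ z, 0 < f z) (hN : ∀ z, HasDerivAt N (M z) z) (h : ∀ᶠ z in atTop, m z ≤ M z) :
    f =O[atTop] fun z => Real.exp (N z) := by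
  obtain ⟨Z, hZ⟩ := eventually_atTop.1 h
  have hanti := antitoneOn_Ici_of_hasDerivAt (Z := Z) (F := fun z => f z * Real.exp (-N z))
    (F' := fun z => f z * Real.exp (-N z) * (m z - M z))
    (fun z => ((hf z).fun_mul (hN z).fun_neg.exp).congr_deriv (by ring))
    (fun z hz => mul_nonpos_of_nonneg_of_nonpos
      (mul_nonneg (hpos z).le (Real.exp_pos _).le) (sub_nonpos.2 (hZ z hz)))
  refine isBigO_of_eventually_le (K := f Z * Real.exp (-N Z))
    (Eventually.of_forall fun z => (hpos z).le) ?_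
    (Eventually.of_forall fun z => (Real.exp_pos _).le)
  filter_upwards [eventually_ge_atTop Z] with z hz
  have h1 := hanti (Set.mem_Ici.2 le_rfl) (Set.mem_Ici.2 hz) hz
  have h2 := mul_le_mul_of_nonneg_right h1 (Real.exp_pos (N z)).le
  simp only at h2
  rwa [mul_assoc, ← Real.exp_add, neg_add_cancel, Real.exp_zero, mul_one] at h2

/-- If `(log f)' ≥ N'` near `+∞`, then `e^N = O(f)`. -/
theorem exp_isBigO_of_le_logDeriv {f m N M : ℝ → ℝ} (hf : ∀ z, HasDerivAt f (f z * m z) z)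
    (hpos : ∀ z, 0 < f z) (hN : ∀ z, HasDerivAt N (M z) z) (h : ∀ᶠ z in atTop, M z ≤ m z) :
    (fun z => Real.exp (N z)) =O[atTop] f := by
  have hinv := isBigO_exp_of_logDeriv_le (f := fun z => (f z)⁻¹) (m := fun z => -m z)
    (N := fun z => -N z) (M := fun z => -M z)
    (fun z => ((hf z).inv (hpos z).ne').congr_deriv (by
      have := (hpos z).ne'
      field_simp))
    (fun z => inv_pos.2 (hpos z)) (fun z => (hN z).neg)
    (by filter_upwards [h] with z hz using neg_le_neg hz)
  have := hinv.inv_rev (Eventually.of_forall fun z hz => absurd hz (inv_pos.2 (hpos z)).ne')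
  simpa [← Real.exp_neg] using this

theorem isBigO_exp_of_logDeriv_tendsto {f m : ℝ → ℝ} {l l' : ℝ}
    (hf : ∀ z, HasDerivAt f (f z * m z) z) (hpos : ∀ z, 0 < f z) (hm : Tendsto m atTop (𝓝 l))
    (hl : l < l') : f =O[atTop] fun z => Real.exp (l' * z) :=
  isBigO_exp_of_logDeriv_le (M := fun _ => l') hf hpos
    (fun z => by simpa using (hasDerivAt_id z).const_mul l')
    ((hm.eventually_lt_const hl).mono fun _ h => h.le)

theorem exp_isBigO_of_logDeriv_tendsto {f m : ℝ → ℝ} {l l' : ℝ}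
    (hf : ∀ z, HasDerivAt f (f z * m z) z) (hpos : ∀ z, 0 < f z) (hm : Tendsto m atTop (𝓝 l))
    (hl : l' < l) : (fun z => Real.exp (l' * z)) =O[atTop] f :=
  exp_isBigO_of_le_logDeriv (M := fun _ => l') hf hpos
    (fun z => by simpa using (hasDerivAt_id z).const_mul l')
    ((hm.eventually_const_lt hl).mono fun _ h => h.le)

/-- If `(log f)'` converges exponentially fast to `l`, then `f` is comparable with `e^{l z}`. -/
theorem isBigO_exp_of_logDeriv_sharp {f m : ℝ → ℝ} {l η : ℝ}
    (hf : ∀ z, HasDerivAt f (f z * m z) z) (hpos : ∀ z, 0 < f z) (hη : 0 < η)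
    (hm : (fun z => m z - l) =O[atTop] fun z => Real.exp (-η * z)) :
    (f =O[atTop] fun z => Real.exp (l * z)) ∧ (fun z => Real.exp (l * z)) =O[atTop] f := by
  obtain ⟨C, hC, hCm⟩ := exists_bound_of_isBigO_exp hm
  have hN : ∀ k z, HasDerivAt (fun z => l * z + k * Real.exp (-η * z))
      (l + k * (-η * Real.exp (-η * z))) z := fun k z => by
    simpa using ((hasDerivAt_id z).const_mul l).fun_add ((hasDerivAt_exp_mul (-η) z).const_mul k)
  have h1 := isBigO_exp_of_logDeriv_le hf hpos (hN (-(C / η))) (by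
    filter_upwards [hCm] with z hz
    have : -(C / η) * (-η * Real.exp (-η * z)) = C * Real.exp (-η * z) := by
      field_simp
    rw [this]
    linarith [(abs_le.1 hz).2])
  have h2 := exp_isBigO_of_le_logDeriv hf hpos (hN (C / η)) (by
    filter_upwards [hCm] with z hz
    have : C / η * (-η * Real.exp (-η * z)) = -(C * Real.exp (-η * z)) := by
      field_simp
    rw [this]
    linarith [(abs_le.1 hz).1])
  have hCη : 0 < C / η := div_pos hC hη
  refine ⟨h1.trans ?_, Asymptotics.IsBigO.trans ?_ h2⟩
  · refine Asymptotics.IsBigO.of_bound 1 (Eventually.of_forall fun z => ?_)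
    rw [Real.norm_eq_abs, Real.norm_eq_abs, Real.abs_exp, Real.abs_exp, one_mul]
    refine Real.exp_le_exp.2 ?_
    have := mul_pos hCη (Real.exp_pos (-η * z))
    linarith
  · refine Asymptotics.IsBigO.of_bound 1 (Eventually.of_forall fun z => ?_)
    rw [Real.norm_eq_abs, Real.norm_eq_abs, Real.abs_exp, Real.abs_exp, one_mul]
    refine Real.exp_le_exp.2 ?_
    have := mul_pos hCη (Real.exp_pos (-η * z))
    linarith

theorem nonpos_of_deriv_nonneg_of_tendsto {F F' : ℝ → ℝ} (h : ∀ z, HasDerivAt F (F' z) z)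
    (h' : ∀ᶠ z in atTop, 0 ≤ F' z) (hF : Tendsto F atTop (𝓝 0)) : ∀ᶠ z in atTop, F z ≤ 0 := by
  obtain ⟨Z, hZ⟩ := eventually_atTop.1 h'
  have hm := monotoneOn_Ici_of_hasDerivAt h hZ
  filter_upwards [eventually_ge_atTop Z] with z hz
  refine ge_of_tendsto hF ?_
  filter_upwards [eventually_ge_atTop z] with t ht
  exact hm (Set.mem_Ici.2 hz) (Set.mem_Ici.2 (hz.trans ht)) ht

/-- Integration of an upper bound for `d = -D'`. -/
theorem isBigO_exp_integrate {D d : ℝ → ℝ} {l : ℝ} (hl : l < 0)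
    (hD : ∀ z, HasDerivAt D (-d z) z) (hpos : ∀ z, 0 < d z) (hD0 : Tendsto D atTop (𝓝 0))
    (h : d =O[atTop] fun z => Real.exp (l * z)) : D =O[atTop] fun z => Real.exp (l * z) := by
  obtain ⟨C, hC, hCd⟩ := exists_bound_of_isBigO_exp h
  have h0 := nonpos_of_deriv_nonneg_of_tendsto (F := fun z => -D z) (F' := d)
    (fun z => by simpa using (hD z).fun_neg) (Eventually.of_forall fun z => (hpos z).le)
    (by simpa using hD0.neg)
  have h1 := nonpos_of_deriv_nonneg_of_tendsto
    (fun z => (hD z).fun_add ((hasDerivAt_exp_mul l z).const_mul (C / l)))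
    (by
      filter_upwards [hCd] with z hz
      have : C / l * (l * Real.exp (l * z)) = C * Real.exp (l * z) := by
        have := hl.ne
        field_simp
      rw [this]
      linarith [(abs_le.1 hz).2])
    (by simpa using hD0.add ((tendsto_exp_mul_atTop_zero hl).const_mul (C / l)))
  refine isBigO_of_eventually_le (K := -(C / l)) ?_ ?_
    (Eventually.of_forall fun z => (Real.exp_pos _).le)
  · filter_upwards [h0] with z hz using by linarith
  · filter_upwards [h1] with z hz
    linarith

/-- Integration of a lower bound for `d = -D'`. -/
theorem exp_isBigO_integrate {D d : ℝ → ℝ} {l : ℝ} (hl : l < 0)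
    (hD : ∀ z, HasDerivAt D (-d z) z) (hpos : ∀ z, 0 < d z) (hD0 : Tendsto D atTop (𝓝 0))
    (h : (fun z => Real.exp (l * z)) =O[atTop] d) : (fun z => Real.exp (l * z)) =O[atTop] D := by
  obtain ⟨C, hC, hCd⟩ := h.exists_pos
  have h0 := nonpos_of_deriv_nonneg_of_tendsto (F := fun z => -D z) (F' := d)
    (fun z => by simpa using (hD z).fun_neg) (Eventually.of_forall fun z => (hpos z).le)
    (by simpa using hD0.neg)
  have h1 := nonpos_of_deriv_nonneg_of_tendsto
    (fun z => ((hD z).const_mul C).fun_neg.fun_sub ((hasDerivAt_exp_mul l z).const_mul (1 / l)))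
    (by
      filter_upwards [hCd.bound] with z hz
      have h2 : 1 / l * (l * Real.exp (l * z)) = Real.exp (l * z) := by
        have := hl.ne
        field_simp
      rw [Real.norm_of_nonneg (Real.exp_pos _).le, Real.norm_of_nonneg (hpos z).le] at hz
      rw [h2]
      linarith)
    (by
      simpa using (hD0.const_mul C).neg.sub
        ((tendsto_exp_mul_atTop_zero hl).const_mul (1 / l)))
  refine isBigO_of_eventually_le (K := -l * C)
    (Eventually.of_forall fun z => (Real.exp_pos _).le) ?_ ?_
  · filter_upwards [h1] with z hz
    have h3 := mul_nonpos_of_nonneg_of_nonpos (neg_nonneg.2 hl.le) hz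
    have h4 : -l * (-(C * D z) - 1 / l * Real.exp (l * z))
        = l * C * D z + Real.exp (l * z) := by
      have := hl.ne
      field_simp
      ring
    linarith
  · filter_upwards [h0] with z hz using by linarith

/-! ### Limits of derivatives -/

theorem eq_zero_of_tendsto_deriv {F F' : ℝ → ℝ} {L κ : ℝ} (h : ∀ z, HasDerivAt F (F' z) z)
    (hF : Tendsto F atTop (𝓝 L)) (hF' : Tendsto F' atTop (𝓝 κ)) : κ = 0 := by
  have hmv : ∀ z, ∃ ξ ∈ Set.Ioo z (z + 1), F' ξ = (F (z + 1) - F z) / (z + 1 - z) := fun z =>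
    exists_hasDerivAt_eq_slope F F' (by linarith)
      (fun t _ => (h t).continuousAt.continuousWithinAt) (fun t _ => h t)
  choose ξ hξ hξ' using hmv
  have hξt : Tendsto ξ atTop atTop := tendsto_atTop_mono (fun z => (hξ z).1.le) tendsto_id
  have h1 : Tendsto (fun z => F (z + 1) - F z) atTop (𝓝 (L - L)) :=
    (hF.comp (tendsto_atTop_add_const_right _ 1 tendsto_id)).sub hF
  have h2 : Tendsto (fun z => F (z + 1) - F z) atTop (𝓝 κ) := by
    refine (hF'.comp hξt).congr fun z => ?_
    simp only [Function.comp]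
    rw [hξ' z]
    ring
  rw [sub_self] at h1
  exact tendsto_nhds_unique h2 h1

/-- A convergent function for which `w'' + c w' → 0` has `w' → 0`. -/
theorem tendsto_deriv_zero {w w₁ w₂ : ℝ → ℝ} {c L : ℝ} (h : HasDerivs w w₁ w₂)
    (hw : Tendsto w atTop (𝓝 L)) (h0 : Tendsto (fun z => w₂ z + c * w₁ z) atTop (𝓝 0)) :
    Tendsto w₁ atTop (𝓝 0) := by
  have hmv : ∀ z, ∃ ξ ∈ Set.Ioo z (z + 1), w₁ ξ = (w (z + 1) - w z) / (z + 1 - z) := fun z =>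
    exists_hasDerivAt_eq_slope w w₁ (by linarith)
      (fun t _ => (h.1 t).continuousAt.continuousWithinAt) (fun t _ => h.1 t)
  choose ξ hξ hξ' using hmv
  have hψ : ∀ z, HasDerivAt (fun z => w₁ z + c * w z) (w₂ z + c * w₁ z) z := fun z =>
    (h.2 z).add ((h.1 z).const_mul c)
  have hmv2 : ∀ z, ∃ ζ ∈ Set.Ioo z (ξ z), w₂ ζ + c * w₁ ζ
      = ((w₁ (ξ z) + c * w (ξ z)) - (w₁ z + c * w z)) / (ξ z - z) := fun z =>
    exists_hasDerivAt_eq_slope (fun z => w₁ z + c * w z) _ (hξ z).1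
      (fun t _ => (hψ t).continuousAt.continuousWithinAt) (fun t _ => hψ t)
  choose ζ hζ hζ' using hmv2
  have hξt : Tendsto ξ atTop atTop := tendsto_atTop_mono (fun z => (hξ z).1.le) tendsto_id
  have hζt : Tendsto ζ atTop atTop := tendsto_atTop_mono (fun z => (hζ z).1.le) tendsto_id
  have h1 : Tendsto (fun z => w (z + 1) - w z) atTop (𝓝 (L - L)) :=
    (hw.comp (tendsto_atTop_add_const_right _ 1 tendsto_id)).sub hw
  have h2 : Tendsto (fun z => c * (w (ξ z) - w z)) atTop (𝓝 (c * (L - L))) :=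
    ((hw.comp hξt).sub hw).const_mul c
  have h3 : Tendsto (fun z => (w₂ (ζ z) + c * w₁ (ζ z)) * (ξ z - z)) atTop (𝓝 0) := by
    refine squeeze_zero_norm (fun z => ?_) (by simpa using (h0.comp hζt).norm)
    rw [norm_mul]
    refine mul_le_of_le_one_right (norm_nonneg _) ?_
    rw [Real.norm_of_nonneg (by linarith [(hξ z).1])]
    linarith [(hξ z).2]
  have h4 := (h1.add h2).sub h3
  simp only [sub_self, mul_zero, add_zero] at h4
  refine h4.congr fun z => ?_
  have h5 : ξ z - z ≠ 0 := by linarith [(hξ z).1]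
  rw [hζ' z, div_mul_cancel₀ _ h5]
  have h6 := hξ' z
  rw [add_sub_cancel_left, div_one] at h6
  rw [h6]
  ring

/-! ### The Riccati equation -/

/-- A continuously moving quantity that can cross the level `a` only upwards ends up on one side. -/
theorem eventually_side_of_crossing {r r' : ℝ → ℝ} {a : ℝ} (hr : ∀ z, HasDerivAt r (r' z) z)
    (h : ∀ᶠ z in atTop, r z = a → 0 < r' z) :
    (∀ᶠ z in atTop, a ≤ r z) ∨ ∀ᶠ z in atTop, r z ≤ a := by
  obtain ⟨Z, hZ⟩ := eventually_atTop.1 h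
  by_cases hex : ∃ z₁ ≥ Z, a ≤ r z₁
  · left
    obtain ⟨z₁, hz₁, ha⟩ := hex
    filter_upwards [eventually_ge_atTop z₁] with z hz
    have := image_le_of_deriv_right_lt_deriv_boundary (f := fun t => -r t) (f' := fun t => -r' t)
      (a := z₁) (b := z) (B := fun _ => -a) (B' := fun _ => 0)
      (fun t _ => (hr t).fun_neg.continuousAt.continuousWithinAt)
      (fun t _ => (hr t).fun_neg.hasDerivWithinAt) (neg_le_neg ha) (fun t => hasDerivAt_const t _)
      (fun t ht hta => neg_neg_of_pos (hZ t (hz₁.trans ht.1) (neg_injective hta)))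
      (Set.right_mem_Icc.2 hz)
    exact neg_le_neg_iff.1 this
  · right
    push Not at hex
    filter_upwards [eventually_ge_atTop Z] with z hz using (hex z hz).le

theorem riccati_bounded {r h : ℝ → ℝ} {c q : ℝ}
    (hr : ∀ z, HasDerivAt r (r z ^ 2 - c * r z + h z) z) (hpos : ∀ z, 0 < r z)
    (hh : Tendsto h atTop (𝓝 q)) : ∃ M, ∀ᶠ z in atTop, r z ≤ M := by
  set M := 2 * |c| + 2 * |q| + 4 with hM
  have hc := abs_nonneg c
  have hq := abs_nonneg q
  have hhq := hh.eventually_const_lt (u := q - 1) (by linarith)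
  -- above the level `M` the quadratic term wins
  have hgrow : ∀ x ≥ M, ∀ y > q - 1, x ^ 2 / 2 ≤ x ^ 2 - c * x + y := by
    intro x hx y hy
    have h1 : c * x ≤ |c| * x := mul_le_mul_of_nonneg_right (le_abs_self c) (by linarith)
    have h2 : x * (|c| + |q| + 2) ≤ x * (x / 2) :=
      mul_le_mul_of_nonneg_left (by linarith) (by linarith)
    have h3 := mul_le_mul_of_nonneg_right (show 1 ≤ x by linarith) (show 0 ≤ |q| + 2 by linarith)
    have h4 := neg_abs_le q
    nlinarith
  refine ⟨M, ?_⟩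
  rcases eventually_side_of_crossing (a := M) hr (by
    filter_upwards [hhq] with z hz hzM
    have := hgrow (r z) hzM.ge _ hz
    have : 0 < r z ^ 2 := pow_pos (hpos z) 2
    linarith) with hup | hlow
  · exfalso
    -- blow-up in finite time: `1 / r + z / 2` decreases
    obtain ⟨Z, hZ⟩ := eventually_atTop.1 (hup.and hhq)
    have hanti := antitoneOn_Ici_of_hasDerivAt (Z := Z) (F := fun z => (r z)⁻¹ + z / 2)
      (F' := fun z => -(r z ^ 2 - c * r z + h z) / r z ^ 2 + 1 / 2)
      (fun z => ((hr z).inv (hpos z).ne').add ((hasDerivAt_id z).div_const 2))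
      (fun z hz => by
        have h1 := hgrow (r z) (hZ z hz).1 _ (hZ z hz).2
        have h2 : 0 < r z ^ 2 := pow_pos (hpos z) 2
        have h3 : -(r z ^ 2 - c * r z + h z) / r z ^ 2 ≤ -(1 / 2) := by
          rw [div_le_iff₀ h2]
          linarith
        linarith)
    have h1 := hanti (Set.mem_Ici.2 le_rfl)
      (Set.mem_Ici.2 (show Z ≤ Z + 2 * (r Z)⁻¹ by have := inv_pos.2 (hpos Z); linarith))
      (by have := inv_pos.2 (hpos Z); linarith)
    simp only at h1
    have h2 := inv_pos.2 (hpos (Z + 2 * (r Z)⁻¹))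
    linarith
  · exact hlow

/-- Positive solutions of `r' = r² - c r + h` with `h → q`, defined up to `+∞`, converge to a root of
`ρ² - c ρ + q`: no level other than a root can be crossed in both directions. -/
theorem riccati_tendsto {r h : ℝ → ℝ} {c q : ℝ}
    (hr : ∀ z, HasDerivAt r (r z ^ 2 - c * r z + h z) z) (hpos : ∀ z, 0 < r z)
    (hh : Tendsto h atTop (𝓝 q)) :
    ∃ ρ, 0 ≤ ρ ∧ Tendsto r atTop (𝓝 ρ) ∧ ρ ^ 2 - c * ρ + q = 0 := by
  obtain ⟨M, hM⟩ := riccati_bounded hr hpos hh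
  have hside : ∀ a, a ^ 2 - c * a + q ≠ 0 →
      (∀ᶠ z in atTop, a ≤ r z) ∨ ∀ᶠ z in atTop, r z ≤ a := by
    intro a ha
    have hlim : Tendsto (fun z => a ^ 2 - c * a + h z) atTop (𝓝 (a ^ 2 - c * a + q)) :=
      hh.const_add _
    rcases lt_or_gt_of_ne ha with hneg | hpos'
    · rcases eventually_side_of_crossing (a := -a) (fun z => (hr z).fun_neg) (by
        filter_upwards [hlim.eventually_lt_const hneg] with z hz hza
        rw [neg_injective hza]
        linarith) with h1 | h1
      · right; filter_upwards [h1] with z hz using neg_le_neg_iff.1 hz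
      · left; filter_upwards [h1] with z hz using neg_le_neg_iff.1 hz
    · exact eventually_side_of_crossing hr (by
        filter_upwards [hlim.eventually_const_lt hpos'] with z hz hza
        rwa [hza])
  have hfin : {a : ℝ | a ^ 2 - c * a + q = 0}.Finite := by
    have hp : (Polynomial.X ^ 2 - Polynomial.C c * Polynomial.X + Polynomial.C q :
        Polynomial ℝ) ≠ 0 := by
      intro h0
      have := congrArg (fun p => Polynomial.coeff p 2) h0
      simp at this
    refine (Polynomial.finite_setOfPred_isRoot hp).subset fun a ha => ?_
    simpa [Polynomial.IsRoot] using ha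
  obtain ⟨ρ, hρ⟩ := tendsto_of_no_upcrossings (f := atTop) (u := r) (hfin.countable.dense_compl ℝ)
    (by
      rintro a ha b - hab ⟨h1, h2⟩
      rcases hside a ha with h3 | h3
      · exact h1 (h3.mono fun z hz => not_lt.2 hz)
      · exact h2 (h3.mono fun z hz => not_lt.2 (hz.trans hab.le)))
    ⟨M, by simpa using hM⟩ ⟨0, by simpa using ⟨0, fun z _ => (hpos z).le⟩⟩
  refine ⟨ρ, ge_of_tendsto' hρ fun z => (hpos z).le, hρ, ?_⟩
  exact eq_zero_of_tendsto_deriv hr hρ (((hρ.pow 2).sub (hρ.const_mul c)).add hh)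

/-- A decaying solution of `d' = κ d + e`, where `κ` tends to a nonzero limit and `e` decays
exponentially, decays exponentially. -/
theorem isBigO_exp_of_linear {d κ e : ℝ → ℝ} {κ₀ η : ℝ}
    (hd : ∀ z, HasDerivAt d (κ z * d z + e z) z) (hκ : Tendsto κ atTop (𝓝 κ₀)) (hκ₀ : κ₀ ≠ 0)
    (hd0 : Tendsto d atTop (𝓝 0)) (hη : 0 < η)
    (he : e =O[atTop] fun z => Real.exp (-η * z)) :
    ∃ η' > 0, d =O[atTop] fun z => Real.exp (-η' * z) := by
  have hk : 0 < |κ₀| := abs_pos.2 hκ₀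
  set m := min η (|κ₀| / 4) with hm
  have hm0 : 0 < m := lt_min hη (by linarith)
  have hmk : m ≤ |κ₀| / 4 := min_le_right _ _
  have he' : e =O[atTop] fun z => Real.exp (-m * z) :=
    he.trans (isBigO_exp_exp (neg_le_neg (min_le_left _ _)))
  obtain ⟨C, hC, hCe⟩ := exists_bound_of_isBigO_exp he'
  have hκ' : ∀ᶠ z in atTop, |κ z - κ₀| < |κ₀| / 4 := by
    have := (hκ.sub_const κ₀).abs
    simp only [sub_self, abs_zero] at this
    exact this.eventually_lt_const (by linarith)
  obtain ⟨Z, hZ⟩ := eventually_atTop.1 (hCe.and hκ')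
  set K := 2 * C / |κ₀| + |d Z| / Real.exp (-m * Z) with hK
  have hKd : |d Z| ≤ K * Real.exp (-m * Z) := by
    rw [← div_le_iff₀ (Real.exp_pos _), hK]
    have : 0 < 2 * C / |κ₀| := by positivity
    linarith
  have hK0 : 0 < K := by
    have h1 : 0 < 2 * C / |κ₀| := by positivity
    have h2 : 0 ≤ |d Z| / Real.exp (-m * Z) := by positivity
    linarith
  have hKC : C ≤ K * (|κ₀| / 2) := by
    have h1 : 2 * C / |κ₀| ≤ K := by
      have : 0 ≤ |d Z| / Real.exp (-m * Z) := by positivity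
      linarith
    rw [div_le_iff₀ hk] at h1
    linarith
  have key : ∀ σ : ℝ, |σ| = 1 → ∀ z ≥ Z, 0 ≤ K * Real.exp (-m * z) - σ * d z := by
    intro σ hσ z hz
    have hw : ∀ z, HasDerivAt (fun z => K * Real.exp (-m * z) - σ * d z)
        (K * (-m * Real.exp (-m * z)) - σ * (κ z * d z + e z)) z := fun z =>
      ((hasDerivAt_exp_mul (-m) z).const_mul K).sub ((hd z).const_mul σ)
    -- the zeroth-order coefficient is given the sign that the maximum principle needs
    have hneg : ∀ z > Z, -|κ z| < 0 := by
      intro z hz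
      have h1 := (hZ z hz.le).2
      have h2 := abs_sub_abs_le_abs_sub κ₀ (κ z)
      rw [abs_sub_comm] at h2
      linarith
    refine nonneg_of_localMin (ι := Unit) (w := fun _ z => K * Real.exp (-m * z) - σ * d z)
      (A := fun z _ _ => -|κ z|) (φ := fun _ => 1) (Z := Z) (fun _ => one_pos)
      (fun _ z _ => (hw z).continuousAt.continuousWithinAt) (fun _ => ?_) (fun _ ε hε => ?_)
      (fun _ _ i j h => absurd (Subsingleton.elim i j) h)
      (fun z hz _ => by simpa using hneg z hz) (fun z hz _ hloc _ => ?_) z hz ()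
    · have h1 := le_abs_self (σ * d Z)
      rw [abs_mul, hσ, one_mul] at h1
      linarith
    · have : Tendsto (fun z => K * Real.exp (-m * z) - σ * d z) atTop (𝓝 (K * 0 - σ * 0)) :=
        ((tendsto_exp_mul_atTop_zero (by linarith)).const_mul K).sub (hd0.const_mul σ)
      exact this.eventually_const_lt (by simpa using hε)
    · have h0 := hloc.hasDerivAt_eq_zero (hw z)
      obtain ⟨h1, h2⟩ := hZ z hz.le
      have hX := Real.exp_pos (-m * z)
      have h3 := le_abs_self (σ * e z)
      have h4 := neg_abs_le (σ * e z)
      rw [abs_mul, hσ, one_mul] at h3 h4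
      have h5 := mul_le_mul_of_nonneg_right hKC hX.le
      have h6 := abs_lt.1 h2
      simp only [Finset.univ_unique, Finset.sum_const, Finset.card_singleton, one_smul]
      have hKX := mul_pos hK0 hX
      rcases lt_or_gt_of_ne hκ₀ with hn | hp
      · rw [abs_of_neg hn] at *
        rw [abs_of_neg (by linarith : κ z < 0)]
        nlinarith [mul_le_mul_of_nonneg_right
          (show m + κ z ≤ κ₀ / 2 by linarith) hKX.le]
      · rw [abs_of_pos hp] at *
        rw [abs_of_pos (by linarith : 0 < κ z)]
        nlinarith [mul_le_mul_of_nonneg_right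
          (show κ₀ / 2 ≤ m + κ z by linarith) hKX.le]
  refine ⟨m, hm0, Asymptotics.IsBigO.of_bound K ?_⟩
  filter_upwards [eventually_ge_atTop Z] with z hz
  rw [Real.norm_eq_abs, Real.norm_eq_abs, Real.abs_exp]
  have h1 := key 1 (by simp) z hz
  have h2 := key (-1) (by simp) z hz
  rw [abs_le]
  constructor <;> linarith

/-! ### From asymptotic rates to two-sided bounds on a half-line -/

theorem exists_bound_of_eventually_le {f : ℝ → ℝ} (hf : Continuous f) {C : ℝ}
    (h : ∀ᶠ z in atTop, f z ≤ C) : ∃ K > 0, ∀ z ≥ 0, f z ≤ K := by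
  obtain ⟨Z, hZ⟩ := eventually_atTop.1 h
  obtain ⟨B, hB⟩ := (isCompact_Icc (a := 0) (b := Z)).bddAbove_image hf.continuousOn
  refine ⟨max 1 (max B C), lt_max_of_lt_left one_pos, fun z hz => ?_⟩
  by_cases hzZ : z ≤ Z
  · exact (hB (Set.mem_image_of_mem f ⟨hz, hzZ⟩)).trans
      ((le_max_left _ _).trans (le_max_right _ _))
  · exact (hZ z (not_le.1 hzZ).le).trans ((le_max_right _ _).trans (le_max_right _ _))

theorem exists_le_exp_of_isBigO {f : ℝ → ℝ} {l : ℝ} (hf : Continuous f)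
    (h : f =O[atTop] fun z => Real.exp (l * z)) :
    ∃ K > 0, ∀ z ≥ 0, f z ≤ K * Real.exp (l * z) := by
  obtain ⟨C, -, hC⟩ := exists_bound_of_isBigO_exp h
  obtain ⟨K, hK, hle⟩ := exists_bound_of_eventually_le
    (f := fun z => f z / Real.exp (l * z)) (C := C)
    (hf.div (by fun_prop) fun z => (Real.exp_pos _).ne') (by
      filter_upwards [hC] with z hz
      rw [div_le_iff₀ (Real.exp_pos _)]
      exact (le_abs_self _).trans hz)
  exact ⟨K, hK, fun z hz => (div_le_iff₀ (Real.exp_pos _)).1 (hle z hz)⟩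

theorem exists_exp_le_of_isBigO {f : ℝ → ℝ} {l : ℝ} (hf : Continuous f) (hpos : ∀ z, 0 < f z)
    (h : (fun z => Real.exp (l * z)) =O[atTop] f) :
    ∃ k > 0, ∀ z ≥ 0, k * Real.exp (l * z) ≤ f z := by
  obtain ⟨C, -, hC⟩ := h.exists_pos
  obtain ⟨K, hK, hle⟩ := exists_bound_of_eventually_le
    (f := fun z => Real.exp (l * z) / f z) (C := C)
    ((by fun_prop : Continuous fun z => Real.exp (l * z)).div hf fun z => (hpos z).ne') (by
      filter_upwards [hC.bound] with z hz
      rw [div_le_iff₀ (hpos z)]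
      rwa [Real.norm_of_nonneg (Real.exp_pos _).le, Real.norm_of_nonneg (hpos z).le] at hz)
  refine ⟨K⁻¹, inv_pos.2 hK, fun z hz => ?_⟩
  have := (div_le_iff₀ (hpos z)).1 (hle z hz)
  rwa [inv_mul_le_iff₀ hK]

theorem expBounds_of_isBigO {D : ℝ → Fin 3 → ℝ} {l : ℝ} {S : Set (Fin 3)}
    (hc : ∀ i, Continuous fun z => D z i) (hpos : ∀ z i, 0 < D z i)
    (hu : ∀ i, (fun z => D z i) =O[atTop] fun z => Real.exp (l * z))
    (hlow : ∀ i ∈ S, (fun z => Real.exp (l * z)) =O[atTop] fun z => D z i) :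
    ExpBounds (Set.Ici 0) l S D := by
  classical
  choose K hK hKle using fun i => exists_le_exp_of_isBigO (hc i) (hu i)
  have hk : ∀ i, ∃ k : ℝ, 0 ≤ k ∧ (i ∈ S → 0 < k) ∧ ∀ z ≥ 0, k * Real.exp (l * z) ≤ D z i := by
    intro i
    by_cases hi : i ∈ S
    · obtain ⟨k, hk, hle⟩ := exists_exp_le_of_isBigO (hc i) (fun z => hpos z i) (hlow i hi)
      exact ⟨k, hk.le, fun _ => hk, hle⟩
    · exact ⟨0, le_rfl, fun h => absurd h hi, fun z _ => by simpa using (hpos z i).le⟩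
  choose k hk0 hkS hkle using hk
  exact ⟨k, K, hk0, hkS, fun i => (hK i).le, fun z hz i => ⟨hkle i z hz, hKle i z hz⟩⟩

theorem expBoundsLoss_of_isBigO {D : ℝ → Fin 3 → ℝ} {l : ℝ} {S : Set (Fin 3)}
    (hl : l < 0) (hc : ∀ i, Continuous fun z => D z i) (hpos : ∀ z i, 0 < D z i)
    (hu : ∀ m, l < m → m < 0 → ∀ i, (fun z => D z i) =O[atTop] fun z => Real.exp (m * z))
    (hlow : ∀ m < l, ∀ i ∈ S, (fun z => Real.exp (m * z)) =O[atTop] fun z => D z i) :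
    ExpBoundsLoss (Set.Ici 0) l S D := by
  have hK : ∀ ε : ℝ, ∀ i, ∃ K : ℝ, 0 < K ∧
      (0 < ε → ∀ z ≥ 0, D z i ≤ K * Real.exp ((l + ε) * z)) := by
    intro ε i
    by_cases hε : 0 < ε
    · have h1 : 0 < min ε (-l / 2) := lt_min hε (by linarith)
      have h2 := min_le_right ε (-l / 2)
      obtain ⟨K, hK, hle⟩ := exists_le_exp_of_isBigO (hc i)
        ((hu (l + min ε (-l / 2)) (by linarith) (by linarith) i).trans
          (isBigO_exp_exp (m := l + ε) (by linarith [min_le_left ε (-l / 2)])))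
      exact ⟨K, hK, fun _ => hle⟩
    · exact ⟨1, one_pos, fun h => absurd h hε⟩
  have hk : ∀ ε : ℝ, ∀ i, ∃ k : ℝ, 0 ≤ k ∧ (0 < ε → i ∈ S → 0 < k) ∧
      (0 < ε → ∀ z ≥ 0, k * Real.exp ((l - ε) * z) ≤ D z i) := by
    intro ε i
    by_cases hi : 0 < ε ∧ i ∈ S
    · obtain ⟨k, hk, hle⟩ := exists_exp_le_of_isBigO (hc i) (fun z => hpos z i)
        (hlow (l - ε) (by linarith [hi.1]) i hi.2)
      exact ⟨k, hk.le, fun _ _ => hk, fun _ => hle⟩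
    · exact ⟨0, le_rfl, fun h h' => absurd ⟨h, h'⟩ hi, fun _ z _ => by
        simpa using (hpos z i).le⟩
  choose K hK0 hKle using hK
  choose k hk0 hkS hkle using hk
  -- adding `1 / ε` makes the upper constants blow up
  refine ⟨k, fun ε i => K ε i + ε⁻¹, fun i => ?_, fun ε hε =>
    ⟨hk0 ε, fun i hi => hkS ε i hε hi, fun i => ?_, fun z hz i => ?_⟩⟩
  · exact tendsto_atTop_mono (fun ε => by linarith [(hK0 ε i)]) tendsto_inv_nhdsGT_zero
  · have := hK0 ε i
    positivity
  · have hz0 : (0 : ℝ) ≤ z := hz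
    rw [abs_of_nonneg hz0, ← sub_mul, ← add_mul]
    refine ⟨hkle ε i hε z hz0, (hKle ε i hε z hz0).trans ?_⟩
    refine mul_le_mul_of_nonneg_right ?_ (Real.exp_pos _).le
    have : 0 < ε⁻¹ := inv_pos.2 hε
    linarith

/-- `D` decays to zero at `+∞` and `d = -D'` is positive and continuous. -/
structure DecaysWith (D d : ℝ → Fin 3 → ℝ) : Prop where
  hasDerivAt : ∀ i z, HasDerivAt (fun z => D z i) (-d z i) z
  tendsto : ∀ i, Tendsto (fun z => D z i) atTop (𝓝 0)
  continuous : ∀ i, Continuous fun z => d z i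
  pos : ∀ z i, 0 < d z i

theorem DecaysWith.pos' {D d : ℝ → Fin 3 → ℝ} (h : DecaysWith D d) (z : ℝ) (i : Fin 3) :
    0 < D z i := by
  have hanti : StrictAnti fun z => D z i := strictAnti_of_deriv_neg fun z => by
    rw [(h.hasDerivAt i z).deriv]
    exact neg_neg_of_pos (h.pos z i)
  exact (hanti.antitone.le_of_tendsto (h.tendsto i) (z + 1)).trans_lt (hanti (lt_add_one z))

theorem DecaysWith.expBounds {D d : ℝ → Fin 3 → ℝ} (h : DecaysWith D d) {l : ℝ} (hl : l < 0)
    {S : Set (Fin 3)} (hu : ∀ i, (fun z => d z i) =O[atTop] fun z => Real.exp (l * z))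
    (hlow : ∀ i ∈ S, (fun z => Real.exp (l * z)) =O[atTop] fun z => d z i) :
    ExpBounds (Set.Ici 0) l S D ∧ ExpBounds (Set.Ici 0) l S d :=
  ⟨expBounds_of_isBigO
    (fun i => continuous_iff_continuousAt.2 fun z => (h.hasDerivAt i z).continuousAt) h.pos'
    (fun i => isBigO_exp_integrate hl (h.hasDerivAt i) (fun z => h.pos z i) (h.tendsto i) (hu i))
    (fun i hi => exp_isBigO_integrate hl (h.hasDerivAt i) (fun z => h.pos z i) (h.tendsto i)
      (hlow i hi)),
  expBounds_of_isBigO h.continuous h.pos hu hlow⟩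

theorem DecaysWith.expBoundsLoss {D d : ℝ → Fin 3 → ℝ} (h : DecaysWith D d) {l : ℝ} (hl : l < 0)
    {S : Set (Fin 3)}
    (hu : ∀ m, l < m → m < 0 → ∀ i, (fun z => d z i) =O[atTop] fun z => Real.exp (m * z))
    (hlow : ∀ m < l, ∀ i ∈ S, (fun z => Real.exp (m * z)) =O[atTop] fun z => d z i) :
    ExpBoundsLoss (Set.Ici 0) l S D ∧ ExpBoundsLoss (Set.Ici 0) l S d :=
  ⟨expBoundsLoss_of_isBigO hl
    (fun i => continuous_iff_continuousAt.2 fun z => (h.hasDerivAt i z).continuousAt) h.pos'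
    (fun m hm hm0 i => isBigO_exp_integrate hm0 (h.hasDerivAt i) (fun z => h.pos z i)
      (h.tendsto i) (hu m hm hm0 i))
    (fun m hm i hi => exp_isBigO_integrate (hm.trans hl) (h.hasDerivAt i) (fun z => h.pos z i)
      (h.tendsto i) (hlow m hm i hi)),
  expBoundsLoss_of_isBigO hl h.continuous h.pos hu hlow⟩

theorem ExpBounds.reflect {D : ℝ → Fin 3 → ℝ} {l : ℝ} {S : Set (Fin 3)}
    (h : ExpBounds (Set.Ici 0) (-l) S fun t => D (-t)) : ExpBounds (Set.Iic 0) l S D := by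
  obtain ⟨k, K, h1, h2, h3, h4⟩ := h
  refine ⟨k, K, h1, h2, h3, fun z hz i => ?_⟩
  have := h4 (-z) (Set.mem_Ici.2 (neg_nonneg.2 (Set.mem_Iic.1 hz))) i
  simpa using this

theorem ExpBoundsLoss.reflect {D : ℝ → Fin 3 → ℝ} {l : ℝ} {S : Set (Fin 3)}
    (h : ExpBoundsLoss (Set.Ici 0) (-l) S fun t => D (-t)) :
    ExpBoundsLoss (Set.Iic 0) l S D := by
  obtain ⟨k, K, h1, h2⟩ := h
  refine ⟨k, K, h1, fun ε hε => ?_⟩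
  obtain ⟨h3, h4, h5, h6⟩ := h2 ε hε
  refine ⟨h3, h4, h5, fun z hz i => ?_⟩
  have := h6 (-z) (Set.mem_Ici.2 (neg_nonneg.2 (Set.mem_Iic.1 hz))) i
  simpa using this

/-! ### The Jacobian of the source -/

section Jacobian

variable {p : Params} {x : Fin 3 → ℝ}

theorem Params.contDiffAt_F (h0 : 0 < 1 + x 0) (h2 : 0 < 1 + x 2) : ContDiffAt ℝ 2 p.F x := by
  have c0 : ContDiffAt ℝ 2 (fun y : Fin 3 → ℝ => y 0) x := contDiffAt_apply ..
  have c1 : ContDiffAt ℝ 2 (fun y : Fin 3 → ℝ => y 1) x := contDiffAt_apply ..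
  have c2 : ContDiffAt ℝ 2 (fun y : Fin 3 → ℝ => y 2) x := contDiffAt_apply ..
  have hP : ∀ k : ℝ, ContDiffAt ℝ 2 (fun y : Fin 3 → ℝ => (1 + y 2) ^ k) x := fun k =>
    (contDiffAt_const.add c2).rpow_const_of_ne h2.ne'
  have hu : ∀ k : ℝ, ContDiffAt ℝ 2 (fun y : Fin 3 → ℝ => (1 + y 0) ^ k) x := fun k =>
    (contDiffAt_const.add c0).rpow_const_of_ne h0.ne'
  have hσ : ContDiffAt ℝ 2
      (fun y : Fin 3 → ℝ => 1 / (1 + Real.exp (-p.beta * (y 1 - p.alpha)))) x :=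
    contDiffAt_const.div
      (contDiffAt_const.add (contDiffAt_const.mul (c1.sub contDiffAt_const)).exp)
      (by positivity)
  rw [contDiffAt_pi]
  intro i
  fin_cases i
  · exact (((((hP _).mul hσ).mul contDiffAt_const).mul c0).mul (contDiffAt_const.sub c0)).sub
      (contDiffAt_const.mul c0)
  · exact contDiffAt_const.sub ((((hP _).mul contDiffAt_const).mul (hu _)).mul c1)
  · exact c0.mul (contDiffAt_const.sub c2)

theorem Params.differentiableAt_F (h0 : 0 < 1 + x 0) (h2 : 0 < 1 + x 2) :
    DifferentiableAt ℝ p.F x :=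
  (p.contDiffAt_F h0 h2).differentiableAt (by norm_num)

theorem Params.differentiableAt_jacobian (h0 : 0 < 1 + x 0) (h2 : 0 < 1 + x 2) (i j : Fin 3) :
    DifferentiableAt ℝ (fun y => jacobian p.F y i j) x := by
  have h : DifferentiableAt ℝ (fderiv ℝ p.F) x :=
    ((p.contDiffAt_F h0 h2).fderiv_right (m := 1) (by norm_num)).differentiableAt (by norm_num)
  have h' := h.clm_apply (differentiableAt_const (Pi.single j 1))
  exact differentiableAt_pi.1 h' i

theorem fderiv_apply_eq_jacobian {n : ℕ} (F : (Fin n → ℝ) → (Fin n → ℝ)) (x v : Fin n → ℝ)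
    (i : Fin n) : fderiv ℝ F x v i = ∑ j, jacobian F x i j * v j := by
  conv_lhs => rw [← Finset.univ_sum_single v]
  rw [map_sum, Finset.sum_apply]
  refine Finset.sum_congr rfl fun j _ => ?_
  have : (Pi.single j (v j) : Fin n → ℝ) = v j • Pi.single j 1 := by
    rw [← Pi.single_smul]; simp
  rw [this, map_smul, jacobian, Pi.smul_apply, smul_eq_mul, mul_comm]

/-- Jacobian entries are derivatives along coordinate lines. -/
theorem hasDerivAt_update_jacobian {n : ℕ} {F : (Fin n → ℝ) → (Fin n → ℝ)} {x : Fin n → ℝ}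
    (h : DifferentiableAt ℝ F x) (i j : Fin n) :
    HasDerivAt (fun t => F (Function.update x j t) i) (jacobian F x i j) (x j) := by
  have hx : Function.update x j (x j) = x := Function.update_eq_self j x
  have h1 : HasFDerivAt F (fderiv ℝ F x) (Function.update x j (x j)) := by
    rw [hx]; exact h.hasFDerivAt
  exact hasDerivAt_pi.1 (h1.comp_hasDerivAt _ (hasDerivAt_update x j (x j))) i

theorem jacobian_eq_of_hasDerivAt {n : ℕ} {F : (Fin n → ℝ) → (Fin n → ℝ)} {x : Fin n → ℝ}
    (h : DifferentiableAt ℝ F x) {i j : Fin n} {a : ℝ}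
    (ha : HasDerivAt (fun t => F (Function.update x j t) i) a (x j)) : jacobian F x i j = a :=
  (hasDerivAt_update_jacobian h i j).unique ha

theorem hasDerivAt_one_add_rpow {a : ℝ} (ha : 0 < 1 + a) (k : ℝ) :
    HasDerivAt (fun t => (1 + t) ^ k) (k * (1 + a) ^ (k - 1)) a := by
  have := ((hasDerivAt_id a).const_add 1).rpow_const (p := k) (Or.inl ha.ne')
  simpa using this

theorem Params.fu_eq (h0 : 0 < 1 + x 0) (h2 : 0 < 1 + x 2) :
    jacobian p.F x 0 0 = (1 + x 2) ^ p.k1 * (1 / (1 + Real.exp (-p.beta * (x 1 - p.alpha))))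
      * p.Gam * (1 - 2 * x 0) - p.omega := by
  refine jacobian_eq_of_hasDerivAt (p.differentiableAt_F h0 h2) ?_
  have h := ((((hasDerivAt_id (x 0)).const_mul ((1 + x 2) ^ p.k1 *
    (1 / (1 + Real.exp (-p.beta * (x 1 - p.alpha)))) * p.Gam)).fun_mul
      ((hasDerivAt_id (x 0)).const_sub 1))).fun_sub ((hasDerivAt_id (x 0)).const_mul p.omega)
  refine (h.congr_of_eventuallyEq (Eventually.of_forall fun t => ?_)).congr_deriv ?_
  · simp [Params.F, Params.f]
  · simp only [id]; ring

theorem Params.fv_eq (h0 : 0 < 1 + x 0) (h2 : 0 < 1 + x 2) :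
    jacobian p.F x 0 1 = (1 + x 2) ^ p.k1 * (p.beta * Real.exp (-p.beta * (x 1 - p.alpha))
      / (1 + Real.exp (-p.beta * (x 1 - p.alpha))) ^ 2) * p.Gam * x 0 * (1 - x 0) := by
  refine jacobian_eq_of_hasDerivAt (p.differentiableAt_F h0 h2) ?_
  have he : HasDerivAt (fun t => 1 + Real.exp (-p.beta * (t - p.alpha)))
      (Real.exp (-p.beta * (x 1 - p.alpha)) * -p.beta) (x 1) := by
    simpa using ((((hasDerivAt_id (x 1)).sub_const p.alpha).const_mul (-p.beta)).exp).const_add 1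
  have hne : 1 + Real.exp (-p.beta * (x 1 - p.alpha)) ≠ 0 := by positivity
  have h := ((((((he.fun_inv hne).const_mul ((1 + x 2) ^ p.k1)).mul_const p.Gam).mul_const
    (x 0)).mul_const (1 - x 0)).sub_const (p.omega * x 0))
  refine (h.congr_of_eventuallyEq (Eventually.of_forall fun t => ?_)).congr_deriv ?_
  · simp [Params.F, Params.f]
  · ring

theorem Params.fP_eq (h0 : 0 < 1 + x 0) (h2 : 0 < 1 + x 2) :
    jacobian p.F x 0 2 = p.k1 * (1 + x 2) ^ (p.k1 - 1) *
      (1 / (1 + Real.exp (-p.beta * (x 1 - p.alpha)))) * p.Gam * x 0 * (1 - x 0) := by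
  refine jacobian_eq_of_hasDerivAt (p.differentiableAt_F h0 h2) ?_
  have h := (((((hasDerivAt_one_add_rpow h2 p.k1).mul_const
    (1 / (1 + Real.exp (-p.beta * (x 1 - p.alpha))))).mul_const p.Gam).mul_const
    (x 0)).mul_const (1 - x 0)).sub_const (p.omega * x 0)
  refine h.congr_of_eventuallyEq (Eventually.of_forall fun t => ?_)
  simp [Params.F, Params.f]

theorem Params.gu_eq (h0 : 0 < 1 + x 0) (h2 : 0 < 1 + x 2) :
    jacobian p.F x 1 0
      = p.k0 * ((1 + x 2) ^ (-p.k2) * p.theta * (1 + x 0) ^ (-p.k0 - 1) * x 1) := by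
  refine jacobian_eq_of_hasDerivAt (p.differentiableAt_F h0 h2) ?_
  have h := (((hasDerivAt_one_add_rpow h0 (-p.k0)).const_mul
    ((1 + x 2) ^ (-p.k2) * p.theta)).mul_const (x 1)).const_sub 1
  refine (h.congr_of_eventuallyEq (Eventually.of_forall fun t => ?_)).congr_deriv ?_
  · simp [Params.F, Params.g]
  · ring

theorem Params.gv_eq (h0 : 0 < 1 + x 0) (h2 : 0 < 1 + x 2) :
    jacobian p.F x 1 1 = -((1 + x 2) ^ (-p.k2) * p.theta * (1 + x 0) ^ (-p.k0)) := by
  refine jacobian_eq_of_hasDerivAt (p.differentiableAt_F h0 h2) ?_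
  have h := ((hasDerivAt_id (x 1)).const_mul
    ((1 + x 2) ^ (-p.k2) * p.theta * (1 + x 0) ^ (-p.k0))).const_sub 1
  refine (h.congr_of_eventuallyEq (Eventually.of_forall fun t => ?_)).congr_deriv ?_
  · simp [Params.F, Params.g]
  · ring

theorem Params.gP_eq (h0 : 0 < 1 + x 0) (h2 : 0 < 1 + x 2) :
    jacobian p.F x 1 2
      = p.k2 * ((1 + x 2) ^ (-p.k2 - 1) * p.theta * (1 + x 0) ^ (-p.k0) * x 1) := by
  refine jacobian_eq_of_hasDerivAt (p.differentiableAt_F h0 h2) ?_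
  have h := ((((hasDerivAt_one_add_rpow h2 (-p.k2)).mul_const p.theta).mul_const
    ((1 + x 0) ^ (-p.k0))).mul_const (x 1)).const_sub 1
  refine (h.congr_of_eventuallyEq (Eventually.of_forall fun t => ?_)).congr_deriv ?_
  · simp [Params.F, Params.g]
  · ring

theorem Params.su_eq (h0 : 0 < 1 + x 0) (h2 : 0 < 1 + x 2) : jacobian p.F x 2 0 = 1 - x 2 := by
  refine jacobian_eq_of_hasDerivAt (p.differentiableAt_F h0 h2) ?_
  have h := (hasDerivAt_id (x 0)).mul_const (1 - x 2)
  refine (h.congr_of_eventuallyEq (Eventually.of_forall fun t => ?_)).congr_deriv (one_mul _)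
  simp [Params.F, Params.s]

theorem Params.sv_eq (h0 : 0 < 1 + x 0) (h2 : 0 < 1 + x 2) : jacobian p.F x 2 1 = 0 := by
  refine jacobian_eq_of_hasDerivAt (p.differentiableAt_F h0 h2) ?_
  have h := hasDerivAt_const (x 1) (x 0 * (1 - x 2))
  refine h.congr_of_eventuallyEq (Eventually.of_forall fun t => ?_)
  simp [Params.F, Params.s]

theorem Params.sP_eq (h0 : 0 < 1 + x 0) (h2 : 0 < 1 + x 2) : jacobian p.F x 2 2 = -x 0 := by
  refine jacobian_eq_of_hasDerivAt (p.differentiableAt_F h0 h2) ?_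
  have h := ((hasDerivAt_id (x 2)).const_sub 1).const_mul (x 0)
  refine (h.congr_of_eventuallyEq (Eventually.of_forall fun t => ?_)).congr_deriv (by ring)
  simp [Params.F, Params.s]

/-- The system is cooperative on `0 ≤ u ≤ 1`, `v ≥ 0`, `0 ≤ P ≤ 1`. -/
theorem Params.Admissible.jacobian_offDiag_nonneg (hp : p.Admissible) (h0 : 0 ≤ x 0)
    (h0' : x 0 ≤ 1) (h1 : 0 ≤ x 1) (h2 : 0 ≤ x 2) (h2' : x 2 ≤ 1) (i j : Fin 3) (hij : i ≠ j) :
    0 ≤ jacobian p.F x i j := by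
  have a0 : 0 < 1 + x 0 := by linarith
  have a2 : 0 < 1 + x 2 := by linarith
  have b := hp.beta_pos
  have G := hp.Gam_pos
  have t := hp.theta_pos
  have k0 := hp.k0_nonneg
  have k1 := hp.k1_nonneg
  have k2 := hp.k2_nonneg
  have u1 : 0 ≤ 1 - x 0 := by linarith
  fin_cases i <;> fin_cases j <;>
    simp only [Fin.isValue, Fin.zero_eta, Fin.mk_one, Fin.reduceFinMk, ne_eq, not_true_eq_false]
      at hij ⊢
  · rw [p.fv_eq a0 a2]; positivity
  · rw [p.fP_eq a0 a2]; positivity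
  · rw [p.gu_eq a0 a2]; positivity
  · rw [p.gP_eq a0 a2]; positivity
  · rw [p.su_eq a0 a2]; linarith
  · rw [p.sv_eq a0 a2]

theorem Params.Admissible.fv_pos (hp : p.Admissible) (h0 : 0 < x 0) (h0' : x 0 < 1)
    (h2 : 0 < 1 + x 2) : 0 < jacobian p.F x 0 1 := by
  have b := hp.beta_pos
  have G := hp.Gam_pos
  have u1 : 0 < 1 - x 0 := by linarith
  rw [p.fv_eq (by linarith) h2]
  positivity

theorem Params.Admissible.fP_pos (hp : p.Admissible) (hk : 0 < p.k1) (h0 : 0 < x 0)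
    (h0' : x 0 < 1) (h2 : 0 < 1 + x 2) : 0 < jacobian p.F x 0 2 := by
  have G := hp.Gam_pos
  have u1 : 0 < 1 - x 0 := by linarith
  rw [p.fP_eq (by linarith) h2]
  positivity

theorem Params.Admissible.gu_pos (hp : p.Admissible) (hk : 0 < p.k0) (h0 : 0 < 1 + x 0)
    (h1 : 0 < x 1) (h2 : 0 < 1 + x 2) : 0 < jacobian p.F x 1 0 := by
  have t := hp.theta_pos
  rw [p.gu_eq h0 h2]
  positivity

theorem Params.Admissible.gP_pos (hp : p.Admissible) (hk : 0 < p.k2) (h0 : 0 < 1 + x 0)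
    (h1 : 0 < x 1) (h2 : 0 < 1 + x 2) : 0 < jacobian p.F x 1 2 := by
  have t := hp.theta_pos
  rw [p.gP_eq h0 h2]
  positivity

theorem Params.Admissible.gv_neg (hp : p.Admissible) (h0 : 0 < 1 + x 0) (h2 : 0 < 1 + x 2) :
    jacobian p.F x 1 1 < 0 := by
  have t := hp.theta_pos
  rw [p.gv_eq h0 h2, neg_lt_zero]
  positivity

end Jacobian

/-! ### Basic properties of monotone waves -/

/-- The standing hypotheses: a monotone wave of speed `c` from the stable positive steady state `Um`
to the trivial steady state `Up` with police density `P < 1`. -/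
structure IsFront (p : Params) (c P : ℝ) (Up Um : Fin 3 → ℝ) (U : ℝ → Fin 3 → ℝ) : Prop where
  adm : p.Admissible
  P_nonneg : 0 ≤ P
  P_lt_one : P < 1
  Up_eq : Up = p.trivialState P
  Um_two : Um 2 = 1
  steady : p.F Um = 0
  stable : p.fv Um * p.gu Um - p.fu Um * p.gv Um < 0
  wave : IsMonotoneWave p c Up Um U

/-- The per-capita growth rate `f / u`. -/
noncomputable def Params.growth (p : Params) (x : Fin 3 → ℝ) : ℝ :=
  (1 + x 2) ^ p.k1 * (1 / (1 + Real.exp (-p.beta * (x 1 - p.alpha)))) * p.Gam * (1 - x 0) - p.omega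

theorem Params.F_zero_eq (p : Params) (x : Fin 3 → ℝ) : p.F x 0 = x 0 * p.growth x := by
  simp only [Params.F, Params.f, Params.growth, Matrix.cons_val_zero]
  ring

theorem Params.differentiableAt_growth {p : Params} {x : Fin 3 → ℝ} (h2 : 0 < 1 + x 2) :
    DifferentiableAt ℝ p.growth x := by
  have c0 : DifferentiableAt ℝ (fun y : Fin 3 → ℝ => y 0) x := differentiableAt_apply 0 x
  have c1 : DifferentiableAt ℝ (fun y : Fin 3 → ℝ => y 1) x := differentiableAt_apply 1 x
  have c2 : DifferentiableAt ℝ (fun y : Fin 3 → ℝ => y 2) x := differentiableAt_apply 2 x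
  unfold Params.growth
  have hP : DifferentiableAt ℝ (fun y : Fin 3 → ℝ => (1 + y 2) ^ p.k1) x :=
    (c2.const_add 1).rpow_const (Or.inl h2.ne')
  have hσ : DifferentiableAt ℝ
      (fun y : Fin 3 → ℝ => 1 / (1 + Real.exp (-p.beta * (y 1 - p.alpha)))) x := by
    fun_prop (disch := positivity)
  exact (((hP.mul hσ).mul_const p.Gam).mul (c0.const_sub 1)).sub_const p.omega

namespace IsFront

variable {p : Params} {c P : ℝ} {Up Um : Fin 3 → ℝ} {U : ℝ → Fin 3 → ℝ}

section

variable (h : IsFront p c P Up Um U)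

include h

theorem Up_zero : Up 0 = 0 := by rw [h.Up_eq]; rfl
theorem Up_one : Up 1 = (1 + P) ^ p.k2 / p.theta := by rw [h.Up_eq]; rfl
theorem Up_two : Up 2 = P := by rw [h.Up_eq]; rfl

theorem hasDerivAt (i : Fin 3) (z : ℝ) :
    HasDerivAt (fun t => U t i) (-negDeriv U z i) z := by
  have : Differentiable ℝ fun t => U t i := by
    fin_cases i
    · exact h.wave.smooth_u.differentiable (by norm_num)
    · exact h.wave.smooth_v.differentiable (by norm_num)
    · exact h.wave.smooth_P.differentiable (by norm_num)
  simpa [negDeriv] using (this z).hasDerivAt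

theorem continuous_comp (i : Fin 3) : Continuous fun t => U t i :=
  continuous_iff_continuousAt.2 fun z => (h.hasDerivAt i z).continuousAt

theorem tendsto_top (i : Fin 3) : Tendsto (fun z => U z i) atTop (𝓝 (Up i)) :=
  tendsto_pi_nhds.1 h.wave.lim_top i

theorem tendsto_bot (i : Fin 3) : Tendsto (fun z => U z i) atBot (𝓝 (Um i)) :=
  tendsto_pi_nhds.1 h.wave.lim_bot i

theorem negDeriv_zero_pos (z : ℝ) : 0 < negDeriv U z 0 := neg_pos.2 (h.wave.u_decreasing z)
theorem negDeriv_one_pos (z : ℝ) : 0 < negDeriv U z 1 := neg_pos.2 (h.wave.v_decreasing z)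

theorem strictAnti_of_pos {i : Fin 3} (hi : ∀ z, 0 < negDeriv U z i) :
    StrictAnti fun z => U z i := strictAnti_of_deriv_neg fun z => by
  rw [(h.hasDerivAt i z).deriv]
  exact neg_neg_of_pos (hi z)

theorem lt_and_lt_of_pos {i : Fin 3} (hi : ∀ z, 0 < negDeriv U z i) (z : ℝ) :
    Up i < U z i ∧ U z i < Um i := by
  have ha := h.strictAnti_of_pos hi
  exact ⟨(ha.antitone.le_of_tendsto (h.tendsto_top i) (z + 1)).trans_lt (ha (lt_add_one z)),
    (ha (sub_one_lt z)).trans_le (ha.antitone.ge_of_tendsto (h.tendsto_bot i) (z - 1))⟩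

theorem u_pos (z : ℝ) : 0 < U z 0 := by
  have := (h.lt_and_lt_of_pos h.negDeriv_zero_pos z).1
  rwa [h.Up_zero] at this

theorem ode_P (z : ℝ) : c * negDeriv U z 2 = U z 0 * (1 - U z 2) := by
  have := h.wave.ode z 2
  simp only [diffusion, Params.F, Params.s, Matrix.cons_val] at this
  simp only [negDeriv]
  linarith

theorem c_pos : 0 < c := by
  have hlt : Up 2 < 1 := by rw [h.Up_two]; exact h.P_lt_one
  rcases lt_trichotomy c 0 with hc | hc | hc
  · exfalso
    have hm : Monotone fun z => U z 2 := monotone_of_deriv_nonneg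
      (fun z => (h.hasDerivAt 2 z).differentiableAt) fun z => by
        rw [(h.hasDerivAt 2 z).deriv]
        have h1 := h.ode_P z
        have h2 := mul_nonneg (h.u_pos z).le (sub_nonneg.2 (h.wave.P_le_one z))
        nlinarith
    have h1 := hm.le_of_tendsto (h.tendsto_bot 2) 0
    have h2 := hm.ge_of_tendsto (h.tendsto_top 2) 0
    rw [h.Um_two] at h1
    linarith
  · exfalso
    have h1 : ∀ z, U z 2 = 1 := fun z => by
      have h1 := h.ode_P z
      rw [hc, zero_mul] at h1
      rcases mul_eq_zero.1 h1.symm with h2 | h2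
      · exact absurd h2 (h.u_pos z).ne'
      · linarith
    have h2 := h.tendsto_top 2
    simp only [h1] at h2
    exact hlt.ne (tendsto_nhds_unique h2 tendsto_const_nhds)
  · exact hc

theorem negDeriv_two (z : ℝ) : negDeriv U z 2 = U z 0 * (1 - U z 2) / c := by
  rw [eq_div_iff h.c_pos.ne', mul_comm]
  exact h.ode_P z

/-- `1 - P` satisfies the linear equation `Q' = Q u / c`. -/
theorem hasDerivAt_one_sub_P (z : ℝ) :
    HasDerivAt (fun t => 1 - U t 2) ((1 - U z 2) * (U z 0 / c)) z :=
  ((h.hasDerivAt 2 z).const_sub 1).congr_deriv (by rw [h.negDeriv_two]; ring)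

theorem P_lt (z₀ : ℝ) : U z₀ 2 < 1 := by
  refine lt_of_le_of_ne (h.wave.P_le_one z₀) fun heq => ?_
  have hanti : Antitone fun t => (1 - U t 2) * Real.exp (-(Um 0 / c) * t) :=
    antitone_of_deriv_nonpos
      (fun z => ((h.hasDerivAt_one_sub_P z).fun_mul (hasDerivAt_exp_mul _ z)).differentiableAt)
      fun z => by
        rw [((h.hasDerivAt_one_sub_P z).fun_mul (hasDerivAt_exp_mul _ z)).deriv]
        have h1 : U z 0 / c ≤ Um 0 / c := div_le_div_of_nonneg_right
          (h.lt_and_lt_of_pos h.negDeriv_zero_pos z).2.le h.c_pos.le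
        have h2 := mul_nonneg (sub_nonneg.2 (h.wave.P_le_one z))
          (Real.exp_pos (-(Um 0 / c) * z)).le
        nlinarith
  have h1 : ∀ z ≥ z₀, U z 2 = 1 := fun z hz => by
    have h2 := hanti hz
    simp only [heq, sub_self, zero_mul] at h2
    have h3 := nonpos_of_mul_nonpos_left h2 (Real.exp_pos _)
    linarith [h.wave.P_le_one z]
  have h2 : Tendsto (fun z => U z 2) atTop (𝓝 1) :=
    tendsto_const_nhds.congr' (by
      filter_upwards [eventually_ge_atTop z₀] with z hz using (h1 z hz).symm)
  have h3 := tendsto_nhds_unique (h.tendsto_top 2) h2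
  rw [h.Up_two] at h3
  linarith [h.P_lt_one]

theorem negDeriv_pos (z : ℝ) (i : Fin 3) : 0 < negDeriv U z i := by
  fin_cases i
  · exact h.negDeriv_zero_pos z
  · exact h.negDeriv_one_pos z
  · change 0 < negDeriv U z 2
    rw [h.negDeriv_two]
    exact div_pos (mul_pos (h.u_pos z) (sub_pos.2 (h.P_lt z))) h.c_pos

theorem strictAnti (i : Fin 3) : StrictAnti fun z => U z i :=
  h.strictAnti_of_pos fun z => h.negDeriv_pos z i

theorem Up_lt (z : ℝ) (i : Fin 3) : Up i < U z i :=
  (h.lt_and_lt_of_pos (fun z => h.negDeriv_pos z i) z).1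

theorem lt_Um (z : ℝ) (i : Fin 3) : U z i < Um i :=
  (h.lt_and_lt_of_pos (fun z => h.negDeriv_pos z i) z).2

theorem Um_zero_pos : 0 < Um 0 := (h.u_pos 0).trans (h.lt_Um 0 0)

theorem Um_one_pos : 0 < Um 1 := (h.wave.v_nonneg 0).trans_lt (h.lt_Um 0 1)

theorem Um_growth : p.growth Um = 0 := by
  have h1 := congrFun h.steady 0
  rw [p.F_zero_eq] at h1
  exact (mul_eq_zero.1 h1).resolve_left h.Um_zero_pos.ne'

theorem Um_zero_lt_one : Um 0 < 1 := by
  have h1 := h.Um_growth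
  have hG := h.adm.Gam_pos
  have hω := h.adm.omega_pos
  unfold Params.growth at h1
  rw [h.Um_two] at h1
  by_contra! hle
  have h2 : 0 ≤ (1 + 1 : ℝ) ^ p.k1 * (1 / (1 + Real.exp (-p.beta * (Um 1 - p.alpha)))) * p.Gam := by
    positivity
  nlinarith

theorem Up_one_pos : 0 < Up 1 := by
  have := h.adm.theta_pos
  have := h.P_nonneg
  rw [h.Up_one]
  positivity

theorem u_lt_one (z : ℝ) : U z 0 < 1 := (h.lt_Um z 0).trans h.Um_zero_lt_one

theorem v_pos (z : ℝ) : 0 < U z 1 := h.Up_one_pos.trans (h.Up_lt z 1)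

theorem one_add_u_pos (z : ℝ) : 0 < 1 + U z 0 := by linarith [h.u_pos z]
theorem one_add_P_pos (z : ℝ) : 0 < 1 + U z 2 := by linarith [h.wave.P_nonneg z]
theorem one_add_Up_zero : 0 < 1 + Up 0 := by rw [h.Up_zero]; norm_num
theorem one_add_Up_two : 0 < 1 + Up 2 := by rw [h.Up_two]; linarith [h.P_nonneg]
theorem one_add_Um_zero : 0 < 1 + Um 0 := by linarith [h.Um_zero_pos]
theorem one_add_Um_two : 0 < 1 + Um 2 := by rw [h.Um_two]; norm_num

/-- Without feedback on `v` both steady states would share the same tension, so that `v` could not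
decrease. -/
theorem k0_pos_or_k2_pos : 0 < p.k0 ∨ 0 < p.k2 := by
  by_contra! hle
  have h0 : p.k0 = 0 := le_antisymm hle.1 h.adm.k0_nonneg
  have h2 : p.k2 = 0 := le_antisymm hle.2 h.adm.k2_nonneg
  have hθ := h.adm.theta_pos
  have h3 := congrFun h.steady 1
  simp only [Params.F, Params.g, h0, h2, Matrix.cons_val, Pi.zero_apply, neg_zero, Real.rpow_zero,
    one_mul, mul_one] at h3
  have h4 := (h.Up_lt 0 1).trans (h.lt_Um 0 1)
  rw [h.Up_one, h2, Real.rpow_zero, div_lt_iff₀ hθ] at h4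
  linarith

theorem F_Up : p.F Up = 0 := by
  have hθ := h.adm.theta_pos
  have hP : 0 < 1 + P := by linarith [h.P_nonneg]
  funext i
  fin_cases i
  · simp [Params.F, Params.f, h.Up_zero]
  · simp only [Params.F, Params.g, h.Up_zero, h.Up_one, h.Up_two, Fin.mk_one, Matrix.cons_val,
      Pi.zero_apply, add_zero, Real.one_rpow, mul_one, Real.rpow_neg hP.le]
    have : (1 + P) ^ p.k2 ≠ 0 := (Real.rpow_pos_of_pos hP _).ne'
    field_simp
    ring
  · simp [Params.F, Params.s, h.Up_zero]

theorem hasDerivAt_F (i : Fin 3) (z : ℝ) :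
    HasDerivAt (fun t => p.F (U t) i) (-∑ j, jacobian p.F (U z) i j * negDeriv U z j) z := by
  have hU : HasDerivAt U (fun i => -negDeriv U z i) z := hasDerivAt_pi.2 fun i => h.hasDerivAt i z
  have h1 := (p.differentiableAt_F (h.one_add_u_pos z)
    (h.one_add_P_pos z)).hasFDerivAt.comp_hasDerivAt z hU
  refine (hasDerivAt_pi.1 h1 i).congr_deriv ?_
  rw [fderiv_apply_eq_jacobian, ← Finset.sum_neg_distrib]
  exact Finset.sum_congr rfl fun j _ => by ring

/-- The derivatives `-u'` and `-v'` solve the linearized equations. -/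
theorem hasDerivs_negDeriv {i : Fin 3} (hi : i ≠ 2) :
    HasDerivs (fun z => negDeriv U z i) (fun z => -c * negDeriv U z i + p.F (U z) i)
      (fun z => -c * (-c * negDeriv U z i + p.F (U z) i)
        - ∑ j, jacobian p.F (U z) i j * negDeriv U z j) := by
  have hdiff : Differentiable ℝ (deriv fun t => U t i) := by
    have h2 : ContDiff ℝ 2 fun t => U t i := by
      fin_cases i
      · exact h.wave.smooth_u
      · exact h.wave.smooth_v
      · exact absurd rfl hi
    exact (h2.iterate_deriv' 1 1).differentiable (by norm_num)
  have hd : ∀ z, HasDerivAt (fun z => negDeriv U z i)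
      (-c * negDeriv U z i + p.F (U z) i) z := fun z => by
    refine (hdiff z).hasDerivAt.neg.congr_deriv ?_
    have h1 := h.wave.ode z i
    have h2 : diffusion i = 1 := by
      fin_cases i
      · rfl
      · rfl
      · exact absurd rfl hi
    rw [h2] at h1
    simp only [negDeriv]
    linarith
  refine ⟨hd, fun z => (((hd z).const_mul (-c)).fun_add (h.hasDerivAt_F i z)).congr_deriv ?_⟩
  ring

theorem continuous_negDeriv (i : Fin 3) : Continuous fun z => negDeriv U z i := by
  by_cases hi : i = 2
  · subst hi
    simp only [h.negDeriv_two]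
    have h0 := h.continuous_comp 0
    have h2 := h.continuous_comp 2
    fun_prop
  · exact (h.hasDerivs_negDeriv hi).continuous

theorem tendsto_F_top (i : Fin 3) : Tendsto (fun z => p.F (U z) i) atTop (𝓝 0) := by
  have h1 := (p.differentiableAt_F h.one_add_Up_zero h.one_add_Up_two).continuousAt.tendsto.comp
    h.wave.lim_top
  rw [h.F_Up] at h1
  exact tendsto_pi_nhds.1 h1 i

theorem tendsto_F_bot (i : Fin 3) : Tendsto (fun z => p.F (U z) i) atBot (𝓝 0) := by
  have h1 := (p.differentiableAt_F h.one_add_Um_zero h.one_add_Um_two).continuousAt.tendsto.comp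
    h.wave.lim_bot
  rw [h.steady] at h1
  exact tendsto_pi_nhds.1 h1 i

theorem tendsto_negDeriv_top {i : Fin 3} (hi : i ≠ 2) :
    Tendsto (fun z => negDeriv U z i) atTop (𝓝 0) := by
  have h1 := h.hasDerivs_negDeriv hi
  have h2 := tendsto_deriv_zero (c := c) (w := fun z => U z i) (w₁ := fun z => -negDeriv U z i)
    ⟨h.hasDerivAt i, fun z => (h1.1 z).fun_neg⟩ (h.tendsto_top i)
    (by simpa using (h.tendsto_F_top i).neg.congr fun z => by ring)
  simpa using h2.neg

end

/-- Reflection in the origin turns the behaviour at `-∞` into behaviour at `+∞`, with `c` replaced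
by `-c`. -/
theorem hasDerivs_reflect {w w₁ w₂ : ℝ → ℝ} (hw : HasDerivs w w₁ w₂) :
    HasDerivs (fun t => w (-t)) (fun t => -w₁ (-t)) (fun t => w₂ (-t)) := by
  refine ⟨fun t => ?_, fun t => ?_⟩
  · exact ((hw.1 (-t)).scomp t (hasDerivAt_neg t)).congr_deriv (by simp)
  · exact ((hw.2 (-t)).scomp t (hasDerivAt_neg t)).fun_neg.congr_deriv (by simp)

variable (h : IsFront p c P Up Um U)

include h

theorem tendsto_reflect : Tendsto (fun t => U (-t)) atTop (𝓝 Um) :=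
  h.wave.lim_bot.comp tendsto_neg_atTop_atBot

theorem tendsto_negDeriv_reflect {i : Fin 3} (hi : i ≠ 2) :
    Tendsto (fun t => negDeriv U (-t) i) atTop (𝓝 0) := by
  have h1 := h.hasDerivs_negDeriv hi
  have h2 := hasDerivs_reflect (w := fun z => U z i) (w₁ := fun z => -negDeriv U z i)
    ⟨h.hasDerivAt i, fun z => (h1.1 z).fun_neg⟩
  have h3 := tendsto_deriv_zero (c := -c) h2
    ((h.tendsto_bot i).comp tendsto_neg_atTop_atBot)
    (by
      have h4 := ((h.tendsto_F_bot i).comp tendsto_neg_atTop_atBot).neg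
      rw [neg_zero] at h4
      exact h4.congr fun z => by simp only [Function.comp]; ring)
  simpa using h3

theorem decaysWith_top : DecaysWith (fun z => U z - Up) (negDeriv U) where
  hasDerivAt i z := (h.hasDerivAt i z).sub_const (Up i)
  tendsto i := by simpa using (h.tendsto_top i).sub_const (Up i)
  continuous := h.continuous_negDeriv
  pos := h.negDeriv_pos

theorem decaysWith_reflect :
    DecaysWith (fun t => Um - U (-t)) (fun t => negDeriv U (-t)) where
  hasDerivAt i t := by
    have := ((h.hasDerivAt i (-t)).scomp t (hasDerivAt_neg t)).const_sub (Um i)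
    simpa using this
  tendsto i := by
    simpa using ((h.tendsto_bot i).comp tendsto_neg_atTop_atBot).const_sub (Um i)
  continuous i := (h.continuous_negDeriv i).comp continuous_neg
  pos t := h.negDeriv_pos (-t)

end IsFront

/-- Exponential convergence is inherited by differentiable functions. -/
theorem isBigO_sub_of_differentiableAt {Φ : (Fin 3 → ℝ) → ℝ} {x₀ : Fin 3 → ℝ}
    {X : ℝ → Fin 3 → ℝ} {g : ℝ → ℝ} (hΦ : DifferentiableAt ℝ Φ x₀)
    (hX : Tendsto X atTop (𝓝 x₀)) (hO : ∀ i, (fun z => X z i - x₀ i) =O[atTop] g) :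
    (fun z => Φ (X z) - Φ x₀) =O[atTop] g :=
  (hΦ.isBigO_sub.comp_tendsto hX).trans (Asymptotics.isBigO_pi.2 hO)

/-! ### Rates at `+∞` -/

theorem fin_three_cases (i : Fin 3) : i = 0 ∨ i = 1 ∨ i = 2 := by
  fin_cases i <;> simp

/-- The forcing of the tension by activity and police. -/
theorem tension_eq (p : Params) (c : ℝ) (U : ℝ → Fin 3 → ℝ) (z : ℝ) :
    -c * (-c * negDeriv U z 1 + p.F (U z) 1) - ∑ j, jacobian p.F (U z) 1 j * negDeriv U z j
      + c * (-c * negDeriv U z 1 + p.F (U z) 1) + jacobian p.F (U z) 1 1 * negDeriv U z 1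
      = -(jacobian p.F (U z) 1 0 * negDeriv U z 0 + jacobian p.F (U z) 1 2 * negDeriv U z 2) := by
  rw [Fin.sum_univ_three]
  ring

namespace IsFront

variable {p : Params} {c P : ℝ} {Up Um : Fin 3 → ℝ} {U : ℝ → Fin 3 → ℝ}
  (h : IsFront p c P Up Um U)

include h

theorem growth_Up : p.growth Up = jacobian p.F Up 0 0 := by
  rw [p.fu_eq h.one_add_Up_zero h.one_add_Up_two, Params.growth, h.Up_zero]
  ring

theorem gv_Up_neg : jacobian p.F Up 1 1 < 0 :=
  h.adm.gv_neg h.one_add_Up_zero h.one_add_Up_two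

theorem tendsto_jacobian_top (i j : Fin 3) :
    Tendsto (fun z => jacobian p.F (U z) i j) atTop (𝓝 (jacobian p.F Up i j)) :=
  (p.differentiableAt_jacobian h.one_add_Up_zero h.one_add_Up_two i j).continuousAt.tendsto.comp
    h.wave.lim_top

theorem jacobian_offDiag_nonneg (z : ℝ) (i j : Fin 3) (hij : i ≠ j) :
    0 ≤ jacobian p.F (U z) i j :=
  h.adm.jacobian_offDiag_nonneg (h.u_pos z).le (h.u_lt_one z).le (h.v_pos z).le
    (h.wave.P_nonneg z) (h.P_lt z).le i j hij

theorem hasDerivAt_u (z : ℝ) :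
    HasDerivAt (fun t => U t 0) (U z 0 * -(negDeriv U z 0 / U z 0)) z :=
  (h.hasDerivAt 0 z).congr_deriv (by have := (h.u_pos z).ne'; field_simp)

/-- The logarithmic decay rate `-u'/u` solves a Riccati equation. -/
theorem hasDerivAt_logRate (z : ℝ) :
    HasDerivAt (fun t => negDeriv U t 0 / U t 0)
      ((negDeriv U z 0 / U z 0) ^ 2 - c * (negDeriv U z 0 / U z 0) + p.growth (U z)) z := by
  have hu := (h.u_pos z).ne'
  refine (((h.hasDerivs_negDeriv (i := 0) (by decide)).1 z).fun_div
    (h.hasDerivAt 0 z) hu).congr_deriv ?_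
  simp only [p.F_zero_eq]
  field_simp
  ring

theorem exists_logRate_limit :
    ∃ ρ, 0 ≤ ρ ∧ Tendsto (fun z => negDeriv U z 0 / U z 0) atTop (𝓝 ρ) ∧
      ρ ^ 2 - c * ρ + jacobian p.F Up 0 0 = 0 := by
  have hg := (Params.differentiableAt_growth (p := p)
    h.one_add_Up_two).continuousAt.tendsto.comp h.wave.lim_top
  rw [h.growth_Up] at hg
  exact riccati_tendsto h.hasDerivAt_logRate
    (fun z => div_pos (h.negDeriv_pos z 0) (h.u_pos z)) hg

theorem tendsto_coeff_P : Tendsto (fun z => (1 - U z 2) / c) atTop (𝓝 ((1 - P) / c)) := by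
  have := ((h.tendsto_top 2).const_sub 1).div_const c
  rwa [h.Up_two] at this

theorem negDeriv_zero_isBigO {ρ : ℝ}
    (hr : Tendsto (fun z => negDeriv U z 0 / U z 0) atTop (𝓝 ρ)) :
    (fun z => negDeriv U z 0) =O[atTop] fun z => U z 0 := by
  have := (hr.isBigO_one ℝ).mul (Asymptotics.isBigO_refl (fun z => U z 0) atTop)
  refine this.congr (fun z => ?_) fun z => one_mul _
  exact div_mul_cancel₀ _ (h.u_pos z).ne'

theorem negDeriv_two_isBigO :
    (fun z => negDeriv U z 2) =O[atTop] fun z => U z 0 := by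
  have := (h.tendsto_coeff_P.isBigO_one ℝ).mul (Asymptotics.isBigO_refl (fun z => U z 0) atTop)
  refine this.congr (fun z => ?_) fun z => one_mul _
  rw [h.negDeriv_two]
  ring

theorem isBigO_negDeriv_zero {ρ : ℝ} (hρ : 0 < ρ)
    (hr : Tendsto (fun z => negDeriv U z 0 / U z 0) atTop (𝓝 ρ)) :
    (fun z => U z 0) =O[atTop] fun z => negDeriv U z 0 := by
  have h1 := ((hr.inv₀ hρ.ne').isBigO_one ℝ).mul
    (Asymptotics.isBigO_refl (fun z => negDeriv U z 0) atTop)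
  refine h1.congr (fun z => ?_) fun z => one_mul _
  have := (h.negDeriv_pos z 0).ne'
  field_simp

theorem isBigO_negDeriv_two :
    (fun z => U z 0) =O[atTop] fun z => negDeriv U z 2 := by
  have hP : (1 - P) / c ≠ 0 := (div_pos (sub_pos.2 h.P_lt_one) h.c_pos).ne'
  have h1 := ((h.tendsto_coeff_P.inv₀ hP).isBigO_one ℝ).mul
    (Asymptotics.isBigO_refl (fun z => negDeriv U z 2) atTop)
  refine h1.congr (fun z => ?_) fun z => one_mul _
  rw [h.negDeriv_two]
  have h2 := (sub_pos.2 (h.P_lt z)).ne'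
  have h3 := h.c_pos.ne'
  field_simp

theorem forcing_isBigO {ρ l : ℝ}
    (hr : Tendsto (fun z => negDeriv U z 0 / U z 0) atTop (𝓝 ρ))
    (hu : (fun z => U z 0) =O[atTop] fun z => Real.exp (l * z)) :
    (fun z => -(jacobian p.F (U z) 1 0 * negDeriv U z 0
      + jacobian p.F (U z) 1 2 * negDeriv U z 2)) =O[atTop] fun z => Real.exp (l * z) := by
  have h1 := ((h.tendsto_jacobian_top 1 0).isBigO_one ℝ).mul ((h.negDeriv_zero_isBigO hr).trans hu)
  have h2 := ((h.tendsto_jacobian_top 1 2).isBigO_one ℝ).mul (h.negDeriv_two_isBigO.trans hu)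
  simpa using (h1.add h2).neg_left

theorem negDeriv_isBigO_top {ρ l : ℝ}
    (hr : Tendsto (fun z => negDeriv U z 0 / U z 0) atTop (𝓝 ρ))
    (hl : l ^ 2 + c * l + jacobian p.F Up 1 1 < 0)
    (hu : (fun z => U z 0) =O[atTop] fun z => Real.exp (l * z)) (i : Fin 3) :
    (fun z => negDeriv U z i) =O[atTop] fun z => Real.exp (l * z) := by
  rcases fin_three_cases i with rfl | rfl | rfl
  · exact (h.negDeriv_zero_isBigO hr).trans hu
  · refine isBigO_exp_scalar (c := c) (h.tendsto_jacobian_top 1 1) h.gv_Up_neg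
      (h.hasDerivs_negDeriv (i := 1) (by decide)) h.negDeriv_one_pos
      (h.tendsto_negDeriv_top (by decide)) hl ?_
    simp only [tension_eq]
    exact h.forcing_isBigO hr hu
  · exact h.negDeriv_two_isBigO.trans hu

theorem isBigO_negDeriv_top {ρ l : ℝ} (hρ : 0 < ρ)
    (hr : Tendsto (fun z => negDeriv U z 0 / U z 0) atTop (𝓝 ρ)) (hl : l < 0)
    (hu : (fun z => Real.exp (l * z)) =O[atTop] fun z => U z 0) (i : Fin 3) :
    (fun z => Real.exp (l * z)) =O[atTop] fun z => negDeriv U z i := by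
  have h0 := hu.trans (h.isBigO_negDeriv_zero hρ hr)
  have h2 := hu.trans h.isBigO_negDeriv_two
  have hforce : ∀ j : Fin 3, j ≠ 1 → 0 < jacobian p.F Up 1 j →
      ((fun z => Real.exp (l * z)) =O[atTop] fun z => negDeriv U z j) →
      (fun z => Real.exp (l * z)) =O[atTop]
        fun z => jacobian p.F (U z) 1 j * negDeriv U z j := by
    intro j _ hj hO
    have h1 := (((h.tendsto_jacobian_top 1 j).inv₀ hj.ne').isBigO_one ℝ).mul
      (Asymptotics.isBigO_refl (fun z => jacobian p.F (U z) 1 j * negDeriv U z j) atTop)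
    refine hO.trans (h1.congr' ?_ (by simp))
    filter_upwards [(h.tendsto_jacobian_top 1 j).eventually_const_lt hj] with z hz
    rw [inv_mul_cancel_left₀ hz.ne']
  rcases fin_three_cases i with rfl | rfl | rfl
  · exact h0
  · have hn : ∀ j : Fin 3, 1 ≠ j → ∀ z, 0 ≤ jacobian p.F (U z) 1 j * negDeriv U z j :=
      fun j hj z => mul_nonneg (h.jacobian_offDiag_nonneg z 1 j hj) (h.negDeriv_pos z j).le
    rcases h.k0_pos_or_k2_pos with hk | hk
    · refine exp_isBigO_of_forcing (c := c) (h.tendsto_jacobian_top 1 1) h.gv_Up_neg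
        (h.hasDerivs_negDeriv (i := 1) (by decide)) h.negDeriv_one_pos hl
        (hforce 0 (by decide)
          (h.adm.gu_pos hk h.one_add_Up_zero h.Up_one_pos h.one_add_Up_two) h0)
        (Eventually.of_forall (hn 0 (by decide))) (Eventually.of_forall fun z => ?_)
      rw [tension_eq]
      linarith [hn 2 (by decide) z]
    · refine exp_isBigO_of_forcing (c := c) (h.tendsto_jacobian_top 1 1) h.gv_Up_neg
        (h.hasDerivs_negDeriv (i := 1) (by decide)) h.negDeriv_one_pos hl
        (hforce 2 (by decide)
          (h.adm.gP_pos hk h.one_add_Up_zero h.Up_one_pos h.one_add_Up_two) h2)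
        (Eventually.of_forall (hn 2 (by decide))) (Eventually.of_forall fun z => ?_)
      rw [tension_eq]
      linarith [hn 0 (by decide) z]
  · exact h2

/-- Some exponential rate for all components: the first step towards sharp rates. -/
theorem exists_rate_top {ρ : ℝ} (hρ : 0 < ρ)
    (hr : Tendsto (fun z => negDeriv U z 0 / U z 0) atTop (𝓝 ρ)) :
    ∃ η > 0, ∀ i, (fun z => U z i - Up i) =O[atTop] fun z => Real.exp (-η * z) := by
  have hc := h.c_pos
  have hm : 0 < min (ρ / 2) (c / 2) := lt_min (by linarith) (by linarith)
  have h1 := min_le_left (ρ / 2) (c / 2)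
  have h2 := min_le_right (ρ / 2) (c / 2)
  refine ⟨min (ρ / 2) (c / 2), hm, fun i => ?_⟩
  have hu := isBigO_exp_of_logDeriv_tendsto (l' := -min (ρ / 2) (c / 2)) h.hasDerivAt_u h.u_pos
    hr.neg (by linarith)
  have hd := h.negDeriv_isBigO_top hr (l := -min (ρ / 2) (c / 2))
    (by have := h.gv_Up_neg; nlinarith) hu i
  exact isBigO_exp_integrate (by linarith) (h.decaysWith_top.hasDerivAt i)
    (fun z => h.negDeriv_pos z i) (h.decaysWith_top.tendsto i) hd

theorem u_sharp_top {ρ : ℝ} (hρ : 0 < ρ)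
    (hr : Tendsto (fun z => negDeriv U z 0 / U z 0) atTop (𝓝 ρ))
    (hroot : ρ ^ 2 - c * ρ + jacobian p.F Up 0 0 = 0) (hsimple : 2 * ρ ≠ c) :
    ((fun z => U z 0) =O[atTop] fun z => Real.exp (-ρ * z)) ∧
      (fun z => Real.exp (-ρ * z)) =O[atTop] fun z => U z 0 := by
  obtain ⟨η, hη, hO⟩ := h.exists_rate_top hρ hr
  have hg := isBigO_sub_of_differentiableAt
    (Params.differentiableAt_growth (p := p) h.one_add_Up_two) h.wave.lim_top hO
  rw [h.growth_Up] at hg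
  obtain ⟨η', hη', hO'⟩ := isBigO_exp_of_linear
    (d := fun z => negDeriv U z 0 / U z 0 - ρ)
    (κ := fun z => negDeriv U z 0 / U z 0 + (ρ - c)) (κ₀ := ρ + (ρ - c))
    (fun z => ((h.hasDerivAt_logRate z).sub_const ρ).congr_deriv (by linear_combination hroot))
    (hr.add_const _) (by intro h0; apply hsimple; linarith) (by simpa using hr.sub_const ρ) hη hg
  refine isBigO_exp_of_logDeriv_sharp h.hasDerivAt_u h.u_pos hη' (hO'.neg_left.congr_left ?_)
  intro z
  ring

theorem rateAtTop_of_logRate {ρ : ℝ} (hρ : 0 < ρ)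
    (hr : Tendsto (fun z => negDeriv U z 0 / U z 0) atTop (𝓝 ρ))
    (hroot : ρ ^ 2 - c * ρ + jacobian p.F Up 0 0 = 0) (hsimple : 2 * ρ ≠ c)
    (hgf : jacobian p.F Up 1 1 < jacobian p.F Up 0 0) :
    RateAtTop Up U (-ρ) Set.univ := by
  obtain ⟨h1, h2⟩ := h.u_sharp_top hρ hr hroot hsimple
  exact h.decaysWith_top.expBounds (by linarith)
    (h.negDeriv_isBigO_top hr (by nlinarith) h1)
    fun i _ => h.isBigO_negDeriv_top hρ hr (by linarith) h2 i

theorem rateAtTopLoss_of_logRate {ρ : ℝ} (hρ : 0 < ρ)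
    (hr : Tendsto (fun z => negDeriv U z 0 / U z 0) atTop (𝓝 ρ))
    (hm : ∀ m, -ρ < m → m < 0 → m ^ 2 + c * m + jacobian p.F Up 1 1 < 0) :
    RateAtTopLoss Up U (-ρ) Set.univ :=
  h.decaysWith_top.expBoundsLoss (by linarith)
    (fun m h1 h2 => h.negDeriv_isBigO_top hr (hm m h1 h2)
      (isBigO_exp_of_logDeriv_tendsto h.hasDerivAt_u h.u_pos hr.neg h1))
    fun m h1 i _ => h.isBigO_negDeriv_top hρ hr (by linarith)
      (exp_isBigO_of_logDeriv_tendsto h.hasDerivAt_u h.u_pos hr.neg h1) i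

/-- If the activity decays faster than the free tension, the latter has its own sharp rate. -/
theorem rateAtTop_tension {ρ l : ℝ} (hρ : 0 < ρ)
    (hr : Tendsto (fun z => negDeriv U z 0 / U z 0) atTop (𝓝 ρ))
    (hl0 : l < 0) (hl : l ^ 2 + c * l + jacobian p.F Up 1 1 = 0) (hsimple : 2 * l + c < 0)
    (hρl : -ρ < l) : RateAtTop Up U l {1} := by
  obtain ⟨η, hη, hO⟩ := h.exists_rate_top hρ hr
  set η' := min η ((l + ρ) / 2) with hη'
  have hη'0 : 0 < η' := lt_min hη (by linarith)
  have hle : η' ≤ (l + ρ) / 2 := min_le_right _ _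
  have hJ : (fun z => jacobian p.F (U z) 1 1 - jacobian p.F Up 1 1) =O[atTop]
      fun z => Real.exp (-η' * z) :=
    (isBigO_sub_of_differentiableAt
      (p.differentiableAt_jacobian h.one_add_Up_zero h.one_add_Up_two 1 1) h.wave.lim_top
      hO).trans (isBigO_exp_exp (neg_le_neg (min_le_left _ _)))
  have hu := isBigO_exp_of_logDeriv_tendsto (l' := l - η') h.hasDerivAt_u h.u_pos hr.neg
    (by linarith)
  have hu' := hu.trans (isBigO_exp_exp (show l - η' ≤ l by linarith))
  refine h.decaysWith_top.expBounds hl0 (fun i => ?_) fun i hi => ?_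
  · rcases fin_three_cases i with rfl | rfl | rfl
    · exact (h.negDeriv_zero_isBigO hr).trans hu'
    · refine isBigO_exp_sharp_scalar (c := c) (h.tendsto_jacobian_top 1 1) h.gv_Up_neg
        (h.hasDerivs_negDeriv (i := 1) (by decide)) h.negDeriv_one_pos
        (h.tendsto_negDeriv_top (by decide)) hη'0 hJ hl hsimple ?_
      simp only [tension_eq]
      exact h.forcing_isBigO hr hu
    · exact h.negDeriv_two_isBigO.trans hu'
  · rw [Set.mem_singleton_iff] at hi
    subst hi
    refine exp_isBigO_sharp_scalar (c := c) (h.tendsto_jacobian_top 1 1) h.gv_Up_neg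
      (h.hasDerivs_negDeriv (i := 1) (by decide)) h.negDeriv_one_pos hl0 hη'0 hJ hl hsimple
      (Eventually.of_forall fun z => ?_)
    rw [tension_eq]
    have h0 := mul_nonneg (h.jacobian_offDiag_nonneg z 1 0 (by decide)) (h.negDeriv_pos z 0).le
    have h2 := mul_nonneg (h.jacobian_offDiag_nonneg z 1 2 (by decide)) (h.negDeriv_pos z 2).le
    linarith

end IsFront

/-! ### Rates at `-∞` -/

/-- The largest eigenvalue of the linearization of `(f, g)` in `(u, v)`. -/
noncomputable def Params.perron (p : Params) (x : Fin 3 → ℝ) : ℝ := -p.mu2 x / 2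

/-- For `s + m < 0`, where `m` is the Perron root of a cooperative `2 × 2` matrix, adding `s` to the
diagonal leaves a matrix that maps some positive vector to a negative one. -/
theorem exists_pos_supersolution {a b d e m s : ℝ} (hb : 0 < b) (ha : a ≤ m) (he : e ≤ m)
    (hroot : (m - a) * (m - e) = b * d) (hs : s + m < 0) :
    ∃ φ₀ > 0, ∃ φ₁ > 0, (s + a) * φ₀ + b * φ₁ < 0 ∧ d * φ₀ + (s + e) * φ₁ < 0 := by
  -- the Perron vector `(b, m - a)` with `m` moved halfway towards `-s`
  set r := (-s - m) / 2 with hr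
  have hr0 : 0 < r := by linarith
  refine ⟨b, hb, m + r - a, by linarith, by nlinarith, ?_⟩
  have h1 : d * b + (s + e) * (m + r - a)
      = -(r * (m - a) + r * (m - e) + r * r) - r * (m + r - a) := by
    have hs' : s = -m - 2 * r := by linarith
    rw [hs']
    linear_combination -hroot
  rw [h1]
  have h2 := mul_nonneg hr0.le (sub_nonneg.2 ha)
  have h3 := mul_nonneg hr0.le (sub_nonneg.2 he)
  nlinarith [mul_pos hr0 hr0]

theorem sysOp_reflect (p : Params) (c : ℝ) (U : ℝ → Fin 3 → ℝ) (i : Fin 2) (t : ℝ) :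
    sysOp (-c) (fun t (i j : Fin 2) => jacobian p.F (U (-t)) i.castSucc j.castSucc)
      (fun i t => negDeriv U (-t) i.castSucc)
      (fun i t => -(-c * negDeriv U (-t) i.castSucc + p.F (U (-t)) i.castSucc))
      (fun i t => -c * (-c * negDeriv U (-t) i.castSucc + p.F (U (-t)) i.castSucc)
        - ∑ j, jacobian p.F (U (-t)) i.castSucc j * negDeriv U (-t) j) i t
      = -(jacobian p.F (U (-t)) i.castSucc 2 * negDeriv U (-t) 2) := by
  rw [sysOp, Fin.sum_univ_castSucc (n := 2)]
  simp only [Fin.reduceLast]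
  ring

theorem castSucc_ne_two (i : Fin 2) : i.castSucc ≠ (2 : Fin 3) := (Fin.castSucc_lt_last i).ne

theorem forall_of_castSucc {R : Fin 3 → Prop} (h01 : ∀ i : Fin 2, R i.castSucc) (h2 : R 2)
    (i : Fin 3) : R i := by
  rcases fin_three_cases i with rfl | rfl | rfl
  · exact h01 0
  · exact h01 1
  · exact h2

namespace IsFront

variable {p : Params} {c P : ℝ} {Up Um : Fin 3 → ℝ} {U : ℝ → Fin 3 → ℝ}
  (h : IsFront p c P Up Um U)

include h

theorem fv_Um_pos : 0 < jacobian p.F Um 0 1 :=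
  h.adm.fv_pos h.Um_zero_pos h.Um_zero_lt_one h.one_add_Um_two

theorem gu_Um_nonneg : 0 ≤ jacobian p.F Um 1 0 :=
  h.adm.jacobian_offDiag_nonneg h.Um_zero_pos.le h.Um_zero_lt_one.le h.Um_one_pos.le
    (by rw [h.Um_two]; norm_num) h.Um_two.le 1 0 (by decide)

theorem gu_Um_pos (hk : 0 < p.k0) : 0 < jacobian p.F Um 1 0 :=
  h.adm.gu_pos hk h.one_add_Um_zero h.Um_one_pos h.one_add_Um_two

theorem gu_Um_eq_zero (hk : ¬ 0 < p.k0) : jacobian p.F Um 1 0 = 0 := by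
  rw [p.gu_eq h.one_add_Um_zero h.one_add_Um_two,
    le_antisymm (not_lt.1 hk) h.adm.k0_nonneg, zero_mul]

theorem fu_Um_neg : jacobian p.F Um 0 0 < 0 := by
  have h1 := h.Um_growth
  rw [p.fu_eq h.one_add_Um_zero h.one_add_Um_two]
  unfold Params.growth at h1
  have hG := h.adm.Gam_pos
  have h2 := h.one_add_Um_two
  have h3 : 0 < (1 + Um 2) ^ p.k1 * (1 / (1 + Real.exp (-p.beta * (Um 1 - p.alpha)))) * p.Gam := by
    positivity
  nlinarith [mul_pos h3 h.Um_zero_pos]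

theorem gv_Um_neg : jacobian p.F Um 1 1 < 0 :=
  h.adm.gv_neg h.one_add_Um_zero h.one_add_Um_two

theorem stable' : jacobian p.F Um 0 1 * jacobian p.F Um 1 0
    < jacobian p.F Um 0 0 * jacobian p.F Um 1 1 := sub_neg.1 h.stable

theorem disc_nonneg : 0 ≤ (jacobian p.F Um 0 0 + jacobian p.F Um 1 1) ^ 2
    + 4 * jacobian p.F Um 0 1 * jacobian p.F Um 1 0
    - 4 * jacobian p.F Um 0 0 * jacobian p.F Um 1 1 := by
  have h1 := mul_nonneg h.fv_Um_pos.le h.gu_Um_nonneg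
  nlinarith [sq_nonneg (jacobian p.F Um 0 0 - jacobian p.F Um 1 1)]

theorem perron_root : (p.perron Um - jacobian p.F Um 0 0) * (p.perron Um - jacobian p.F Um 1 1)
    = jacobian p.F Um 0 1 * jacobian p.F Um 1 0 := by
  have h1 := Real.sq_sqrt h.disc_nonneg
  simp only [Params.perron, Params.mu2, Params.fu, Params.fv, Params.gu, Params.gv]
  linear_combination h1 / 4

theorem le_perron : jacobian p.F Um 0 0 ≤ p.perron Um ∧ jacobian p.F Um 1 1 ≤ p.perron Um := by
  have h1 := mul_nonneg h.fv_Um_pos.le h.gu_Um_nonneg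
  rw [← h.perron_root] at h1
  have h2 : jacobian p.F Um 0 0 + jacobian p.F Um 1 1 ≤ 2 * p.perron Um := by
    have := Real.sqrt_nonneg ((jacobian p.F Um 0 0 + jacobian p.F Um 1 1) ^ 2
      + 4 * jacobian p.F Um 0 1 * jacobian p.F Um 1 0
      - 4 * jacobian p.F Um 0 0 * jacobian p.F Um 1 1)
    simp only [Params.perron, Params.mu2, Params.fu, Params.fv, Params.gu, Params.gv]
    linarith
  constructor <;> by_contra! hlt <;> nlinarith

theorem perron_neg : p.perron Um < 0 := by
  by_contra! h0
  have h1 := h.perron_root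
  have h2 := h.stable'
  have h3 := h.fu_Um_neg
  have h4 := h.gv_Um_neg
  nlinarith [mul_nonneg h0 (neg_nonneg.2 h3.le), mul_nonneg h0 (neg_nonneg.2 h4.le)]

theorem fu_lt_perron_of_gu_pos (hgu : 0 < jacobian p.F Um 1 0) :
    jacobian p.F Um 0 0 < p.perron Um := by
  refine lt_of_le_of_ne h.le_perron.1 fun heq => ?_
  have h1 := h.perron_root
  rw [← heq, sub_self, zero_mul] at h1
  exact (mul_pos h.fv_Um_pos hgu).ne h1

theorem perron_eq_fu (hgu : jacobian p.F Um 1 0 = 0)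
    (hle : jacobian p.F Um 1 1 ≤ jacobian p.F Um 0 0) : p.perron Um = jacobian p.F Um 0 0 := by
  have h1 := h.perron_root
  rw [hgu, mul_zero] at h1
  rcases mul_eq_zero.1 h1 with h2 | h2
  · linarith
  · linarith [h.le_perron.1]

theorem mu_eq_iff : p.mu1 Um = p.mu2 Um ↔
    jacobian p.F Um 0 0 = jacobian p.F Um 1 1 ∧ jacobian p.F Um 1 0 = 0 := by
  have hd := h.disc_nonneg
  have hb := h.fv_Um_pos
  have hg := mul_nonneg hb.le h.gu_Um_nonneg
  simp only [Params.mu1, Params.mu2, Params.fu, Params.fv, Params.gu, Params.gv]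
  constructor
  · intro heq
    have h1 := (Real.sqrt_eq_zero hd).1 (by linarith)
    have h2 := sq_nonneg (jacobian p.F Um 0 0 - jacobian p.F Um 1 1)
    have h3 : (jacobian p.F Um 0 0 - jacobian p.F Um 1 1) ^ 2 = 0 := by nlinarith
    have h4 : jacobian p.F Um 0 1 * jacobian p.F Um 1 0 = 0 := by nlinarith
    exact ⟨sub_eq_zero.1 (pow_eq_zero_iff (two_ne_zero)|>.1 h3),
      (mul_eq_zero.1 h4).resolve_left hb.ne'⟩
  · rintro ⟨h1, h2⟩
    have h3 : (jacobian p.F Um 0 0 + jacobian p.F Um 1 1) ^ 2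
      + 4 * jacobian p.F Um 0 1 * jacobian p.F Um 1 0
      - 4 * jacobian p.F Um 0 0 * jacobian p.F Um 1 1 = 0 := by rw [h1, h2]; ring
    rw [h3, Real.sqrt_zero]
    ring

theorem bottom_rate_pos : 0 < Um 0 / c := div_pos h.Um_zero_pos h.c_pos

theorem lamTwo_spec : 0 < (-c + √(c ^ 2 + 2 * p.mu2 Um)) / 2 ∧
    ((-c + √(c ^ 2 + 2 * p.mu2 Um)) / 2) ^ 2 + c * ((-c + √(c ^ 2 + 2 * p.mu2 Um)) / 2)
      + p.perron Um = 0 := by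
  have hm := h.perron_neg
  have hmu : p.mu2 Um = -2 * p.perron Um := by simp only [Params.perron]; ring
  have hc := h.c_pos
  rw [hmu]
  have h1 : 0 ≤ c ^ 2 + 2 * (-2 * p.perron Um) := by nlinarith [sq_nonneg c]
  have h2 := Real.sq_sqrt h1
  refine ⟨?_, by linear_combination h2 / 4⟩
  have h3 : c < √(c ^ 2 + 2 * (-2 * p.perron Um)) := Real.lt_sqrt_of_sq_lt (by linarith)
  linarith

theorem tendsto_jacobian_reflect (i j : Fin 3) :
    Tendsto (fun t => jacobian p.F (U (-t)) i j) atTop (𝓝 (jacobian p.F Um i j)) :=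
  (p.differentiableAt_jacobian h.one_add_Um_zero h.one_add_Um_two i j).continuousAt.tendsto.comp
    h.tendsto_reflect

theorem hasDerivs_negDeriv_reflect {i : Fin 3} (hi : i ≠ 2) :
    HasDerivs (fun t => negDeriv U (-t) i)
      (fun t => -(-c * negDeriv U (-t) i + p.F (U (-t)) i))
      (fun t => -c * (-c * negDeriv U (-t) i + p.F (U (-t)) i)
        - ∑ j, jacobian p.F (U (-t)) i j * negDeriv U (-t) j) :=
  hasDerivs_reflect (h.hasDerivs_negDeriv hi)

theorem isStableCoop_reflect :
    IsStableCoop (fun t (i j : Fin 2) => jacobian p.F (U (-t)) i.castSucc j.castSucc)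
      (fun i j => jacobian p.F Um i.castSucc j.castSucc) where
  tendsto i j := h.tendsto_jacobian_reflect _ _
  offDiag := Eventually.of_forall fun t i j hij =>
    h.jacobian_offDiag_nonneg (-t) _ _ fun heq => hij (Fin.castSucc_injective _ heq)
  exists_pos := by
    obtain ⟨φ₀, h0, φ₁, h1, h2, h3⟩ := exists_pos_supersolution (s := 0) h.fv_Um_pos
      h.le_perron.1 h.le_perron.2 h.perron_root (by simpa using h.perron_neg)
    refine ⟨![φ₀, φ₁], fun i => ?_, fun i => ?_⟩
    · fin_cases i <;> simpa
    · fin_cases i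
      · simpa [Fin.sum_univ_two] using h2
      · simpa [Fin.sum_univ_two] using h3

/-- After reflection, `1 - P` has the logarithmic derivative `-u / c`. -/
theorem hasDerivAt_Q (t : ℝ) :
    HasDerivAt (fun t => 1 - U (-t) 2) ((1 - U (-t) 2) * -(U (-t) 0 / c)) t :=
  ((h.hasDerivAt_one_sub_P (-t)).scomp t (hasDerivAt_neg t)).congr_deriv (by simp)

theorem Q_pos (t : ℝ) : 0 < 1 - U (-t) 2 := sub_pos.2 (h.P_lt (-t))

theorem tendsto_coeff_Q : Tendsto (fun t => U (-t) 0 / c) atTop (𝓝 (Um 0 / c)) :=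
  ((h.tendsto_bot 0).comp tendsto_neg_atTop_atBot).div_const c

theorem Q_isBigO {l : ℝ} (hl : -(Um 0 / c) < l) :
    (fun t => 1 - U (-t) 2) =O[atTop] fun t => Real.exp (l * t) :=
  isBigO_exp_of_logDeriv_tendsto h.hasDerivAt_Q h.Q_pos h.tendsto_coeff_Q.neg hl

theorem isBigO_Q {l : ℝ} (hl : l < -(Um 0 / c)) :
    (fun t => Real.exp (l * t)) =O[atTop] fun t => 1 - U (-t) 2 :=
  exp_isBigO_of_logDeriv_tendsto h.hasDerivAt_Q h.Q_pos h.tendsto_coeff_Q.neg hl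

theorem negDeriv_two_isBigO_Q :
    (fun t => negDeriv U (-t) 2) =O[atTop] fun t => 1 - U (-t) 2 := by
  have := (h.tendsto_coeff_Q.isBigO_one ℝ).mul
    (Asymptotics.isBigO_refl (fun t => 1 - U (-t) 2) atTop)
  refine this.congr (fun z => ?_) fun z => one_mul _
  rw [h.negDeriv_two]
  ring

theorem Q_isBigO_negDeriv_two :
    (fun t => 1 - U (-t) 2) =O[atTop] fun t => negDeriv U (-t) 2 := by
  have h1 := ((h.tendsto_coeff_Q.inv₀ h.bottom_rate_pos.ne').isBigO_one ℝ).mul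
    (Asymptotics.isBigO_refl (fun t => negDeriv U (-t) 2) atTop)
  refine h1.congr (fun z => ?_) fun z => one_mul _
  rw [h.negDeriv_two]
  have h2 := (h.u_pos (-z)).ne'
  have h3 := h.c_pos.ne'
  field_simp

theorem forcing_isBigO_reflect {l : ℝ}
    (hQ : (fun t => 1 - U (-t) 2) =O[atTop] fun t => Real.exp (l * t)) (i : Fin 3) :
    (fun t => -(jacobian p.F (U (-t)) i 2 * negDeriv U (-t) 2)) =O[atTop]
      fun t => Real.exp (l * t) := by
  simpa using (((h.tendsto_jacobian_reflect i 2).isBigO_one ℝ).mul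
    (h.negDeriv_two_isBigO_Q.trans hQ)).neg_left

theorem negDeriv_isBigO_reflect {l : ℝ} (hl : l ^ 2 - c * l + p.perron Um < 0)
    (hQ : (fun t => 1 - U (-t) 2) =O[atTop] fun t => Real.exp (l * t)) (i : Fin 3) :
    (fun t => negDeriv U (-t) i) =O[atTop] fun t => Real.exp (l * t) := by
  refine forall_of_castSucc
    (R := fun i => (fun t => negDeriv U (-t) i) =O[atTop] fun t => Real.exp (l * t)) (fun i => ?_) (h.negDeriv_two_isBigO_Q.trans hQ) i
  obtain ⟨φ₀, h0, φ₁, h1, h2, h3⟩ := exists_pos_supersolution h.fv_Um_pos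
    h.le_perron.1 h.le_perron.2 h.perron_root hl
  refine h.isStableCoop_reflect.isBigO_exp (c := -c) (φ := ![φ₀, φ₁])
    (w := fun i t => negDeriv U (-t) i.castSucc)
    (fun i => h.hasDerivs_negDeriv_reflect (castSucc_ne_two i)) (fun i t => h.negDeriv_pos _ _)
    (fun i => h.tendsto_negDeriv_reflect (castSucc_ne_two i)) (fun i => ?_) (fun i => ?_)
    (fun i => ?_) i
  · fin_cases i <;> simpa
  · fin_cases i
    · simp [Fin.sum_univ_two]
      linarith
    · simp [Fin.sum_univ_two]
      linarith
  · simp only [sysOp_reflect]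
    exact h.forcing_isBigO_reflect hQ _

theorem exists_rate_reflect : ∃ η > 0,
    ∀ i, (fun t => U (-t) i - Um i) =O[atTop] fun t => Real.exp (-η * t) := by
  obtain ⟨hL, hroot⟩ := h.lamTwo_spec
  set L := (-c + √(c ^ 2 + 2 * p.mu2 Um)) / 2 with hLdef
  have hR := h.bottom_rate_pos
  have hc := h.c_pos
  set η := min (Um 0 / c) L / 2 with hη
  have hm : 0 < min (Um 0 / c) L := lt_min hR hL
  have h1 := min_le_left (Um 0 / c) L
  have h2 := min_le_right (Um 0 / c) L
  refine ⟨η, by linarith, fun i => ?_⟩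
  have hd := h.negDeriv_isBigO_reflect (l := -η) (by nlinarith) (h.Q_isBigO (by linarith)) i
  have := isBigO_exp_integrate (by linarith) (h.decaysWith_reflect.hasDerivAt i)
    (fun t => h.negDeriv_pos _ i) (h.decaysWith_reflect.tendsto i) hd
  refine this.neg_left.congr_left fun t => ?_
  simp

theorem Q_sharp : ((fun t => 1 - U (-t) 2) =O[atTop] fun t => Real.exp (-(Um 0 / c) * t)) ∧
    (fun t => Real.exp (-(Um 0 / c) * t)) =O[atTop] fun t => 1 - U (-t) 2 := by
  obtain ⟨η, hη, hO⟩ := h.exists_rate_reflect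
  refine isBigO_exp_of_logDeriv_sharp h.hasDerivAt_Q h.Q_pos hη
    (((hO 0).const_mul_left (-1 / c)).congr_left fun t => ?_)
  ring

/-- The equation for a single component, with the coupling as forcing. -/
theorem component_le {i j : Fin 3} (hij : i ≠ j) (t : ℝ) :
    (-c * (-c * negDeriv U (-t) i + p.F (U (-t)) i)
        - ∑ j, jacobian p.F (U (-t)) i j * negDeriv U (-t) j)
      + -c * (-(-c * negDeriv U (-t) i + p.F (U (-t)) i))
      + jacobian p.F (U (-t)) i i * negDeriv U (-t) i
      ≤ -(jacobian p.F (U (-t)) i j * negDeriv U (-t) j) := by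
  have h1 : ∑ k, jacobian p.F (U (-t)) i k * negDeriv U (-t) k
      = jacobian p.F (U (-t)) i i * negDeriv U (-t) i
        + ∑ k ∈ Finset.univ.erase i, jacobian p.F (U (-t)) i k * negDeriv U (-t) k :=
    (Finset.add_sum_erase _ _ (Finset.mem_univ i)).symm
  have h2 : jacobian p.F (U (-t)) i j * negDeriv U (-t) j
      ≤ ∑ k ∈ Finset.univ.erase i, jacobian p.F (U (-t)) i k * negDeriv U (-t) k :=
    Finset.single_le_sum (f := fun k => jacobian p.F (U (-t)) i k * negDeriv U (-t) k)
      (fun k hk => mul_nonneg (h.jacobian_offDiag_nonneg _ _ _ (Finset.ne_of_mem_erase hk).symm)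
        (h.negDeriv_pos _ _).le) (Finset.mem_erase.2 ⟨hij.symm, Finset.mem_univ j⟩)
  rw [h1]
  linarith

theorem diag_neg {i : Fin 3} (hi : i ≠ 2) : jacobian p.F Um i i < 0 := by
  rcases fin_three_cases i with rfl | rfl | rfl
  · exact h.fu_Um_neg
  · exact h.gv_Um_neg
  · exact absurd rfl hi

theorem isBigO_of_coupling {i j : Fin 3} (hi : i ≠ 2) (hij : i ≠ j)
    (hJ : 0 < jacobian p.F Um i j) {l : ℝ} (hl : l < 0)
    (hj : (fun t => Real.exp (l * t)) =O[atTop] fun t => negDeriv U (-t) j) :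
    (fun t => Real.exp (l * t)) =O[atTop] fun t => negDeriv U (-t) i := by
  have h1 := (((h.tendsto_jacobian_reflect i j).inv₀ hJ.ne').isBigO_one ℝ).mul
    (Asymptotics.isBigO_refl (fun t => jacobian p.F (U (-t)) i j * negDeriv U (-t) j) atTop)
  refine exp_isBigO_of_forcing (c := -c) (h.tendsto_jacobian_reflect i i) (h.diag_neg hi)
    (h.hasDerivs_negDeriv_reflect hi) (fun t => h.negDeriv_pos _ _) hl
    (hj.trans (h1.congr' ?_ (by simp)))
    (Eventually.of_forall fun t =>
      mul_nonneg (h.jacobian_offDiag_nonneg _ _ _ hij) (h.negDeriv_pos _ _).le)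
    (Eventually.of_forall fun t => h.component_le hij t)
  filter_upwards [(h.tendsto_jacobian_reflect i j).eventually_const_lt hJ] with t ht
  rw [inv_mul_cancel_left₀ ht.ne']

theorem isBigO_of_diag {i : Fin 3} (hi : i ≠ 2) {l : ℝ} (hl : l < 0)
    (hpos : 0 < l ^ 2 - c * l + jacobian p.F Um i i) :
    (fun t => Real.exp (l * t)) =O[atTop] fun t => negDeriv U (-t) i := by
  refine exp_isBigO_scalar (c := -c) (h.tendsto_jacobian_reflect i i) (h.diag_neg hi)
    (h.hasDerivs_negDeriv_reflect hi) (fun t => h.negDeriv_pos _ _) hl (by linarith)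
    (Eventually.of_forall fun t => (h.component_le hi t).trans ?_)
  exact neg_nonpos.2 (mul_nonneg (h.jacobian_offDiag_nonneg _ _ _ hi) (h.negDeriv_pos _ _).le)

/-- If the police density feeds back at all, its rate is a lower bound for all components. -/
theorem isBigO_of_police {l : ℝ} (hl : l < 0) (hk : 0 < p.k1 ∨ 0 < p.k2)
    (hQ : (fun t => Real.exp (l * t)) =O[atTop] fun t => 1 - U (-t) 2) (i : Fin 3) :
    (fun t => Real.exp (l * t)) =O[atTop] fun t => negDeriv U (-t) i := by
  have h2 := hQ.trans h.Q_isBigO_negDeriv_two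
  have key : ((fun t => Real.exp (l * t)) =O[atTop] fun t => negDeriv U (-t) 0) ∧
      (fun t => Real.exp (l * t)) =O[atTop] fun t => negDeriv U (-t) 1 := by
    by_cases hk2 : 0 < p.k2
    · have h1 := h.isBigO_of_coupling (i := 1) (by decide) (by decide)
        (h.adm.gP_pos hk2 h.one_add_Um_zero h.Um_one_pos h.one_add_Um_two) hl h2
      exact ⟨h.isBigO_of_coupling (i := 0) (by decide) (by decide) h.fv_Um_pos hl h1, h1⟩
    · have h0 := h.isBigO_of_coupling (i := 0) (by decide) (by decide)
        (h.adm.fP_pos (hk.resolve_right hk2) h.Um_zero_pos h.Um_zero_lt_one h.one_add_Um_two) hl h2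
      exact ⟨h0, h.isBigO_of_coupling (i := 1) (by decide) (by decide)
        (h.gu_Um_pos (h.k0_pos_or_k2_pos.resolve_right hk2)) hl h0⟩
  rcases fin_three_cases i with rfl | rfl | rfl
  · exact key.1
  · exact key.2
  · exact h2

/-- Below the Perron rate, with a positive Perron vector `(f_v, m - f_u)`. -/
theorem isBigO_of_perron {l : ℝ} (hl : l < 0) (hm : jacobian p.F Um 0 0 < p.perron Um)
    (hpos : 0 < l ^ 2 - c * l + p.perron Um) (i : Fin 2) :
    (fun t => Real.exp (l * t)) =O[atTop] fun t => negDeriv U (-t) i.castSucc := by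
  have hb := h.fv_Um_pos
  have hr := h.perron_root
  have hm' := sub_pos.2 hm
  refine h.isStableCoop_reflect.exp_isBigO (c := -c)
    (φ := ![jacobian p.F Um 0 1, p.perron Um - jacobian p.F Um 0 0])
    (w := fun i t => negDeriv U (-t) i.castSucc)
    (fun i => h.hasDerivs_negDeriv_reflect (castSucc_ne_two i)) (fun i t => h.negDeriv_pos _ _)
    hl (fun i => ?_) (fun i => ?_) (Eventually.of_forall fun t i => ?_) i
  · fin_cases i <;> simpa
  · fin_cases i
    · simp [Fin.sum_univ_two]
      nlinarith [mul_pos hpos hb]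
    · simp [Fin.sum_univ_two]
      nlinarith [mul_pos hpos hm']
  · rw [sysOp_reflect]
    exact neg_nonpos.2 (mul_nonneg (h.jacobian_offDiag_nonneg _ _ _ (castSucc_ne_two i))
      (h.negDeriv_pos _ _).le)

theorem sharp_of_perron {L : ℝ} (hL : 0 < L) (hroot : L ^ 2 + c * L + p.perron Um = 0)
    (hLR : L < Um 0 / c) (hm : jacobian p.F Um 0 0 < p.perron Um) (i : Fin 2) :
    ((fun t => negDeriv U (-t) i.castSucc) =O[atTop] fun t => Real.exp (-L * t)) ∧
      (fun t => Real.exp (-L * t)) =O[atTop] fun t => negDeriv U (-t) i.castSucc := by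
  have hb := h.fv_Um_pos
  have hr := h.perron_root
  have hc := h.c_pos
  obtain ⟨η, hη, hO⟩ := h.exists_rate_reflect
  set η' := min η ((Um 0 / c - L) / 2) with hη'
  have hη'0 : 0 < η' := lt_min hη (by linarith)
  have hle : η' ≤ (Um 0 / c - L) / 2 := min_le_right _ _
  have hJ : ∀ i j : Fin 2, (fun t => jacobian p.F (U (-t)) i.castSucc j.castSucc
      - jacobian p.F Um i.castSucc j.castSucc) =O[atTop] fun t => Real.exp (-η' * t) := fun i j =>
    (isBigO_sub_of_differentiableAt
      (p.differentiableAt_jacobian h.one_add_Um_zero h.one_add_Um_two _ _) h.tendsto_reflect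
      hO).trans (isBigO_exp_exp (neg_le_neg (min_le_left _ _)))
  have hφ : ∀ i, 0 < (![jacobian p.F Um 0 1, p.perron Um - jacobian p.F Um 0 0] : Fin 2 → ℝ) i := by
    intro i
    fin_cases i
    · simpa using hb
    · simpa using hm
  have hker : ∀ i : Fin 2, ((-L) ^ 2 + -c * -L)
      * (![jacobian p.F Um 0 1, p.perron Um - jacobian p.F Um 0 0] : Fin 2 → ℝ) i
      + ∑ j : Fin 2, jacobian p.F Um i.castSucc j.castSucc
        * (![jacobian p.F Um 0 1, p.perron Um - jacobian p.F Um 0 0] : Fin 2 → ℝ) j = 0 := by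
    intro i
    fin_cases i
    · simp [Fin.sum_univ_two]
      linear_combination jacobian p.F Um 0 1 * hroot
    · simp [Fin.sum_univ_two]
      linear_combination (p.perron Um - jacobian p.F Um 0 0) * hroot - hr
  constructor
  · refine h.isStableCoop_reflect.isBigO_exp_sharp (c := -c)
      (w := fun i t => negDeriv U (-t) i.castSucc)
      (fun i => h.hasDerivs_negDeriv_reflect (castSucc_ne_two i)) (fun i t => h.negDeriv_pos _ _)
      (fun i => h.tendsto_negDeriv_reflect (castSucc_ne_two i)) hφ hη'0 hJ hker (by linarith)
      (fun i => ?_) i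
    simp only [sysOp_reflect]
    exact h.forcing_isBigO_reflect (h.Q_isBigO (by linarith)) _
  · refine h.isStableCoop_reflect.exp_isBigO_sharp (c := -c)
      (w := fun i t => negDeriv U (-t) i.castSucc)
      (fun i => h.hasDerivs_negDeriv_reflect (castSucc_ne_two i)) (fun i t => h.negDeriv_pos _ _)
      (by linarith) hφ hη'0 hJ hker (by linarith) (Eventually.of_forall fun t i => ?_) i
    rw [sysOp_reflect]
    exact neg_nonpos.2 (mul_nonneg (h.jacobian_offDiag_nonneg _ _ _ (castSucc_ne_two i))
      (h.negDeriv_pos _ _).le)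

/-- The triangular case in which the tension relaxes faster than the activity. -/
theorem sharp_of_triangular {L : ℝ} (hL : 0 < L) (hroot : L ^ 2 + c * L + p.perron Um = 0)
    (hLR : L < Um 0 / c) (hk : ¬ 0 < p.k0)
    (hlt : jacobian p.F Um 1 1 < jacobian p.F Um 0 0) :
    ((fun t => negDeriv U (-t) 0) =O[atTop] fun t => Real.exp (-L * t)) ∧
      ((fun t => negDeriv U (-t) 1) =O[atTop] fun t => Real.exp (-L * t)) ∧
      (fun t => Real.exp (-L * t)) =O[atTop] fun t => negDeriv U (-t) 0 := by
  have hgu := h.gu_Um_eq_zero hk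
  have hperr := h.perron_eq_fu hgu hlt.le
  have hgu' : ∀ t, jacobian p.F (U (-t)) 1 0 = 0 := fun t => by
    rw [p.gu_eq (h.one_add_u_pos _) (h.one_add_P_pos _),
      le_antisymm (not_lt.1 hk) h.adm.k0_nonneg, zero_mul]
  have hc := h.c_pos
  obtain ⟨η, hη, hO⟩ := h.exists_rate_reflect
  set B := jacobian p.F Um 0 0 - jacobian p.F Um 1 1 with hB
  have hB0 : 0 < B := sub_pos.2 hlt
  -- small enough to keep `L + η'` below the rates of the police density and of the tension
  set η' := min (min η ((Um 0 / c - L) / 2)) (min 1 (B / (2 * (2 * L + 1 + c)))) with hη'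
  have hd : 0 < 2 * (2 * L + 1 + c) := by linarith
  have hη'0 : 0 < η' := lt_min (lt_min hη (by linarith)) (lt_min one_pos (div_pos hB0 hd))
  have hle1 : η' ≤ η := (min_le_left _ _).trans (min_le_left _ _)
  have hle2 : η' ≤ (Um 0 / c - L) / 2 := (min_le_left _ _).trans (min_le_right _ _)
  have hle3 : η' ≤ 1 := (min_le_right _ _).trans (min_le_left _ _)
  have hle4 : η' * (2 * (2 * L + 1 + c)) ≤ B :=
    (le_div_iff₀ hd).1 ((min_le_right _ _).trans (min_le_right _ _))
  have hQ := h.Q_isBigO (l := -L - η') (by linarith)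
  have hJ : (fun t => jacobian p.F (U (-t)) 0 0 - jacobian p.F Um 0 0) =O[atTop]
      fun t => Real.exp (-η' * t) :=
    (isBigO_sub_of_differentiableAt
      (p.differentiableAt_jacobian h.one_add_Um_zero h.one_add_Um_two _ _) h.tendsto_reflect
      hO).trans (isBigO_exp_exp (neg_le_neg hle1))
  have hy : (fun t => negDeriv U (-t) 1) =O[atTop] fun t => Real.exp ((-L - η') * t) := by
    refine isBigO_exp_scalar (c := -c) (h.tendsto_jacobian_reflect 1 1) h.gv_Um_neg
      (h.hasDerivs_negDeriv_reflect (i := 1) (by decide)) (fun t => h.negDeriv_pos _ _)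
      (h.tendsto_negDeriv_reflect (by decide)) (by nlinarith) ?_
    refine (h.forcing_isBigO_reflect hQ 1).congr_left fun t => ?_
    rw [Fin.sum_univ_three, hgu']
    ring
  refine ⟨?_, hy.trans (isBigO_exp_exp (by linarith)), ?_⟩
  · refine isBigO_exp_sharp_scalar (c := -c) (h.tendsto_jacobian_reflect 0 0) h.fu_Um_neg
      (h.hasDerivs_negDeriv_reflect (i := 0) (by decide)) (fun t => h.negDeriv_pos _ _)
      (h.tendsto_negDeriv_reflect (by decide)) hη'0 hJ
      (by rw [← hperr]; linarith) (by linarith) ?_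
    have hyJ := (((h.tendsto_jacobian_reflect 0 1).isBigO_one ℝ).mul hy).neg_left
    simp only [one_mul] at hyJ
    refine ((h.forcing_isBigO_reflect hQ 0).add hyJ).congr_left fun t => ?_
    rw [Fin.sum_univ_three]
    ring
  · refine exp_isBigO_sharp_scalar (c := -c) (h.tendsto_jacobian_reflect 0 0) h.fu_Um_neg
      (h.hasDerivs_negDeriv_reflect (i := 0) (by decide)) (fun t => h.negDeriv_pos _ _)
      (by linarith) hη'0 hJ
      (by rw [← hperr]; linarith) (by linarith)
      (Eventually.of_forall fun t => (h.component_le (j := 2) (by decide) t).trans ?_)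
    exact neg_nonpos.2 (mul_nonneg (h.jacobian_offDiag_nonneg _ _ _ (by decide))
      (h.negDeriv_pos _ _).le)

theorem rateAtBot {l : ℝ} (hl : 0 < l) {S : Set (Fin 3)}
    (hu : ∀ i, (fun t => negDeriv U (-t) i) =O[atTop] fun t => Real.exp (-l * t))
    (hlow : ∀ i ∈ S, (fun t => Real.exp (-l * t)) =O[atTop] fun t => negDeriv U (-t) i) :
    RateAtBot Um U l S := by
  obtain ⟨h1, h2⟩ := h.decaysWith_reflect.expBounds (l := -l) (by linarith) hu hlow
  exact ⟨ExpBounds.reflect h1, ExpBounds.reflect h2⟩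

theorem rateAtBotLoss {l : ℝ} (hl : 0 < l) {S : Set (Fin 3)}
    (hu : ∀ m, -l < m → m < 0 → ∀ i,
      (fun t => negDeriv U (-t) i) =O[atTop] fun t => Real.exp (m * t))
    (hlow : ∀ m < -l, ∀ i ∈ S,
      (fun t => Real.exp (m * t)) =O[atTop] fun t => negDeriv U (-t) i) :
    RateAtBotLoss Um U l S := by
  obtain ⟨h1, h2⟩ := h.decaysWith_reflect.expBoundsLoss (l := -l) (by linarith) hu hlow
  exact ⟨ExpBoundsLoss.reflect h1, ExpBoundsLoss.reflect h2⟩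

end IsFront

/-! ### Sliding: waves above the minimal speed do not decay fast -/

theorem exists_mem_segment_F {p : Params} {s : Set (Fin 3 → ℝ)} (hs : Convex ℝ s)
    (hdom : ∀ x ∈ s, 0 < 1 + x 0 ∧ 0 < 1 + x 2) {x y : Fin 3 → ℝ} (hx : x ∈ s) (hy : y ∈ s)
    (i : Fin 3) :
    ∃ ξ ∈ s, p.F y i - p.F x i = ∑ j, jacobian p.F ξ i j * (y j - x j) := by
  obtain ⟨ξ, hξ, heq⟩ := domain_mvt (f := fun x => p.F x i)
    (f' := fun x => (ContinuousLinearMap.proj i).comp (fderiv ℝ p.F x))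
    (fun x hx => (hasFDerivAt_pi'.1 (p.differentiableAt_F (hdom x hx).1
      (hdom x hx).2).hasFDerivAt i).hasFDerivWithinAt) hs hx hy
  refine ⟨ξ, hs.segment_subset hx hy hξ, heq.trans ?_⟩
  exact fderiv_apply_eq_jacobian p.F ξ (y - x) i

namespace IsFront

variable {p : Params} {c c' P : ℝ} {Up Um : Fin 3 → ℝ} {U W : ℝ → Fin 3 → ℝ}

/-- At a local minimum of the difference between a shifted wave of smaller speed and `U`, the source
term of the shifted wave is strictly smaller. -/
theorem F_sub_neg_of_isLocalMin (h : IsFront p c P Up Um U) (hW : IsFront p c' P Up Um W)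
    (hcc : c' < c) {τ z : ℝ} {i : Fin 3}
    (hloc : IsLocalMin (fun z => W (z - τ) i - U z i) z) :
    p.F (W (z - τ)) i - p.F (U z) i < 0 := by
  have hWd : ∀ z, HasDerivAt (fun z => W (z - τ) i) (-negDeriv W (z - τ) i) z := fun z =>
    (hW.hasDerivAt i (z - τ)).comp_sub_const z τ
  have hn : negDeriv W (z - τ) i = negDeriv U z i := by
    have := hloc.hasDerivAt_eq_zero ((hWd z).fun_sub (h.hasDerivAt i z))
    linarith
  have hpos := h.negDeriv_pos z i
  have hlt : (c' - c) * negDeriv U z i < 0 := mul_neg_of_neg_of_pos (sub_neg.2 hcc) hpos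
  by_cases hi : i = 2
  · subst hi
    have h1 : p.F (W (z - τ)) 2 = c' * negDeriv W (z - τ) 2 := (hW.ode_P _).symm
    have h2 : p.F (U z) 2 = c * negDeriv U z 2 := (h.ode_P _).symm
    rw [h1, h2, hn]
    linarith
  · have hd : HasDerivs (fun z => W (z - τ) i - U z i)
        (fun z => -negDeriv W (z - τ) i - -negDeriv U z i)
        (fun z => -(-c' * negDeriv W (z - τ) i + p.F (W (z - τ)) i)
          - -(-c * negDeriv U z i + p.F (U z) i)) :=
      ⟨fun z => (hWd z).sub (h.hasDerivAt i z), fun z =>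
        (((hW.hasDerivs_negDeriv hi).1 (z - τ)).comp_sub_const z τ).fun_neg.sub
          ((h.hasDerivs_negDeriv hi).1 z).fun_neg⟩
    have h2 := (hd.of_isLocalMin hloc).2
    rw [hn] at h2
    linarith

/-- A shift of the slower wave that lies above `U` does not touch it. -/
theorem lt_shift_of_le (h : IsFront p c P Up Um U) (hW : IsFront p c' P Up Um W)
    (hcc : c' < c) {τ : ℝ} (hle : ∀ z i, U z i ≤ W (z - τ) i) (z : ℝ) (i : Fin 3) :
    U z i < W (z - τ) i := by
  refine lt_of_le_of_ne (hle z i) fun heq => ?_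
  have hloc : IsLocalMin (fun z => W (z - τ) i - U z i) z := by
    refine Eventually.of_forall fun t => ?_
    simp only [← heq, sub_self]
    exact sub_nonneg.2 (hle t i)
  have hlt := h.F_sub_neg_of_isLocalMin hW hcc hloc
  set s : Set (Fin 3 → ℝ) := Set.univ.pi ![Set.Icc 0 1, Set.Ici 0, Set.Icc 0 1] with hs
  have hmem : ∀ x : Fin 3 → ℝ, x ∈ s ↔
      (0 ≤ x 0 ∧ x 0 ≤ 1) ∧ 0 ≤ x 1 ∧ (0 ≤ x 2 ∧ x 2 ≤ 1) := fun x => by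
    simp [hs, Set.mem_pi, Fin.forall_fin_succ]
  have hconv : Convex ℝ s := convex_pi fun j _ => by
    fin_cases j
    · exact convex_Icc _ _
    · exact convex_Ici _
    · exact convex_Icc _ _
  obtain ⟨ξ, hξ, heqF⟩ := exists_mem_segment_F (p := p) hconv
    (fun x hx => by have := (hmem x).1 hx; constructor <;> linarith [this.1.1, this.2.2.1])
    ((hmem (U z)).2 ⟨⟨(h.u_pos z).le, (h.u_lt_one z).le⟩, (h.v_pos z).le, h.wave.P_nonneg z,
      (h.P_lt z).le⟩)
    ((hmem (W (z - τ))).2 ⟨⟨(hW.u_pos _).le, (hW.u_lt_one _).le⟩, (hW.v_pos _).le,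
      hW.wave.P_nonneg _, (hW.P_lt _).le⟩) i
  rw [heqF] at hlt
  refine absurd hlt (not_lt.2 (Finset.sum_nonneg fun j _ => ?_))
  by_cases hij : i = j
  · subst hij; rw [heq, sub_self, mul_zero]
  · obtain ⟨h0, h1, h2⟩ := (hmem ξ).1 hξ
    exact mul_nonneg (h.adm.jacobian_offDiag_nonneg h0.1 h0.2 h1 h2.1 h2.2 i j hij)
      (sub_nonneg.2 (hle z j))

/-- The stable state `Um` has a positive direction into which the linearized source points
inwards. -/
theorem exists_pos_jacobian_neg (h : IsFront p c P Up Um U) :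
    ∃ φ : Fin 3 → ℝ, (∀ i, 0 < φ i) ∧ ∀ i, ∑ j, jacobian p.F Um i j * φ j < 0 := by
  obtain ⟨φ₀, h0, φ₁, h1, h2, h3⟩ := exists_pos_supersolution (s := 0) h.fv_Um_pos
    h.le_perron.1 h.le_perron.2 h.perron_root (by simpa using h.perron_neg)
  have hnn : ∀ i : Fin 3, i ≠ 2 → 0 ≤ jacobian p.F Um i 2 := fun i hi =>
    h.adm.jacobian_offDiag_nonneg h.Um_zero_pos.le h.Um_zero_lt_one.le h.Um_one_pos.le
      (by rw [h.Um_two]; norm_num) h.Um_two.le i 2 hi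
  have hA := hnn 0 (by decide)
  have hB := hnn 1 (by decide)
  set r₀ := -((0 + jacobian p.F Um 0 0) * φ₀ + jacobian p.F Um 0 1 * φ₁) with hr₀
  set r₁ := -(jacobian p.F Um 1 0 * φ₀ + (0 + jacobian p.F Um 1 1) * φ₁) with hr₁
  have hr₀' : 0 < r₀ := neg_pos.2 h2
  have hr₁' : 0 < r₁ := neg_pos.2 h3
  set δ := min (r₀ / (jacobian p.F Um 0 2 + 1)) (r₁ / (jacobian p.F Um 1 2 + 1)) with hδ
  have hδ0 : 0 < δ := lt_min (by positivity) (by positivity)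
  have hδ1 : δ * (jacobian p.F Um 0 2 + 1) ≤ r₀ :=
    (le_div_iff₀ (by positivity)).1 (min_le_left _ _)
  have hδ2 : δ * (jacobian p.F Um 1 2 + 1) ≤ r₁ :=
    (le_div_iff₀ (by positivity)).1 (min_le_right _ _)
  refine ⟨![φ₀, φ₁, δ], fun i => ?_, fun i => ?_⟩
  · rcases fin_three_cases i with rfl | rfl | rfl <;> simpa
  · rw [Fin.sum_univ_three]
    rcases fin_three_cases i with rfl | rfl | rfl
    · simp only [Matrix.cons_val]
      linarith
    · simp only [Matrix.cons_val]
      linarith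
    · simp only [Matrix.cons_val]
      rw [p.su_eq h.one_add_Um_zero h.one_add_Um_two, p.sv_eq h.one_add_Um_zero h.one_add_Um_two,
        p.sP_eq h.one_add_Um_zero h.one_add_Um_two, h.Um_two]
      have := mul_pos h.Um_zero_pos hδ0
      linarith

/-- Near `-∞` the order between `U` and a shift of the slower wave is inherited from the right end
of the half-line, uniformly for shifts bounded below. -/
theorem exists_slide_bottom (h : IsFront p c P Up Um U) (hW : IsFront p c' P Up Um W)
    (hcc : c' < c) (τ₀ : ℝ) :
    ∃ Z, ∀ τ ≥ τ₀, (∀ i, U (-Z) i ≤ W (-Z - τ) i) → ∀ z ≤ -Z, ∀ i, U z i ≤ W (z - τ) i := by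
  obtain ⟨φ, hφ, hneg⟩ := h.exists_pos_jacobian_neg
  have hev : ∀ᶠ x in 𝓝 Um, (∀ i, ∑ j, jacobian p.F x i j * φ j < 0) ∧
      0 < x 0 ∧ 0 < x 1 ∧ 0 < x 2 := by
    have hap : ∀ i : Fin 3, Tendsto (fun x : Fin 3 → ℝ => x i) (𝓝 Um) (𝓝 (Um i)) := fun i =>
      (continuous_apply i).tendsto Um
    refine (eventually_all.2 fun i => ?_).and (((hap 0).eventually_const_lt h.Um_zero_pos).and
      (((hap 1).eventually_const_lt h.Um_one_pos).and
        ((hap 2).eventually_const_lt (by rw [h.Um_two]; norm_num))))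
    refine Tendsto.eventually_lt_const (hneg i) (tendsto_finsetSum _ fun j _ => ?_)
    exact ((p.differentiableAt_jacobian h.one_add_Um_zero h.one_add_Um_two i
      j).continuousAt.tendsto).mul_const _
  obtain ⟨ε, hε, hball⟩ := Metric.eventually_nhds_iff.1 hev
  set s : Set (Fin 3 → ℝ) := Set.univ.pi fun i => Set.Ioo (Um i - ε) (Um i) with hs
  have hconv : Convex ℝ s := convex_pi fun j _ => convex_Ioo _ _
  have hsprop : ∀ x ∈ s, (∀ i, ∑ j, jacobian p.F x i j * φ j < 0) ∧ 0 < x 0 ∧ 0 < x 1 ∧ 0 < x 2 := by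
    intro x hx
    apply hball
    rw [dist_pi_lt_iff hε]
    intro i
    have := hx i trivial
    rw [Real.dist_eq, abs_lt]
    constructor <;> linarith [this.1, this.2]
  have hsup : ∀ x ∈ s, x 0 ≤ 1 ∧ x 2 ≤ 1 := fun x hx =>
    ⟨(hx 0 trivial).2.le.trans h.Um_zero_lt_one.le, (hx 2 trivial).2.le.trans h.Um_two.le⟩
  have hUev : ∀ᶠ z in atBot, ∀ i, Um i - ε < U z i := eventually_all.2 fun i =>
    (h.tendsto_bot i).eventually_const_lt (by linarith)
  have hWev : ∀ᶠ z in atBot, ∀ i, Um i - ε < W (z - τ₀) i := eventually_all.2 fun i =>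
    ((hW.tendsto_bot i).comp (tendsto_atBot_add_const_right _ (-τ₀) tendsto_id)).eventually_const_lt
      (by linarith)
  obtain ⟨Z', hZ'⟩ := eventually_atBot.1 (hUev.and hWev)
  refine ⟨-Z', fun τ hτ hstart => ?_⟩
  have hUs : ∀ t ≥ -Z', U (-t) ∈ s := fun t ht i _ =>
    ⟨(hZ' (-t) (by linarith)).1 i, h.lt_Um _ i⟩
  have hWs : ∀ t ≥ -Z', W (-t - τ) ∈ s := fun t ht i _ =>
    ⟨((hZ' (-t) (by linarith)).2 i).trans_le ((hW.strictAnti i).antitone (by linarith)),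
      hW.lt_Um _ i⟩
  have hmv : ∀ t ≥ -Z', ∀ i, ∃ ξ ∈ s, p.F (W (-t - τ)) i - p.F (U (-t)) i
      = ∑ j, jacobian p.F ξ i j * (W (-t - τ) j - U (-t) j) := fun t ht i =>
    exists_mem_segment_F hconv (fun x hx => by
      have := (hsprop x hx).2
      constructor <;> linarith [this.1, this.2.2]) (hUs t ht) (hWs t ht) i
  choose! ξ hξs hξ using hmv
  have key := nonneg_of_localMin (w := fun i t => W (-t - τ) i - U (-t) i)
    (A := fun t i j => jacobian p.F (ξ t i) i j) (φ := φ) (Z := -Z') hφ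
    (fun i => (((hW.continuous_comp i).comp (by fun_prop : Continuous fun t : ℝ => -t - τ)).sub
      ((h.continuous_comp i).comp continuous_neg)).continuousOn)
    (fun i => sub_nonneg.2 (hstart i))
    (fun i ε' hε' => by
      have h1 : Tendsto (fun t => W (-t - τ) i) atTop (𝓝 (Um i)) :=
        (hW.tendsto_bot i).comp
          (tendsto_atBot_add_const_right _ (-τ) tendsto_neg_atTop_atBot)
      have h2 := h1.sub ((h.tendsto_bot i).comp tendsto_neg_atTop_atBot)
      rw [sub_self] at h2
      exact h2.eventually_const_lt (by linarith))
    (fun t ht i j hij => by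
      have h1 := hsprop _ (hξs t ht.le i)
      have h2 := hsup _ (hξs t ht.le i)
      exact h.adm.jacobian_offDiag_nonneg h1.2.1.le h2.1 h1.2.2.1.le h1.2.2.2.le h2.2 i j hij)
    (fun t ht i => (hsprop _ (hξs t ht.le i)).1 i)
    (fun t ht i hloc _ => by
      rw [← hξ t ht.le i]
      refine (h.F_sub_neg_of_isLocalMin hW hcc ?_).le
      have h1 : IsLocalMin (fun t => W (-t - τ) i - U (-t) i) (-(-t)) := by rwa [neg_neg]
      have h2 := h1.comp_continuous (g := fun z : ℝ => -z) continuous_neg.continuousAt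
      simpa [Function.comp_def] using h2)
  intro z hz i
  have := key (-z) (by linarith) i
  simp only [neg_neg] at this
  linarith

/-- Near `+∞` every shift of the more slowly decaying wave lies above `U`. -/
theorem exists_slide_top {l l' : ℝ} (hW : IsFront p c' P Up Um W) (hl : l < l')
    (hU : ∀ i, (fun z => U z i - Up i) =O[atTop] fun z => Real.exp (l * z))
    (hWl : ∀ i, (fun z => Real.exp (l' * z)) =O[atTop] fun z => W z i - Up i) (τ₀ : ℝ) :
    ∃ Z, ∀ τ ≥ τ₀, ∀ z ≥ Z, ∀ i, U z i < W (z - τ) i := by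
  have hev : ∀ᶠ z in atTop, ∀ i, U z i < W (z - τ₀) i := by
    refine eventually_all.2 fun i => ?_
    have h1 : (fun z => Real.exp (l * z)) =o[atTop] fun z => Real.exp (l' * z) := by
      rw [Real.isLittleO_exp_comp_exp_comp]
      refine (tendsto_id.const_mul_atTop (sub_pos.2 hl)).congr fun z => ?_
      simp only [id]
      ring
    have h2 : (fun z => Real.exp (l' * z)) =O[atTop] fun z => W (z - τ₀) i - Up i := by
      have h3 := (hWl i).comp_tendsto (tendsto_atTop_add_const_right atTop (-τ₀) tendsto_id)
      refine (h3.const_mul_left (Real.exp (l' * τ₀))).congr_left fun z => ?_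
      simp only [Function.comp, id]
      rw [← Real.exp_add]
      ring_nf
    have h4 := ((hU i).trans_isLittleO h1).trans_isBigO h2
    filter_upwards [h4.bound (show (0 : ℝ) < 1 / 2 by norm_num)] with z hz
    have h5 : 0 < W (z - τ₀) i - Up i := sub_pos.2 (hW.Up_lt _ i)
    rw [Real.norm_of_nonneg h5.le] at hz
    have := le_abs_self (U z i - Up i)
    rw [← Real.norm_eq_abs] at this
    linarith
  obtain ⟨Z, hZ⟩ := eventually_atTop.1 hev
  exact ⟨Z, fun τ hτ z hz i =>
    (hZ z hz i).trans_le ((hW.strictAnti i).antitone (by linarith))⟩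

/-- A wave cannot decay faster at `+∞` than a wave of smaller speed: otherwise the smallest shift of
the slower wave that lies above it would have to touch it. -/
theorem false_of_faster_decay (h : IsFront p c P Up Um U) (hW : IsFront p c' P Up Um W)
    (hcc : c' < c) {l l' : ℝ} (hl : l < l')
    (hU : ∀ i, (fun z => U z i - Up i) =O[atTop] fun z => Real.exp (l * z))
    (hWl : ∀ i, (fun z => Real.exp (l' * z)) =O[atTop] fun z => W z i - Up i) : False := by
  set T : Set ℝ := {τ | ∀ z i, U z i ≤ W (z - τ) i} with hT
  -- membership in `T` is decided on a compact interval
  have hmemT : ∀ τ₀, ∃ Z₁ Z₂, -Z₁ ≤ Z₂ ∧ ∀ τ ≥ τ₀,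
      (∀ z ∈ Set.Icc (-Z₁) Z₂, ∀ i, U z i ≤ W (z - τ) i) → τ ∈ T := by
    intro τ₀
    obtain ⟨Z₁, hZ₁⟩ := h.exists_slide_bottom hW hcc τ₀
    obtain ⟨Z₂, hZ₂⟩ := hW.exists_slide_top hl hU hWl τ₀
    refine ⟨Z₁, max (-Z₁) Z₂, le_max_left _ _, fun τ hτ hK z i => ?_⟩
    rcases le_total z (-Z₁) with hz | hz
    · exact hZ₁ τ hτ (hK _ ⟨le_rfl, le_max_left _ _⟩) z hz i
    · rcases le_total z (max (-Z₁) Z₂) with hz' | hz'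
      · exact hK z ⟨hz, hz'⟩ i
      · exact (hZ₂ τ hτ z ((le_max_right _ _).trans hz') i).le
  have hne : T.Nonempty := by
    obtain ⟨Z₁, Z₂, -, hK⟩ := hmemT 0
    have hev : ∀ᶠ τ in atTop, ∀ i, U (-Z₁) i < W (Z₂ - τ) i := eventually_all.2 fun i => by
      have h1 : Tendsto (fun τ => W (Z₂ - τ) i) atTop (𝓝 (Um i)) :=
        (hW.tendsto_bot i).comp (tendsto_atBot_add_const_left _ Z₂ tendsto_neg_atTop_atBot)
      exact h1.eventually_const_lt (h.lt_Um _ i)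
    obtain ⟨τ, hτ, hτ0⟩ := (hev.and (eventually_ge_atTop 0)).exists
    refine ⟨τ, hK τ hτ0 fun z hz i => ?_⟩
    calc U z i ≤ U (-Z₁) i := (h.strictAnti i).antitone hz.1
      _ ≤ W (Z₂ - τ) i := (hτ i).le
      _ ≤ W (z - τ) i := (hW.strictAnti i).antitone (by linarith [hz.2])
  have hbdd : BddBelow T := by
    have h1 : Tendsto (fun τ => W (0 - τ) 0) atBot (𝓝 (Up 0)) :=
      (hW.tendsto_top 0).comp (tendsto_atTop_add_const_left _ 0 tendsto_neg_atBot_atTop)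
    obtain ⟨B, hB⟩ := eventually_atBot.1 (h1.eventually_lt_const (h.Up_lt 0 0))
    refine ⟨B, fun τ hτ => ?_⟩
    by_contra! hlt
    exact absurd (hτ 0 0) (not_le.2 (hB τ hlt.le))
  have hclosed : IsClosed T := by
    simp only [hT, Set.ofPred_forall]
    refine isClosed_iInter fun z => isClosed_iInter fun i => isClosed_le continuous_const ?_
    exact (hW.continuous_comp i).comp (by fun_prop : Continuous fun τ : ℝ => z - τ)
  set τs := sInf T with hτs
  have hmem : τs ∈ T := hclosed.csInf_mem hne hbdd
  have hstrict := h.lt_shift_of_le hW hcc hmem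
  obtain ⟨Z₁, Z₂, -, hK⟩ := hmemT (τs - 1)
  have hopen : ∀ᶠ τ in 𝓝 τs, ∀ z ∈ Set.Icc (-Z₁) Z₂, ∀ i, U z i < W (z - τ) i := by
    refine isCompact_Icc.eventually_forall_of_forall_eventually fun z _ => ?_
    refine eventually_all.2 fun i => ?_
    have hc1 : Continuous fun q : ℝ × ℝ => U q.2 i := (h.continuous_comp i).comp continuous_snd
    have hc2 : Continuous fun q : ℝ × ℝ => W (q.2 - q.1) i :=
      (hW.continuous_comp i).comp (by fun_prop : Continuous fun q : ℝ × ℝ => q.2 - q.1)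
    exact hc1.continuousAt.eventually_lt hc2.continuousAt (hstrict z i)
  have hlt : ∀ᶠ τ in 𝓝[<] τs, τ < τs ∧ τs - 1 < τ :=
    (eventually_mem_nhdsWithin).and
      (mem_nhdsWithin_of_mem_nhds (lt_mem_nhds (by linarith : τs - 1 < τs)))
  obtain ⟨τ, h1, h2, h3⟩ := ((hopen.filter_mono nhdsWithin_le_nhds).and hlt).exists
  exact absurd (csInf_le hbdd (hK τ h3.le fun z hz i => (h1 z hz i).le)) (not_le.2 h2)

end IsFront

/-! ### Principal eigenvalues of the first-order system -/

theorem Params.waveMatrix_mulVec {p : Params} {x : Fin 3 → ℝ} (h0 : 0 < 1 + x 0)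
    (h2 : 0 < 1 + x 2) (c : ℝ) (V : Fin 5 → ℝ) :
    (p.waveMatrix c x).mulVec V = ![V 3, V 4,
      -(1 / c) * ∑ j, jacobian p.F x 2 j * (![V 0, V 1, V 2] : Fin 3 → ℝ) j,
      -c * V 3 - ∑ j, jacobian p.F x 0 j * (![V 0, V 1, V 2] : Fin 3 → ℝ) j,
      -c * V 4 - ∑ j, jacobian p.F x 1 j * (![V 0, V 1, V 2] : Fin 3 → ℝ) j] := by
  set Y : Fin 5 → ℝ := ![x 0, x 1, x 2, 0, 0] with hY
  set π : (Fin 5 → ℝ) →L[ℝ] (Fin 3 → ℝ) := ContinuousLinearMap.pi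
    ![ContinuousLinearMap.proj 0, ContinuousLinearMap.proj 1, ContinuousLinearMap.proj 2] with hπ
  have hπa : ∀ W : Fin 5 → ℝ, π W = ![W 0, W 1, W 2] := fun W => by
    funext i
    rcases fin_three_cases i with rfl | rfl | rfl <;> rfl
  have hπY : π Y = x := by
    rw [hπa]
    funext i
    rcases fin_three_cases i with rfl | rfl | rfl <;> rfl
  have hF : ∀ i, HasFDerivAt (fun Z : Fin 5 → ℝ => p.F (π Z) i)
      (((ContinuousLinearMap.proj i).comp (fderiv ℝ p.F x)).comp π) Y := fun i => by
    have h1 := (p.differentiableAt_F h0 h2).hasFDerivAt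
    rw [← hπY] at h1
    have h3 := hasFDerivAt_pi'.1 (h1.comp Y π.hasFDerivAt) i
    rw [hπY] at h3
    exact h3
  have hproj : ∀ i : Fin 5, HasFDerivAt (fun Z : Fin 5 → ℝ => Z i)
      (ContinuousLinearMap.proj (R := ℝ) (φ := fun _ : Fin 5 => ℝ) i) Y := fun i =>
    hasFDerivAt_apply i Y
  have hD : HasFDerivAt (p.waveField c) (ContinuousLinearMap.pi
      ![ContinuousLinearMap.proj 3, ContinuousLinearMap.proj 4,
        (-(1 / c)) • ((ContinuousLinearMap.proj 2).comp (fderiv ℝ p.F x)).comp π,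
        (-c) • ContinuousLinearMap.proj 3
          - ((ContinuousLinearMap.proj 0).comp (fderiv ℝ p.F x)).comp π,
        (-c) • ContinuousLinearMap.proj 4
          - ((ContinuousLinearMap.proj 1).comp (fderiv ℝ p.F x)).comp π]) Y := by
    rw [hasFDerivAt_pi']
    intro i
    fin_cases i
    · exact hproj 3
    · exact hproj 4
    · exact (hF 2).const_mul (-(1 / c))
    · exact ((hproj 3).const_mul (-c)).sub (hF 0)
    · exact ((hproj 4).const_mul (-c)).sub (hF 1)
  have hmul : (p.waveMatrix c x).mulVec V = fderiv ℝ (p.waveField c) Y V := by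
    funext i
    rw [fderiv_apply_eq_jacobian]
    rfl
  rw [hmul, hD.fderiv]
  funext i
  have hc : ∀ j, fderiv ℝ p.F x (π V) j
      = ∑ k, jacobian p.F x j k * (![V 0, V 1, V 2] : Fin 3 → ℝ) k := fun j => by
    rw [fderiv_apply_eq_jacobian, hπa]
  fin_cases i
  · rfl
  · rfl
  · exact congrArg (fun y => -(1 / c) * y) (hc 2)
  · exact congrArg (fun y => -c * V 3 - y) (hc 0)
  · exact congrArg (fun y => -c * V 4 - y) (hc 1)

/-- Eigenvalues of the first-order system as solutions of the quadratic eigenvalue problem for the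
second-order one. -/
theorem Params.hasEigenvalue_waveMatrix_iff {p : Params} {x : Fin 3 → ℝ} (h0 : 0 < 1 + x 0)
    (h2 : 0 < 1 + x 2) {c : ℝ} (hc : 0 < c) (r : ℝ) :
    Module.End.HasEigenvalue (Matrix.toLin' (p.waveMatrix c x)) r ↔
      ∃ a : Fin 3 → ℝ, a ≠ 0 ∧
        (r ^ 2 + c * r) * a 0 + ∑ j, jacobian p.F x 0 j * a j = 0 ∧
        (r ^ 2 + c * r) * a 1 + ∑ j, jacobian p.F x 1 j * a j = 0 ∧
        c * r * a 2 + ∑ j, jacobian p.F x 2 j * a j = 0 := by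
  constructor
  · intro hr
    obtain ⟨V, hV⟩ := hr.exists_hasEigenvector
    rw [Module.End.hasEigenvector_iff, Module.End.mem_eigenspace_iff, Matrix.toLin'_apply,
      Params.waveMatrix_mulVec h0 h2] at hV
    obtain ⟨heq, hne⟩ := hV
    have e0 := congrFun heq 0
    have e1 := congrFun heq 1
    have e2 := congrFun heq 2
    have e3 := congrFun heq 3
    have e4 := congrFun heq 4
    simp only [Matrix.cons_val, Pi.smul_apply, smul_eq_mul] at e0 e1 e2 e3 e4
    refine ⟨![V 0, V 1, V 2], fun hz => hne ?_, ?_, ?_, ?_⟩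
    · have z0 : V 0 = 0 := congrFun hz 0
      have z1 : V 1 = 0 := congrFun hz 1
      have z2 : V 2 = 0 := congrFun hz 2
      funext i
      fin_cases i
      · exact z0
      · exact z1
      · exact z2
      · change V 3 = 0
        rw [e0, z0, mul_zero]
      · change V 4 = 0
        rw [e1, z1, mul_zero]
    · simp only [Matrix.cons_val]
      rw [e0] at e3
      linear_combination -e3
    · simp only [Matrix.cons_val]
      rw [e1] at e4
      linear_combination -e4
    · simp only [Matrix.cons_val]
      field_simp at e2
      linear_combination -e2
  · rintro ⟨a, hne, e0, e1, e2⟩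
    have ha : a = ![a 0, a 1, a 2] := by
      funext i
      rcases fin_three_cases i with rfl | rfl | rfl <;> rfl
    refine Module.End.hasEigenvalue_of_hasEigenvector (x := ![a 0, a 1, a 2, r * a 0, r * a 1]) ?_
    rw [Module.End.hasEigenvector_iff, Module.End.mem_eigenspace_iff, Matrix.toLin'_apply,
      Params.waveMatrix_mulVec h0 h2]
    constructor
    · simp only [Matrix.cons_val]
      rw [← ha]
      funext i
      fin_cases i
      · rfl
      · rfl
      · change -(1 / c) * ∑ j, jacobian p.F x 2 j * a j = r * a 2
        field_simp
        linear_combination -e2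
      · change -c * (r * a 0) - ∑ j, jacobian p.F x 0 j * a j = r * (r * a 0)
        linear_combination -e0
      · change -c * (r * a 1) - ∑ j, jacobian p.F x 1 j * a j = r * (r * a 1)
        linear_combination -e1
    · intro hz
      apply hne
      have z0 : a 0 = 0 := congrFun hz 0
      have z1 : a 1 = 0 := congrFun hz 1
      have z2 : a 2 = 0 := congrFun hz 2
      funext i
      rcases fin_three_cases i with rfl | rfl | rfl
      · exact z0
      · exact z1
      · exact z2

namespace IsFront

variable {p : Params} {c P : ℝ} {Up Um : Fin 3 → ℝ} {U : ℝ → Fin 3 → ℝ}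
  (h : IsFront p c P Up Um U)

include h

theorem hasEigenvalue_top_iff {r : ℝ} (hr : r ≠ 0) :
    Module.End.HasEigenvalue (Matrix.toLin' (p.waveMatrix c Up)) r ↔
      r ^ 2 + c * r + jacobian p.F Up 0 0 = 0 ∨ r ^ 2 + c * r + jacobian p.F Up 1 1 = 0 := by
  have a0 := h.one_add_Up_zero
  have a2 := h.one_add_Up_two
  have hc := h.c_pos
  rw [p.hasEigenvalue_waveMatrix_iff a0 a2 hc]
  have hfv : jacobian p.F Up 0 1 = 0 := by rw [p.fv_eq a0 a2, h.Up_zero]; ring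
  have hfP : jacobian p.F Up 0 2 = 0 := by rw [p.fP_eq a0 a2, h.Up_zero]; ring
  have hsP : jacobian p.F Up 2 2 = 0 := by rw [p.sP_eq a0 a2, h.Up_zero, neg_zero]
  simp only [Fin.sum_univ_three, hfv, hfP, hsP, p.su_eq a0 a2, p.sv_eq a0 a2]
  constructor
  · rintro ⟨a, hne, e0, e1, e2⟩
    by_cases hz : a 0 = 0
    · right
      rw [hz] at e1 e2
      have hz2 : a 2 = 0 := by
        have h3 : c * r * a 2 = 0 := by linarith
        exact (mul_eq_zero.1 h3).resolve_left (mul_ne_zero hc.ne' hr)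
      have hz1 : a 1 ≠ 0 := fun hz1 => hne (by
        funext i
        rcases fin_three_cases i with rfl | rfl | rfl
        · exact hz
        · exact hz1
        · exact hz2)
      rw [hz2] at e1
      have h3 : (r ^ 2 + c * r + jacobian p.F Up 1 1) * a 1 = 0 := by linarith
      exact (mul_eq_zero.1 h3).resolve_right hz1
    · left
      have h3 : (r ^ 2 + c * r + jacobian p.F Up 0 0) * a 0 = 0 := by linarith
      exact (mul_eq_zero.1 h3).resolve_right hz
  · intro hroot
    by_cases he : r ^ 2 + c * r + jacobian p.F Up 1 1 = 0
    · refine ⟨![0, 1, 0], fun hz => one_ne_zero (congrFun hz 1), ?_, ?_, ?_⟩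
      · simp
      · simpa using he
      · simp
    · have hq := hroot.resolve_right he
      refine ⟨![1, -(jacobian p.F Up 1 0 + jacobian p.F Up 1 2 * (-(1 - Up 2) / (c * r)))
        / (r ^ 2 + c * r + jacobian p.F Up 1 1), -(1 - Up 2) / (c * r)],
        fun hz => one_ne_zero (congrFun hz 0), ?_, ?_, ?_⟩
      · simpa using hq
      · simp only [Matrix.cons_val]
        linear_combination (-(jacobian p.F Up 1 0
          + jacobian p.F Up 1 2 * (-(1 - Up 2) / (c * r)))) * mul_inv_cancel₀ he
      · simp only [Matrix.cons_val]
        field_simp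
        ring

theorem isPrincipalAtTop_of_neg {s lam : ℝ} (hs : s < 0) (hlam : lam < 0)
    (hroot : lam ^ 2 + c * lam + s = 0)
    (hs1 : jacobian p.F Up 0 0 ≤ s) (hs2 : jacobian p.F Up 1 1 ≤ s)
    (hs3 : s = jacobian p.F Up 0 0 ∨ s = jacobian p.F Up 1 1) :
    IsPrincipalAtTop (p.waveMatrix c Up) lam := by
  refine ⟨⟨hlam, (h.hasEigenvalue_top_iff hlam.ne).2 ?_⟩, ?_⟩
  · rcases hs3 with h3 | h3
    · exact Or.inl (by rw [← h3]; exact hroot)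
    · exact Or.inr (by rw [← h3]; exact hroot)
  · rintro r ⟨hr, heig⟩
    have hge : 0 ≤ r ^ 2 + c * r + s := by
      rcases (h.hasEigenvalue_top_iff hr.ne).1 heig with h3 | h3 <;> linarith
    -- the other root of the quadratic for `s` is positive
    have hother : lam + c < 0 := by
      by_contra! h0
      nlinarith [mul_nonneg h0 (neg_nonneg.2 hlam.le)]
    by_contra! hlt
    nlinarith [mul_pos (sub_pos.2 hlt) (neg_pos.2 (by linarith : r + lam + c < 0))]

theorem isPrincipalAtTop_of_pos (hq : 0 < jacobian p.F Up 0 0)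
    (hcq : 4 * jacobian p.F Up 0 0 ≤ c ^ 2) :
    IsPrincipalAtTop (p.waveMatrix c Up) (rootPlus c (jacobian p.F Up 0 0)) := by
  have hc := h.c_pos
  have hsq := Real.sq_sqrt (sub_nonneg.2 hcq)
  have hnn := Real.sqrt_nonneg (c ^ 2 - 4 * jacobian p.F Up 0 0)
  unfold rootPlus
  set R := √(c ^ 2 - 4 * jacobian p.F Up 0 0) with hR
  have hRc : R < c := by nlinarith
  have hneg : (-c + R) / 2 < 0 := by linarith
  refine ⟨⟨hneg, (h.hasEigenvalue_top_iff hneg.ne).2 (Or.inl ?_)⟩, ?_⟩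
  · linear_combination hsq / 4
  · rintro r ⟨hr, heig⟩
    by_contra! hlt
    rcases (h.hasEigenvalue_top_iff hr.ne).1 heig with h3 | h3
    · nlinarith
    · have he := h.gv_Up_neg
      nlinarith [mul_pos (neg_pos.2 hr) (by linarith : 0 < r + c)]

theorem hasEigenvalue_bot_iff (r : ℝ) :
    Module.End.HasEigenvalue (Matrix.toLin' (p.waveMatrix c Um)) r ↔
      ∃ a : Fin 3 → ℝ, a ≠ 0 ∧
        (r ^ 2 + c * r + jacobian p.F Um 0 0) * a 0 + jacobian p.F Um 0 1 * a 1
          + jacobian p.F Um 0 2 * a 2 = 0 ∧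
        jacobian p.F Um 1 0 * a 0 + (r ^ 2 + c * r + jacobian p.F Um 1 1) * a 1
          + jacobian p.F Um 1 2 * a 2 = 0 ∧
        (c * r - Um 0) * a 2 = 0 := by
  have a0 := h.one_add_Um_zero
  have a2 := h.one_add_Um_two
  rw [p.hasEigenvalue_waveMatrix_iff a0 a2 h.c_pos]
  simp only [Fin.sum_univ_three, p.su_eq a0 a2, p.sv_eq a0 a2, p.sP_eq a0 a2, h.Um_two]
  refine exists_congr fun a => and_congr_right fun _ => ?_
  refine and_congr ⟨fun e => ?_, fun e => ?_⟩ (and_congr ⟨fun e => ?_, fun e => ?_⟩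
    ⟨fun e => ?_, fun e => ?_⟩) <;> linear_combination e

/-- Below `λ̃₂` the characteristic determinant of the `(u, v)` block is positive. -/
theorem det_pos {s : ℝ} (hs : s + p.perron Um < 0) :
    0 < (s + jacobian p.F Um 0 0) * (s + jacobian p.F Um 1 1)
      - jacobian p.F Um 0 1 * jacobian p.F Um 1 0 := by
  obtain ⟨h1, h2⟩ := h.le_perron
  rw [← h.perron_root]
  nlinarith [mul_nonneg (neg_nonneg.2 hs.le) (sub_nonneg.2 h1),
    mul_nonneg (neg_nonneg.2 hs.le) (sub_nonneg.2 h2), mul_pos_of_neg_of_neg hs hs]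

theorem eigenvalue_bot_ge {L r : ℝ} (hL : 0 < L) (hroot : L ^ 2 + c * L + p.perron Um = 0)
    (hr : 0 < r) (heig : Module.End.HasEigenvalue (Matrix.toLin' (p.waveMatrix c Um)) r) :
    r = Um 0 / c ∨ L ≤ r := by
  have hc := h.c_pos
  obtain ⟨a, hne, e0, e1, e2⟩ := (h.hasEigenvalue_bot_iff r).1 heig
  rcases mul_eq_zero.1 e2 with h3 | h3
  · left
    rw [eq_div_iff hc.ne']
    linarith
  · right
    by_contra! hlt
    have hdet := h.det_pos (s := r ^ 2 + c * r) (by nlinarith)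
    rw [h3, mul_zero, add_zero] at e0 e1
    have z0 : ((r ^ 2 + c * r + jacobian p.F Um 0 0) * (r ^ 2 + c * r + jacobian p.F Um 1 1)
      - jacobian p.F Um 0 1 * jacobian p.F Um 1 0) * a 0 = 0 := by
      linear_combination (r ^ 2 + c * r + jacobian p.F Um 1 1) * e0 - jacobian p.F Um 0 1 * e1
    have z1 : ((r ^ 2 + c * r + jacobian p.F Um 0 0) * (r ^ 2 + c * r + jacobian p.F Um 1 1)
      - jacobian p.F Um 0 1 * jacobian p.F Um 1 0) * a 1 = 0 := by
      linear_combination (r ^ 2 + c * r + jacobian p.F Um 0 0) * e1 - jacobian p.F Um 1 0 * e0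
    apply hne
    funext i
    rcases fin_three_cases i with rfl | rfl | rfl
    · exact (mul_eq_zero.1 z0).resolve_left hdet.ne'
    · exact (mul_eq_zero.1 z1).resolve_left hdet.ne'
    · exact h3

theorem isPrincipalAtBot_of_le {L : ℝ} (hL : 0 < L) (hroot : L ^ 2 + c * L + p.perron Um = 0)
    (hle : L ≤ Um 0 / c) : IsPrincipalAtBot (p.waveMatrix c Um) L := by
  refine ⟨⟨hL, (h.hasEigenvalue_bot_iff L).2
    ⟨![jacobian p.F Um 0 1, p.perron Um - jacobian p.F Um 0 0, 0],
      fun hz => h.fv_Um_pos.ne' (congrFun hz 0), ?_, ?_, ?_⟩⟩, ?_⟩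
  · simp only [Matrix.cons_val]
    linear_combination jacobian p.F Um 0 1 * hroot
  · simp only [Matrix.cons_val]
    linear_combination (p.perron Um - jacobian p.F Um 0 0) * hroot - h.perron_root
  · simp
  · rintro r ⟨hr, heig⟩
    rcases h.eigenvalue_bot_ge hL hroot hr heig with h3 | h3
    · rw [h3]; exact hle
    · exact h3

theorem isPrincipalAtBot_of_lt {L : ℝ} (hL : 0 < L) (hroot : L ^ 2 + c * L + p.perron Um = 0)
    (hlt : Um 0 / c < L) : IsPrincipalAtBot (p.waveMatrix c Um) (Um 0 / c) := by
  have hc := h.c_pos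
  have hR := h.bottom_rate_pos
  set R := Um 0 / c with hRdef
  have hRc : c * R = Um 0 := by rw [hRdef]; field_simp
  have hdet := (h.det_pos (s := R ^ 2 + c * R) (by nlinarith)).ne'
  refine ⟨⟨hR, (h.hasEigenvalue_bot_iff R).2
    ⟨![(-jacobian p.F Um 0 2 * (R ^ 2 + c * R + jacobian p.F Um 1 1)
          + jacobian p.F Um 0 1 * jacobian p.F Um 1 2)
          / ((R ^ 2 + c * R + jacobian p.F Um 0 0) * (R ^ 2 + c * R + jacobian p.F Um 1 1)
            - jacobian p.F Um 0 1 * jacobian p.F Um 1 0),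
        (-(R ^ 2 + c * R + jacobian p.F Um 0 0) * jacobian p.F Um 1 2
          + jacobian p.F Um 1 0 * jacobian p.F Um 0 2)
          / ((R ^ 2 + c * R + jacobian p.F Um 0 0) * (R ^ 2 + c * R + jacobian p.F Um 1 1)
            - jacobian p.F Um 0 1 * jacobian p.F Um 1 0), 1],
      fun hz => one_ne_zero (congrFun hz 2), ?_, ?_, ?_⟩⟩, ?_⟩
  · simp only [Matrix.cons_val]
    linear_combination (-jacobian p.F Um 0 2) * mul_inv_cancel₀ hdet
  · simp only [Matrix.cons_val]
    linear_combination (-jacobian p.F Um 1 2) * mul_inv_cancel₀ hdet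
  · simp only [Matrix.cons_val]
    rw [hRc]; ring
  · rintro r ⟨hr, heig⟩
    rcases h.eigenvalue_bot_ge hL hroot hr heig with h3 | h3
    · exact h3.ge
    · exact hlt.le.trans h3

end IsFront

/-! ### The individual regimes -/

theorem rootMinus_spec {c q : ℝ} (h : 4 * q ≤ c ^ 2) :
    rootMinus c q ^ 2 + c * rootMinus c q + q = 0 := by
  have := Real.sq_sqrt (sub_nonneg.2 h)
  unfold rootMinus
  linear_combination this / 4

theorem rootMinus_neg {c q : ℝ} (hc : 0 < c) : rootMinus c q < 0 := by
  have := Real.sqrt_nonneg (c ^ 2 - 4 * q)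
  unfold rootMinus
  linarith

theorem rootMinus_simple {c q : ℝ} (h : 4 * q < c ^ 2) : 2 * rootMinus c q + c < 0 := by
  have := Real.sqrt_pos.2 (sub_pos.2 h)
  unfold rootMinus
  linarith

theorem neg_eq_rootMinus {c q ρ : ℝ} (h : ρ ^ 2 - c * ρ + q = 0) (hρ : c ≤ 2 * ρ) :
    -ρ = rootMinus c q := by
  have h1 : c ^ 2 - 4 * q = (2 * ρ - c) ^ 2 := by linear_combination -4 * h
  rw [rootMinus, h1, Real.sqrt_sq (by linarith)]
  ring

theorem neg_eq_rootPlus {c q ρ : ℝ} (h : ρ ^ 2 - c * ρ + q = 0) (hρ : 2 * ρ ≤ c) :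
    -ρ = rootPlus c q := by
  have h1 : c ^ 2 - 4 * q = (c - 2 * ρ) ^ 2 := by linear_combination -4 * h
  rw [rootPlus, h1, Real.sqrt_sq (by linarith)]
  ring

namespace IsFront

variable {p : Params} {c P : ℝ} {Up Um : Fin 3 → ℝ} {U : ℝ → Fin 3 → ℝ}
  (h : IsFront p c P Up Um U)

include h

theorem exists_logRate_pos (hq : jacobian p.F Up 0 0 ≠ 0) :
    ∃ ρ, 0 < ρ ∧ Tendsto (fun z => negDeriv U z 0 / U z 0) atTop (𝓝 ρ) ∧
      ρ ^ 2 - c * ρ + jacobian p.F Up 0 0 = 0 := by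
  obtain ⟨ρ, h0, hr, hroot⟩ := h.exists_logRate_limit
  refine ⟨ρ, lt_of_le_of_ne h0 ?_, hr, hroot⟩
  rintro rfl
  apply hq
  linarith

/-- For `f_u < 0` only the negative root is available. -/
theorem exists_logRate_of_neg (hq : jacobian p.F Up 0 0 < 0) :
    ∃ ρ, 0 < ρ ∧ Tendsto (fun z => negDeriv U z 0 / U z 0) atTop (𝓝 ρ) ∧
      ρ ^ 2 - c * ρ + jacobian p.F Up 0 0 = 0 ∧ c < ρ := by
  obtain ⟨ρ, h0, hr, hroot⟩ := h.exists_logRate_pos hq.ne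
  refine ⟨ρ, h0, hr, hroot, ?_⟩
  by_contra! hle
  nlinarith

theorem quadratic_neg_of_rootMinus_lt {q m : ℝ} (hq : q < 0) (hm : rootMinus c q < m)
    (hm0 : m < 0) : m ^ 2 + c * m + q < 0 := by
  have hc := h.c_pos
  have h1 := rootMinus_spec (c := c) (q := q) (by nlinarith [sq_nonneg c])
  have h2 := rootMinus_neg (q := q) hc
  have h3 : rootMinus c q + c < 0 := by
    by_contra! h0
    nlinarith [mul_nonneg h0 (neg_nonneg.2 h2.le)]
  nlinarith [mul_pos (sub_pos.2 hm) (neg_pos.2 (by linarith : m + rootMinus c q + c < 0))]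

theorem top_fu_lt_gv (hlt : p.fu Up < p.gv Up) :
    IsPrincipalAtTop (p.waveMatrix c Up) (rootMinus c (p.gv Up)) ∧
      RateAtTop Up U (rootMinus c (p.gv Up)) {1} := by
  have hc := h.c_pos
  have hgv : p.gv Up < 0 := h.gv_Up_neg
  have h4 : 4 * p.gv Up < c ^ 2 := by nlinarith [sq_nonneg c]
  have hspec := rootMinus_spec h4.le
  have hneg := rootMinus_neg (q := p.gv Up) hc
  refine ⟨h.isPrincipalAtTop_of_neg hgv hneg hspec hlt.le le_rfl (Or.inr rfl), ?_⟩
  obtain ⟨ρ, hρ, hr, hroot, hcρ⟩ := h.exists_logRate_of_neg (hlt.trans hgv)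
  refine h.rateAtTop_tension hρ hr hneg hspec (rootMinus_simple h4) ?_
  by_contra! hle
  rcases hle.eq_or_lt with heq | hlt'
  · rw [heq] at hspec
    have hfu : p.fu Up = jacobian p.F Up 0 0 := rfl
    linarith
  · have h5 := h.quadratic_neg_of_rootMinus_lt hgv hlt' (by linarith)
    have hfu : p.fu Up = jacobian p.F Up 0 0 := rfl
    rw [hfu] at hlt
    linarith

theorem top_fu_eq_gv (heq : p.fu Up = p.gv Up) :
    IsPrincipalAtTop (p.waveMatrix c Up) (rootMinus c (p.gv Up)) ∧
      RateAtTopLoss Up U (rootMinus c (p.gv Up)) Set.univ := by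
  have hc := h.c_pos
  have hgv : p.gv Up < 0 := h.gv_Up_neg
  have h4 : 4 * p.gv Up < c ^ 2 := by nlinarith [sq_nonneg c]
  refine ⟨h.isPrincipalAtTop_of_neg hgv (rootMinus_neg hc) (rootMinus_spec h4.le) heq.le le_rfl
    (Or.inr rfl), ?_⟩
  obtain ⟨ρ, hρ, hr, hroot, hcρ⟩ := h.exists_logRate_of_neg (heq.trans_lt hgv)
  have hρ' : -ρ = rootMinus c (p.gv Up) := by
    rw [← heq]
    exact neg_eq_rootMinus hroot (by linarith)
  rw [← hρ']
  refine h.rateAtTopLoss_of_logRate hρ hr fun m h1 h2 => ?_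
  rw [hρ'] at h1
  exact h.quadratic_neg_of_rootMinus_lt hgv h1 h2

theorem top_gv_lt_fu_neg (hlt : p.gv Up < p.fu Up) (hneg : p.fu Up < 0) :
    IsPrincipalAtTop (p.waveMatrix c Up) (rootMinus c (p.fu Up)) ∧
      RateAtTop Up U (rootMinus c (p.fu Up)) Set.univ := by
  have hc := h.c_pos
  have h4 : 4 * p.fu Up < c ^ 2 := by nlinarith [sq_nonneg c]
  refine ⟨h.isPrincipalAtTop_of_neg hneg (rootMinus_neg hc) (rootMinus_spec h4.le) le_rfl hlt.le
    (Or.inl rfl), ?_⟩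
  obtain ⟨ρ, hρ, hr, hroot, hcρ⟩ := h.exists_logRate_of_neg hneg
  have hρ' : -ρ = rootMinus c (p.fu Up) := neg_eq_rootMinus hroot (by linarith)
  rw [← hρ']
  exact h.rateAtTop_of_logRate hρ hr hroot (by linarith) hlt

/-- Above the minimal speed the steep decay rate is excluded by comparison with a slower wave. -/
theorem logRate_le_of_exceedsMinimalSpeed (hq : 0 < p.fu Up) {ρ : ℝ} (hρ : 0 < ρ)
    (hr : Tendsto (fun z => negDeriv U z 0 / U z 0) atTop (𝓝 ρ))
    (hroot : ρ ^ 2 - c * ρ + jacobian p.F Up 0 0 = 0) (hne : 2 * ρ ≠ c)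
    (hex : ExceedsMinimalSpeed p c Up Um) : 2 * ρ < c := by
  refine lt_of_le_of_ne ?_ hne
  by_contra! hlt
  obtain ⟨c', hcc, W, hWave⟩ := hex
  have hW : IsFront p c' P Up Um W := ⟨h.adm, h.P_nonneg, h.P_lt_one, h.Up_eq, h.Um_two, h.steady,
    h.stable, hWave⟩
  obtain ⟨ρ', hρ', hr', hroot'⟩ := hW.exists_logRate_pos (ne_of_gt hq)
  have hlt' : ρ' < ρ := by
    by_contra! hle
    nlinarith [mul_nonneg (sub_nonneg.2 hle) (by linarith : 0 ≤ ρ' + ρ - c),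
      mul_pos hρ' (sub_pos.2 hcc)]
  have hgv := h.gv_Up_neg
  have hqJ : 0 < jacobian p.F Up 0 0 := hq
  refine h.false_of_faster_decay hW hcc (l := -ρ) (l' := -(ρ + ρ') / 2) (by linarith) (fun i => ?_)
    fun i => ?_
  · exact isBigO_exp_integrate (by linarith) (h.decaysWith_top.hasDerivAt i)
      (fun z => h.negDeriv_pos z i) (h.decaysWith_top.tendsto i)
      (h.negDeriv_isBigO_top hr (by nlinarith) (h.u_sharp_top hρ hr hroot hne).1 i)
  · exact exp_isBigO_integrate (by linarith) (hW.decaysWith_top.hasDerivAt i)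
      (fun z => hW.negDeriv_pos z i) (hW.decaysWith_top.tendsto i)
      (hW.isBigO_negDeriv_top hρ' hr' (by linarith)
        (exp_isBigO_of_logDeriv_tendsto hW.hasDerivAt_u hW.u_pos hr'.neg (by linarith)) i)

theorem top_fu_pos (hq : 0 < p.fu Up) (hc2 : 2 * √(p.fu Up) < c) :
    IsPrincipalAtTop (p.waveMatrix c Up) (rootPlus c (p.fu Up)) ∧
      (ExceedsMinimalSpeed p c Up Um → RateAtTop Up U (rootPlus c (p.fu Up)) Set.univ) ∧
      (RateAtTop Up U (rootPlus c (p.fu Up)) Set.univ ∨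
        RateAtTop Up U (rootMinus c (p.fu Up)) Set.univ) := by
  have hsq := Real.sq_sqrt hq.le
  have h4 : 4 * p.fu Up < c ^ 2 := by nlinarith [Real.sqrt_nonneg (p.fu Up)]
  obtain ⟨ρ, hρ, hr, hroot⟩ := h.exists_logRate_pos (ne_of_gt hq)
  have hfu : p.fu Up = jacobian p.F Up 0 0 := rfl
  have hne : 2 * ρ ≠ c := by
    intro heq
    rw [hfu] at h4
    nlinarith
  have hrate := h.rateAtTop_of_logRate hρ hr hroot hne (h.gv_Up_neg.trans hq)
  refine ⟨h.isPrincipalAtTop_of_pos hq h4.le, fun hex => ?_, ?_⟩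
  · rw [hfu, ← neg_eq_rootPlus hroot
      (h.logRate_le_of_exceedsMinimalSpeed hq hρ hr hroot hne hex).le]
    exact hrate
  · rcases le_total (2 * ρ) c with hle | hle
    · left
      rw [hfu, ← neg_eq_rootPlus hroot hle]
      exact hrate
    · right
      rw [hfu, ← neg_eq_rootMinus hroot hle]
      exact hrate

theorem top_fu_pos_critical (hq : 0 < p.fu Up) (hc2 : c = 2 * √(p.fu Up)) :
    IsPrincipalAtTop (p.waveMatrix c Up) (rootPlus c (p.fu Up)) ∧
      RateAtTopLoss Up U (rootPlus c (p.fu Up)) Set.univ := by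
  have hsq := Real.sq_sqrt hq.le
  have h4 : c ^ 2 = 4 * p.fu Up := by rw [hc2]; linear_combination 4 * hsq
  refine ⟨h.isPrincipalAtTop_of_pos hq h4.ge, ?_⟩
  obtain ⟨ρ, hρ, hr, hroot⟩ := h.exists_logRate_pos (ne_of_gt hq)
  have hfu : p.fu Up = jacobian p.F Up 0 0 := rfl
  have hρc : 2 * ρ = c := by
    have : (2 * ρ - c) ^ 2 = 0 := by
      rw [hfu] at h4
      linear_combination 4 * hroot + h4
    linarith [pow_eq_zero_iff (two_ne_zero) |>.1 this]
  rw [hfu, ← neg_eq_rootPlus hroot hρc.le]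
  refine h.rateAtTopLoss_of_logRate hρ hr fun m h1 h2 => ?_
  nlinarith [h.gv_Up_neg]

theorem bot_police (hlt : Um 0 / c < (-c + √(c ^ 2 + 2 * p.mu2 Um)) / 2) :
    IsPrincipalAtBot (p.waveMatrix c Um) (Um 0 / c) ∧
      RateAtBot Um U (Um 0 / c) {i | i = 2 ∨ 0 < p.k1 ∨ 0 < p.k2} := by
  obtain ⟨hL, hroot⟩ := h.lamTwo_spec
  have hR := h.bottom_rate_pos
  have hc := h.c_pos
  refine ⟨h.isPrincipalAtBot_of_lt hL hroot hlt, h.rateAtBot hR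
    (h.negDeriv_isBigO_reflect (by nlinarith) h.Q_sharp.1) fun i hi => ?_⟩
  rcases hi with rfl | hk
  · exact h.Q_sharp.2.trans h.Q_isBigO_negDeriv_two
  · exact h.isBigO_of_police (by linarith) hk h.Q_sharp.2 i

theorem bot_resonant (heq : Um 0 / c = (-c + √(c ^ 2 + 2 * p.mu2 Um)) / 2) :
    IsPrincipalAtBot (p.waveMatrix c Um) (Um 0 / c) ∧
      RateAtBotLoss Um U (Um 0 / c) Set.univ := by
  obtain ⟨hL, hroot⟩ := h.lamTwo_spec
  rw [← heq] at hL hroot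
  have hc := h.c_pos
  refine ⟨h.isPrincipalAtBot_of_le hL hroot le_rfl, h.rateAtBotLoss hL (fun m h1 h2 =>
    h.negDeriv_isBigO_reflect (by nlinarith) (h.Q_isBigO h1)) fun m h1 i _ => ?_⟩
  have hQ := h.isBigO_Q h1
  by_cases hk : 0 < p.k0
  · have key := h.isBigO_of_perron (l := m) (by linarith) (h.fu_lt_perron_of_gu_pos (h.gu_Um_pos hk))
      (by nlinarith)
    exact forall_of_castSucc (R := fun i => (fun t => Real.exp (m * t)) =O[atTop]
      fun t => negDeriv U (-t) i) key (hQ.trans h.Q_isBigO_negDeriv_two) i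
  · exact h.isBigO_of_police (by linarith) (Or.inr (h.k0_pos_or_k2_pos.resolve_left hk)) hQ i

theorem bot_degenerate (hlt : (-c + √(c ^ 2 + 2 * p.mu2 Um)) / 2 < Um 0 / c)
    (hmu : p.mu1 Um = p.mu2 Um) :
    IsPrincipalAtBot (p.waveMatrix c Um) ((-c + √(c ^ 2 + 2 * p.mu2 Um)) / 2) ∧
      RateAtBotLoss Um U ((-c + √(c ^ 2 + 2 * p.mu2 Um)) / 2) {0, 1} := by
  obtain ⟨hL, hroot⟩ := h.lamTwo_spec
  have hc := h.c_pos
  obtain ⟨h1, h2⟩ := h.mu_eq_iff.1 hmu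
  have h3 := h.perron_eq_fu h2 h1.ge
  refine ⟨h.isPrincipalAtBot_of_le hL hroot hlt.le, h.rateAtBotLoss hL (fun m hm hm0 =>
    h.negDeriv_isBigO_reflect (by nlinarith) (h.Q_isBigO (by linarith))) fun m hm i hi => ?_⟩
  rcases hi with rfl | hi
  · exact h.isBigO_of_diag (by decide) (by linarith) (by rw [← h3]; nlinarith)
  · rw [Set.mem_singleton_iff] at hi
    subst hi
    exact h.isBigO_of_diag (by decide) (by linarith) (by rw [← h1, ← h3]; nlinarith)

theorem bot_simple (hlt : (-c + √(c ^ 2 + 2 * p.mu2 Um)) / 2 < Um 0 / c)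
    (hmu : p.mu1 Um ≠ p.mu2 Um) :
    IsPrincipalAtBot (p.waveMatrix c Um) ((-c + √(c ^ 2 + 2 * p.mu2 Um)) / 2) ∧
      RateAtBot Um U ((-c + √(c ^ 2 + 2 * p.mu2 Um)) / 2)
        {i | i = 0 ∨ (i = 1 ∧ (0 < p.k0 ∨ p.fu Um < p.gv Um))} := by
  obtain ⟨hL, hroot⟩ := h.lamTwo_spec
  refine ⟨h.isPrincipalAtBot_of_le hL hroot hlt.le, ?_⟩
  have hP : (fun t => negDeriv U (-t) 2) =O[atTop]
      fun t => Real.exp (-((-c + √(c ^ 2 + 2 * p.mu2 Um)) / 2) * t) :=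
    h.negDeriv_two_isBigO_Q.trans (h.Q_isBigO (by linarith))
  by_cases hk : 0 < p.k0 ∨ p.fu Um < p.gv Um
  · have hm : jacobian p.F Um 0 0 < p.perron Um := by
      rcases hk with hk | hk
      · exact h.fu_lt_perron_of_gu_pos (h.gu_Um_pos hk)
      · exact lt_of_lt_of_le hk h.le_perron.2
    have key := h.sharp_of_perron hL hroot hlt hm
    refine h.rateAtBot hL (forall_of_castSucc
      (R := fun i => (fun t => negDeriv U (-t) i) =O[atTop]
        fun t => Real.exp (-((-c + √(c ^ 2 + 2 * p.mu2 Um)) / 2) * t))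
      (fun i => (key i).1) hP) fun i hi => ?_
    rcases hi with rfl | ⟨rfl, -⟩
    · exact (key 0).2
    · exact (key 1).2
  · have hk0 : ¬ 0 < p.k0 := fun h0 => hk (Or.inl h0)
    have hle : jacobian p.F Um 1 1 ≤ jacobian p.F Um 0 0 := not_lt.1 fun h0 => hk (Or.inr h0)
    have hlt' : jacobian p.F Um 1 1 < jacobian p.F Um 0 0 := lt_of_le_of_ne hle fun heq =>
      hmu (h.mu_eq_iff.2 ⟨heq.symm, h.gu_Um_eq_zero hk0⟩)
    obtain ⟨h1, h2, h3⟩ := h.sharp_of_triangular hL hroot hlt hk0 hlt'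
    refine h.rateAtBot hL (fun i => ?_) fun i hi => ?_
    · rcases fin_three_cases i with rfl | rfl | rfl
      · exact h1
      · exact h2
      · exact hP
    · rcases hi with rfl | ⟨-, hi⟩
      · exact h3
      · exact absurd hi hk

end IsFront

end Protest

theorem mainTheorem5 (p : Protest.Params) (hp : p.Admissible) (c P : ℝ)
    (hP0 : 0 ≤ P) (hP1 : P < 1)
    (Up Um : Fin 3 → ℝ) (hUp : Up = p.trivialState P)
    (hUm : Um 2 = 1) (hss : p.F Um = 0)
    (hstab : p.fv Um * p.gu Um - p.fu Um * p.gv Um < 0)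
    (U : ℝ → Fin 3 → ℝ) (hU : Protest.IsMonotoneWave p c Up Um U) :
    -- as `z → +∞`
    (p.fu Up < p.gv Up →
      Protest.IsPrincipalAtTop (p.waveMatrix c Up) (Protest.rootMinus c (p.gv Up)) ∧
      Protest.RateAtTop Up U (Protest.rootMinus c (p.gv Up)) {1}) ∧
    (p.fu Up = p.gv Up →
      Protest.IsPrincipalAtTop (p.waveMatrix c Up) (Protest.rootMinus c (p.gv Up)) ∧
      Protest.RateAtTopLoss Up U (Protest.rootMinus c (p.gv Up)) Set.univ) ∧
    (p.gv Up < p.fu Up → p.fu Up < 0 →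
      Protest.IsPrincipalAtTop (p.waveMatrix c Up) (Protest.rootMinus c (p.fu Up)) ∧
      Protest.RateAtTop Up U (Protest.rootMinus c (p.fu Up)) Set.univ) ∧
    (0 < p.fu Up → 2 * √(p.fu Up) < c →
      Protest.IsPrincipalAtTop (p.waveMatrix c Up) (Protest.rootPlus c (p.fu Up)) ∧
      (Protest.ExceedsMinimalSpeed p c Up Um →
        Protest.RateAtTop Up U (Protest.rootPlus c (p.fu Up)) Set.univ) ∧
      (Protest.RateAtTop Up U (Protest.rootPlus c (p.fu Up)) Set.univ ∨
        Protest.RateAtTop Up U (Protest.rootMinus c (p.fu Up)) Set.univ)) ∧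
    (0 < p.fu Up → c = 2 * √(p.fu Up) →
      Protest.IsPrincipalAtTop (p.waveMatrix c Up) (Protest.rootPlus c (p.fu Up)) ∧
      Protest.RateAtTopLoss Up U (Protest.rootPlus c (p.fu Up)) Set.univ) ∧
    -- as `z → -∞`
    (Um 0 / c < (-c + √(c ^ 2 + 2 * p.mu2 Um)) / 2 →
      Protest.IsPrincipalAtBot (p.waveMatrix c Um) (Um 0 / c) ∧
      Protest.RateAtBot Um U (Um 0 / c) {i | i = 2 ∨ 0 < p.k1 ∨ 0 < p.k2}) ∧
    (Um 0 / c = (-c + √(c ^ 2 + 2 * p.mu2 Um)) / 2 →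
      Protest.IsPrincipalAtBot (p.waveMatrix c Um) (Um 0 / c) ∧
      Protest.RateAtBotLoss Um U (Um 0 / c) Set.univ) ∧
    ((-c + √(c ^ 2 + 2 * p.mu2 Um)) / 2 < Um 0 / c → p.mu1 Um = p.mu2 Um →
      Protest.IsPrincipalAtBot (p.waveMatrix c Um) ((-c + √(c ^ 2 + 2 * p.mu2 Um)) / 2) ∧
      Protest.RateAtBotLoss Um U ((-c + √(c ^ 2 + 2 * p.mu2 Um)) / 2) {0, 1}) ∧
    ((-c + √(c ^ 2 + 2 * p.mu2 Um)) / 2 < Um 0 / c → p.mu1 Um ≠ p.mu2 Um →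
      Protest.IsPrincipalAtBot (p.waveMatrix c Um) ((-c + √(c ^ 2 + 2 * p.mu2 Um)) / 2) ∧
      Protest.RateAtBot Um U ((-c + √(c ^ 2 + 2 * p.mu2 Um)) / 2)
        {i | i = 0 ∨ (i = 1 ∧ (0 < p.k0 ∨ p.fu Um < p.gv Um))}) := by
  have h : Protest.IsFront p c P Up Um U := ⟨hp, hP0, hP1, hUp, hUm, hss, hstab, hU⟩
  exact ⟨h.top_fu_lt_gv, h.top_fu_eq_gv, h.top_gv_lt_fu_neg, h.top_fu_pos, h.top_fu_pos_critical,
    h.bot_police, h.bot_resonant, h.bot_degenerate, h.bot_simple⟩
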